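/- Let $d\ge 1$, let $\mathbb S^d\subset\mathbb R^{d+1}$ be the unit sphere with surface measure $\sigma$, geodesic (angular) distance $\mathrm{dist}$, north pole $0$ and closed caps $B_u(\theta)=\{\theta':\mathrm{dist}(\theta',\theta)\le u\}$. Let $\Lambda^{(i)}(\theta)$, $\theta\in\mathbb S^d$, $i=0,1,2,\dots$, be independent, jointly measurable random fields on a probability space, each almost surely non-negative, with $E\Lambda^{(i)}(\theta)=1$ and $E(\Lambda^{(i)}(\theta))^2<\infty$. Let $b>1$, $p\ge 2$, $k\ge 2$ and $p_1,\dots,p_k\ge 1$ with $p_1+\dots+p_k=p$, and assume the following. 1. There is a non-increasing function $\rho:[0,\infty)\to\mathbb R$ with $E\prod_{j=1}^k(\Lambda^{(i)}(\theta_j))^{p_j}\le\rho\big(b^i\min_{m\ne h}\mathrm{dist}(\theta_m,\theta_h)\big)$ for all $i$ and $\theta_1,\dots,\theta_k\in\mathbb S^d$, such that $b>\rho(0)^{1/d}$ and $\sum_{i\ge 0}\ln\rho(b^i)<\infty$. 2. Each $\Lambda^{(i)}$ is strongly isotropic (its finite-dimensional distributions are invariant under $SO(d+1)$), and $E(\Lambda^{(i)}(0))^q=E(\Lambda^{(j)}(\theta))^q$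 for all $i,j$, $\theta\in\mathbb S^d$ and $q\in[0,p]$. 3. For every $q\in(0,1)$ there is a non-decreasing function $\rho_q:[0,\infty)\to\mathbb R$ with $E\big[(\Lambda^{(i)}(\theta_1))^{q-1}\Lambda^{(i)}(\theta_2)\big]\le\rho_q\big(b^i\,\mathrm{dist}(\theta_1,\theta_2)\big)$ for all $i,\theta_1,\theta_2$, such that $\sum_{i\ge 0}\ln\frac{\rho_q(b^{-i})}{E(\Lambda^{(i)}(0))^q}<\infty$. 4. For every $q\in[1,p]$ there are a point $\tilde\theta\in\mathbb S^d$ and a positive non-increasing function $\upsilon_q$ on $[0,\infty)$ with $\upsilon_q(b^ix)\le E\prod_{j=1}^k(\Lambda^{(i)}(\theta_j))^{q/k}$ for all $i$, $x\in[0,\pi]$ and $\theta_1,\dots,\theta_k\in B_x(\tilde\theta)$, such that $\sum_{i\ge 0}\ln\frac{E(\Lambda^{(i)}(\tilde\theta))^q}{\upsilon_q(b^{-i})}<\infty$. Let $\mu_n(B)=\int_B\prod_{i=0}^n\Lambda^{(i)}(\theta)\,\sigma(d\theta)$. A dyadic decomposition of $\mathbb S^d$ is a sequence of nested finite Borel partitions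 $\Delta_l=\{\Delta_l^{(m)}\}_m$, $l=0,1,\dots$, for which there are constants $c,C>0$ such that for all $l,m$ one has $B_{c2^{-l}}(\theta)\subset\Delta_l^{(m)}\subset B_{C2^{-l}}(\theta)$ for some point $\theta$. Fix a dyadic decomposition and a countable system $\mathfrak B$ of Borel sets that contains all of its cells. Then there is a random measure $\mu$ on $\mathbb S^d$ with $\mu_n(B)\to\mu(B)$ almost surely for all $B\in\mathfrak B$, and for every such limiting measure the Rényi function $$\tau_\mu(q)=\liminf_{l\to\infty}\frac{\log\sum_m E\,\mu(\Delta_l^{(m)})^q}{\log\sigma(\Delta_l^{(0)})}$$ (with $x^0=1$ for every $x\ge 0$) is $$\tau_\mu(q)=q-1-\frac1d\log_bE\big(\Lambda^{(0)}(0)\big)^q,\qquad q\in[0,p].$$ -/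

import Mathlib

open MeasureTheory ProbabilityTheory Filter Topology
open scoped ENNReal

noncomputable section

/-- The unit sphere of dimension `d`, inside Euclidean space of dimension `d + 1`. -/
abbrev Sph (d : ℕ) : Type := Metric.sphere (0 : EuclideanSpace ℝ (Fin (d + 1))) 1

/-- The Lebesgue (surface) measure on the sphere. -/
def surfaceMeasure (d : ℕ) : Measure (Sph d) :=
  (volume : Measure (EuclideanSpace ℝ (Fin (d + 1)))).toSphere

/-- The angular (great circle) distance. -/
def angDist {d : ℕ} (x y : Sph d) : ℝ :=
  InnerProductGeometry.angle (x : EuclideanSpace ℝ (Fin (d + 1))) y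

/-- The closed spherical cap of angular radius `u` around `x`. -/
def sphCap {d : ℕ} (x : Sph d) (u : ℝ) : Set (Sph d) := {y | angDist y x ≤ u}

/-- The north pole. -/
def northPole (d : ℕ) : Sph d := ⟨EuclideanSpace.single 0 1, by simp⟩

/-- The action of a linear isometry of the ambient space on the sphere. -/
def actSph {d : ℕ}
    (g : EuclideanSpace ℝ (Fin (d + 1)) ≃ₗᵢ[ℝ] EuclideanSpace ℝ (Fin (d + 1)))
    (x : Sph d) : Sph d := ⟨g x, by simp⟩

/-- The least angular distance between two entries, with different indices, of a tuple of
points. -/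
def minDist {d k : ℕ} (θ : Fin k → Sph d) : ℝ :=
  ⨅ mh : {mh : Fin k × Fin k // mh.1 ≠ mh.2}, angDist (θ mh.1.1) (θ mh.1.2)

variable {Ω : Type*} [MeasurableSpace Ω]

/-- The law of the field is invariant under rotations (all finite-dimensional distributions are
unchanged by isometries of determinant one). -/
def StronglyIsotropic {d : ℕ} (P : Measure Ω) (T : Sph d → Ω → ℝ) : Prop :=
  ∀ (k : ℕ) (θ : Fin k → Sph d)
    (g : EuclideanSpace ℝ (Fin (d + 1)) ≃ₗᵢ[ℝ] EuclideanSpace ℝ (Fin (d + 1))),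
    LinearMap.det (g.toLinearEquiv :
      EuclideanSpace ℝ (Fin (d + 1)) →ₗ[ℝ] EuclideanSpace ℝ (Fin (d + 1))) = 1 →
    IdentDistrib (fun ω j => T (θ j) ω) (fun ω j => T (actSph g (θ j)) ω) P P

/-- A jointly measurable, almost surely non-negative random field on the sphere with unit mean
and finite second moments. -/
structure IsMotherField {d : ℕ} (P : Measure Ω) (T : Sph d → Ω → ℝ) : Prop where
  measurable : Measurable fun x : Sph d × Ω => T x.1 x.2
  nonneg : ∀ᵐ ω ∂P, ∀ θ, 0 ≤ T θ ω
  memLp_two : ∀ θ, MemLp (T θ) 2 P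
  mean_eq_one : ∀ θ, ∫ ω, T θ ω ∂P = 1

/-- The mixed moment `E ∏ⱼ T(θⱼ)^{aⱼ}` of a non-negative field, with values in `[0, ∞]`
(a negative power of zero is `∞`, and `0 * ∞ = 0`). -/
def mixedMoment {d k : ℕ} (P : Measure Ω) (T : Sph d → Ω → ℝ) (θ : Fin k → Sph d)
    (a : Fin k → ℝ) : ℝ≥0∞ :=
  ∫⁻ ω, ∏ j, ENNReal.ofReal (T (θ j) ω) ^ a j ∂P

/-- The moment `E X ^ q` of a non-negative random variable, with values in `[0, ∞]`. -/
def powMoment (P : Measure Ω) (X : Ω → ℝ) (q : ℝ) : ℝ≥0∞ :=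
  ∫⁻ ω, ENNReal.ofReal (X ω) ^ q ∂P

/-- The mixing bound with exponent vector `a`, scale `b` and bounding function `ρ`. -/
def MixingBound {d k : ℕ} (P : Measure Ω) (Λ : ℕ → Sph d → Ω → ℝ) (b : ℝ) (a : Fin k → ℝ)
    (ρ : ℝ → ℝ) : Prop :=
  ∀ (i : ℕ) (θ : Fin k → Sph d),
    mixedMoment P (Λ i) θ a ≤ ENNReal.ofReal (ρ (b ^ i * minDist θ))

/-- The lower bound for mixed moments on caps around `θ₀`, with exponent vector `a`, scale `b`
and bounding function `υ`. -/
def LowerMomentBound {d k : ℕ} (P : Measure Ω) (Λ : ℕ → Sph d → Ω → ℝ) (b : ℝ) (θ₀ : Sph d)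
    (a : Fin k → ℝ) (υ : ℝ → ℝ) : Prop :=
  ∀ (i : ℕ) (x : ℝ), x ∈ Set.Icc 0 Real.pi → ∀ θ : Fin k → Sph d, (∀ j, θ j ∈ sphCap θ₀ x) →
    ENNReal.ofReal (υ (b ^ i * x)) ≤ mixedMoment P (Λ i) θ a

/-- The conditions for convergence of the cumulative measures: the fields are as in
`IsMotherField`, independent of each other, and mixing with exponent vector `a`. -/
structure ConvergenceConditions {d k : ℕ} (P : Measure Ω) (Λ : ℕ → Sph d → Ω → ℝ) (b p : ℝ)
    (a : Fin k → ℝ) : Prop where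
  field : ∀ i, IsMotherField P (Λ i)
  indep : iIndepFun (fun (i : ℕ) (ω : Ω) (θ : Sph d) => Λ i θ ω) P
  one_lt_scale : 1 < b
  two_le_card : 2 ≤ k
  one_le_exponent : ∀ j, 1 ≤ a j
  sum_exponent : ∑ j, a j = p
  two_le : 2 ≤ p
  mixing : ∃ ρ : ℝ → ℝ, AntitoneOn ρ (Set.Ici 0) ∧ MixingBound P Λ b a ρ ∧
    ρ 0 ^ (1 / (d : ℝ)) < b ∧ Summable fun i : ℕ => Real.log (ρ (b ^ i))

/-- Strong isotropy, and equality of the moments of order `q ∈ [0, p]`. -/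
structure IsotropyConditions {d : ℕ} (P : Measure Ω) (Λ : ℕ → Sph d → Ω → ℝ) (p : ℝ) :
    Prop where
  isotropic : ∀ i, StronglyIsotropic P (Λ i)
  moments : ∀ q ∈ Set.Icc 0 p, ∀ (i j : ℕ) (θ : Sph d),
    powMoment P (Λ i (northPole d)) q = powMoment P (Λ j θ) q

/-- The condition on the fields for an exponent `q ∈ (0, 1)`. -/
def SmallExponentCondition {d : ℕ} (P : Measure Ω) (Λ : ℕ → Sph d → Ω → ℝ) (b q : ℝ) : Prop :=
  ∃ ρ : ℝ → ℝ, MonotoneOn ρ (Set.Ici 0) ∧ MixingBound P Λ b ![q - 1, 1] ρ ∧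
    Summable fun i : ℕ =>
      Real.log (ρ ((b ^ i)⁻¹) / (powMoment P (Λ i (northPole d)) q).toReal)

/-- The condition on the fields for an exponent `q ≥ 1`; `k` is the length of the exponent
vector. -/
def LargeExponentCondition {d : ℕ} (P : Measure Ω) (Λ : ℕ → Sph d → Ω → ℝ) (b : ℝ) (k : ℕ)
    (q : ℝ) : Prop :=
  ∃ (θ₀ : Sph d) (υ : ℝ → ℝ), AntitoneOn υ (Set.Ici 0) ∧ (∀ x, 0 ≤ x → 0 < υ x) ∧
    LowerMomentBound P Λ b θ₀ (fun _ : Fin k => q / k) υ ∧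
    Summable fun i : ℕ => Real.log ((powMoment P (Λ i θ₀) q).toReal / υ ((b ^ i)⁻¹))

/-- The cumulative random measure `B ↦ ∫_B ∏_{i ≤ n} Λ⁽ⁱ⁾(θ) σ(dθ)`. -/
def cumMeasure {d : ℕ} (Λ : ℕ → Sph d → Ω → ℝ) (n : ℕ) (ω : Ω) : Measure (Sph d) :=
  (surfaceMeasure d).withDensity
    fun θ => ENNReal.ofReal (∏ i ∈ Finset.range (n + 1), Λ i θ ω)

/-- The random measure `μ` is the limit of the cumulative measures on the system `𝔅` of sets:
almost surely, for every `B ∈ 𝔅`, the masses of `B` converge to the mass `μ B`. -/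
def IsLimitingMeasure {d : ℕ} (P : Measure Ω) (Λ : ℕ → Sph d → Ω → ℝ) (𝔅 : Set (Set (Sph d)))
    (μ : Kernel Ω (Sph d)) : Prop :=
  ∀ᵐ ω ∂P, ∀ B ∈ 𝔅, Tendsto (fun n => cumMeasure Λ n ω B) atTop (𝓝 (μ ω B))

/-- A dyadic decomposition of the sphere: a nested sequence of finite Borel partitions such that
each cell of level `l` contains and is contained in caps with a common centre and radii
comparable to `2 ^ (-l)`. The number of cells of level `l` is `last l + 1`. -/
structure DyadicDecomposition (d : ℕ) where
  last : ℕ → ℕ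
  cell : (l : ℕ) → Fin (last l + 1) → Set (Sph d)
  measurableSet_cell : ∀ l m, MeasurableSet (cell l m)
  disjoint_cell : ∀ l m m', m ≠ m' → Disjoint (cell l m) (cell l m')
  iUnion_cell : ∀ l, ⋃ m, cell l m = Set.univ
  nested : ∀ l m, ∃ m', cell (l + 1) m ⊆ cell l m'
  caps : ∃ c C : ℝ, 0 < c ∧ 0 < C ∧ ∀ l m, ∃ x : Sph d,
    sphCap x (c * (1 / 2) ^ l) ⊆ cell l m ∧ cell l m ⊆ sphCap x (C * (1 / 2) ^ l)

/-- The Rényi function of a random measure along a dyadic decomposition, with values in the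
extended real line. -/
def renyi {d : ℕ} (P : Measure Ω) (D : DyadicDecomposition d) (μ : Kernel Ω (Sph d)) (q : ℝ) :
    EReal :=
  liminf (fun l : ℕ =>
    ENNReal.log (∑ m, ∫⁻ ω, (μ ω (D.cell l m)) ^ q ∂P) /
      ENNReal.log (surfaceMeasure d (D.cell l 0))) atTop

end

/-!
The cumulative mass of a set `B` is a non-negative martingale in the number of factors. Write
`K q` for the common moment of order `q` of the fields, and let `B` be a cell of diameter about
`b ^ (-n)`. The first `n` fields vary little over `B`, and the remaining fields, seen at the scale
of `B`, look like the whole cascade at scale one. Therefore the limiting mass has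
`E μ(B) ^ q ≍ σ(B) ^ q * (K q) ^ n`, with constants that do not depend on the cell. There are about
`2 ^ (l d)` cells of level `l`, each with measure about `2 ^ (-l d)` and with
`n = l * log_b 2 + O(1)`, so that the sum over the cells is of exact order `2 ^ (l s)` with
`s = d - d q + log_b (K q)`, and division by `log σ(B) = -l d log 2 + O(1)` gives the formula.

The two-sided estimate is `exists_moment_bounds`. It rests on the following points.

* The fields with index at least `n` have mass bounded in `L^p`, uniformly in the cells
  (`exists_lintegral_mass_rpow_le`). Jensen's inequality bounds the moment of order `p` by an
  average of mixed moments over tuples of points. By the mixing condition the mixed moment at points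
  with least distance `u`, in units of the diameter of the cell, is at most of order `u ^ (-β)` with
  `β < d`, and this is integrable.
* Jensen's inequality with respect to the mass of the fields with index at least `n` bounds the
  moment from above by `(K q) ^ n` if `q ≥ 1` and from below if `q ≤ 1`
  (`IsCascade.lintegral_mass_rpow_le`, `IsCascade.le_lintegral_mass_rpow`).
* The opposite bounds concern the first `n` fields only, since the martingale property makes moments
  monotone in the number of factors. They follow from two-point moments at distances up to
  `b ^ (-n)` (`IsCascade.lintegral_mass_rpow_le_of_pair`,
  `IsCascade.le_lintegral_mass_rpow_of_pair`); by the summability conditions these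
  differ from `(K q) ^ n` by a bounded factor
  (`exists_pair_moment_le`, `exists_le_pair_moment`).

The boundedness in `L^p` also gives uniform integrability. Hence no mass is lost in the limit, the
limits of the masses are almost surely countably additive along any given sequence of sets, and they
are the values of a random measure (`IsCascade.exists_limit_kernel`).
-/

/-! ### Averages of random fields and measurability -/

/-- The case of bounded functions of `exists_measurable_ae_eq_lintegral`. -/
lemma exists_measurable_ae_eq_lintegral_of_le {Ω S : Type*} {m mΩ : MeasurableSpace Ω}
    [MeasurableSpace S] (hm : m ≤ mΩ) (P : Measure Ω) [IsProbabilityMeasure P]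
    (ν : Measure S) [IsFiniteMeasure ν] (f : S → Ω → ℝ≥0∞)
    (hf : Measurable fun x : S × Ω => f x.1 x.2) (hfm : ∀ θ, Measurable[m] (f θ))
    (C : ℝ) (hC : ∀ θ ω, f θ ω ≤ ENNReal.ofReal C) :
    ∃ Y : Ω → ℝ≥0∞, Measurable[m] Y ∧ (fun ω => ∫⁻ θ, f θ ω ∂ν) =ᵐ[P] Y := by
  have hC0 : ∀ θ ω, f θ ω ≠ ∞ := fun θ ω => ((hC θ ω).trans_lt ENNReal.ofReal_lt_top).ne
  set F : S → Ω → ℝ := fun θ ω => (f θ ω).toReal with hF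
  have hFb : ∀ θ ω, ‖F θ ω‖ ≤ max C 0 := fun θ ω => by
    simp only [hF, Real.norm_eq_abs, abs_of_nonneg ENNReal.toReal_nonneg]
    exact (ENNReal.toReal_mono ENNReal.ofReal_ne_top (hC θ ω)).trans (by
      rw [ENNReal.toReal_ofReal'])
  have hFmeas : Measurable fun x : S × Ω => F x.1 x.2 := hf.ennreal_toReal
  have hFmeas' : Measurable fun x : Ω × S => F x.2 x.1 := hFmeas.comp measurable_swap
  have hFθ : ∀ θ, Measurable (F θ) := fun θ => hFmeas.comp measurable_prodMk_left
  set y : Ω → ℝ := fun ω => ∫ θ, F θ ω ∂ν with hy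
  have hym : StronglyMeasurable y :=
    (hFmeas'.stronglyMeasurable).integral_prod_right
  have hyb : ∀ ω, ‖y ω‖ ≤ max C 0 * ν.real Set.univ := fun ω =>
    norm_integral_le_of_norm_le_const (ae_of_all _ fun θ => hFb θ ω)
  have hyi : Integrable y P := Integrable.of_bound hym.aestronglyMeasurable _ (ae_of_all _ hyb)
  -- swapping the integrals against a bounded weight
  have hswap : ∀ w : Ω → ℝ, AEStronglyMeasurable w P → (∃ c, ∀ᵐ ω ∂P, ‖w ω‖ ≤ c) →
      ∫ ω, w ω * y ω ∂P = ∫ θ, ∫ ω, w ω * F θ ω ∂P ∂ν := by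
    rintro w hw ⟨c, hwc⟩
    simp only [hy, ← integral_const_mul]
    refine integral_integral_swap ?_
    have hwm : AEStronglyMeasurable (fun x : Ω × S => w x.1) (P.prod ν) := hw.comp_fst
    refine Integrable.of_bound (hwm.mul hFmeas'.aestronglyMeasurable) (c * max C 0) ?_
    have := (Measure.quasiMeasurePreserving_fst (μ := P) (ν := ν)).ae hwc
    filter_upwards [this] with x hx
    simp only [Function.uncurry, norm_mul]
    gcongr
    · exact (norm_nonneg _).trans hx
    · exact hFb _ _
  have hae : y =ᵐ[P] P[y|m] := by
    refine Integrable.ae_eq_of_forall_setIntegral_eq _ _ hyi integrable_condExp ?_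
    intro A hA _
    set z := P[A.indicator (fun _ => (1 : ℝ))|m] with hz
    have h1i : Integrable (A.indicator (fun _ => (1 : ℝ))) P :=
      (integrable_const 1).indicator hA
    have hzb : ∀ᵐ ω ∂P, ‖z ω‖ ≤ (1 : NNReal) := by
      have := ae_bdd_abs_condExp_of_ae_bdd_abs (m := m) (R := (1 : ℝ)) (μ := P)
        (f := A.indicator (fun _ => (1 : ℝ))) (ae_of_all _ fun ω => by
          by_cases h : ω ∈ A <;> simp [h])
      simpa using this
    have e1 : ∀ g : Ω → ℝ, ∫ ω in A, g ω ∂P = ∫ ω, A.indicator (fun _ => (1 : ℝ)) ω * g ω ∂P := by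
      intro g
      rw [← integral_indicator hA]
      congr 1 with ω
      by_cases h : ω ∈ A <;> simp [h]
    have e2 : ∀ g : Ω → ℝ, StronglyMeasurable[m] g → Integrable g P →
        ∫ ω, A.indicator (fun _ => (1 : ℝ)) ω * g ω ∂P = ∫ ω, z ω * g ω ∂P := by
      intro g hg hgi
      have hi : Integrable (A.indicator (fun _ => (1 : ℝ)) * g) P := by
        have := hgi.indicator hA
        refine this.congr (ae_of_all _ fun ω => ?_)
        by_cases h : ω ∈ A <;> simp [h]
      have := condExp_mul_of_stronglyMeasurable_right (μ := P) hg hi h1i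
      have h3 := integral_congr_ae this
      rw [integral_condExp hm] at h3
      exact h3
    rw [e1, e1, hswap _ h1i.aestronglyMeasurable
      ⟨1, ae_of_all _ fun ω => by by_cases h : ω ∈ A <;> simp [h]⟩,
      e2 _ stronglyMeasurable_condExp integrable_condExp]
    have : ∀ θ, ∫ ω, A.indicator (fun _ => (1 : ℝ)) ω * F θ ω ∂P = ∫ ω, z ω * F θ ω ∂P :=
      fun θ => e2 _ (hfm θ).ennreal_toReal.stronglyMeasurable
        (Integrable.of_bound (hFθ θ).aestronglyMeasurable _ (ae_of_all _ (hFb θ)))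
    simp_rw [this]
    rw [← hswap z integrable_condExp.aestronglyMeasurable ⟨_, hzb⟩]
    have hzy : Integrable (z * y) P := by
      refine Integrable.bdd_mul (c := ((1 : NNReal) : ℝ)) hyi
        integrable_condExp.aestronglyMeasurable hzb
    have := condExp_mul_of_stronglyMeasurable_left (μ := P)
      (stronglyMeasurable_condExp : StronglyMeasurable[m] z) hzy hyi
    have h2 := integral_congr_ae this
    rw [integral_condExp hm] at h2
    exact h2
  refine ⟨fun ω => ENNReal.ofReal (P[y|m] ω),
    (stronglyMeasurable_condExp.measurable).ennreal_ofReal, ?_⟩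
  filter_upwards [hae] with ω hω
  rw [← hω, hy]
  have hint : Integrable (fun θ => F θ ω) ν :=
    Integrable.of_bound (hFmeas.comp measurable_prodMk_right).aestronglyMeasurable _
      (ae_of_all _ fun θ => hFb θ ω)
  rw [ofReal_integral_eq_lintegral_ofReal hint (ae_of_all _ fun θ => ENNReal.toReal_nonneg)]
  refine lintegral_congr fun θ => ?_
  rw [hF, ENNReal.ofReal_toReal (hC0 θ ω)]

/-- If each `f θ` is measurable with respect to a sub-σ-algebra `m`, then so is, up to a null set,
the average of `f` over `θ`. Joint measurability is needed with respect to the large σ-algebra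
only; the average is unchanged by conditioning on `m`, since `E (∫ f) 1_A = ∫ E f P[A|m]`. -/
lemma exists_measurable_ae_eq_lintegral {Ω S : Type*} {m mΩ : MeasurableSpace Ω}
    [MeasurableSpace S] (hm : m ≤ mΩ) (P : Measure Ω) [IsProbabilityMeasure P]
    (ν : Measure S) [IsFiniteMeasure ν] (f : S → Ω → ℝ≥0∞)
    (hf : Measurable fun x : S × Ω => f x.1 x.2) (hfm : ∀ θ, Measurable[m] (f θ)) :
    ∃ Y : Ω → ℝ≥0∞, Measurable[m] Y ∧ (fun ω => ∫⁻ θ, f θ ω ∂ν) =ᵐ[P] Y := by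
  have h : ∀ n : ℕ, ∃ Y : Ω → ℝ≥0∞, Measurable[m] Y ∧
      (fun ω => ∫⁻ θ, min (f θ ω) n ∂ν) =ᵐ[P] Y := fun n =>
    exists_measurable_ae_eq_lintegral_of_le hm P ν (fun θ ω => min (f θ ω) n)
      (hf.min measurable_const) (fun θ => (hfm θ).min measurable_const) n
      fun θ ω => by simp
  choose Y hY hYe using h
  refine ⟨fun ω => ⨆ n, Y n ω, Measurable.iSup hY, ?_⟩
  filter_upwards [ae_all_iff.2 hYe] with ω hω
  simp_rw [← hω]
  rw [← lintegral_iSup]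
  · refine lintegral_congr fun θ => ?_
    refine le_antisymm ?_ (iSup_le fun n => min_le_left _ _)
    rw [← inf_iSup_eq, ENNReal.iSup_natCast]
    simp
  · exact fun n => (hf.comp measurable_prodMk_right).min measurable_const
  · intro a b hab θ
    exact min_le_min le_rfl (by exact_mod_cast hab)

/-! ### Products of independent fields -/

/-- The σ-algebra generated by the values at all points of the fields with index in `s`. -/
abbrev fieldSigma {Ω S : Type*} (L : ℕ → S → Ω → ℝ≥0∞) (s : Finset ℕ) : MeasurableSpace Ω :=
  ⨆ i ∈ (s : Set ℕ), MeasurableSpace.comap (fun ω θ => L i θ ω) MeasurableSpace.pi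

lemma fieldSigma_mono {Ω S : Type*} {L : ℕ → S → Ω → ℝ≥0∞} {s t : Finset ℕ}
    (h : s ⊆ t) : fieldSigma L s ≤ fieldSigma L t :=
  biSup_mono fun _ hi => h hi

lemma measurable_prod_field {Ω S : Type*} {L : ℕ → S → Ω → ℝ≥0∞} (s : Finset ℕ) (θ : S) :
    Measurable[fieldSigma L s] fun ω => ∏ i ∈ s, L i θ ω := by
  refine Finset.measurable_fun_prod _ fun i hi => ?_
  have h1 : Measurable[MeasurableSpace.comap (fun ω θ => L i θ ω) MeasurableSpace.pi]
      fun ω => L i θ ω :=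
    (measurable_pi_apply θ).comp (comap_measurable fun ω θ => L i θ ω)
  exact h1.mono (le_iSup₂_of_le i hi le_rfl) le_rfl

section Cascade
variable {Ω S : Type*} [MeasurableSpace Ω] [MeasurableSpace S]

/-- Independent, jointly measurable, finite non-negative random fields of mean one on a
measurable space `S`. -/
structure IsCascade (P : Measure Ω) (L : ℕ → S → Ω → ℝ≥0∞) : Prop where
  measurable : ∀ i, Measurable fun x : S × Ω => L i x.1 x.2
  indep : iIndepFun (fun (i : ℕ) (ω : Ω) (θ : S) => L i θ ω) P
  mean_eq_one : ∀ i θ, ∫⁻ ω, L i θ ω ∂P = 1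
  ne_top : ∀ i θ ω, L i θ ω ≠ ∞

/-- The total mass of the measure with density `∏ i ∈ s, L i` with respect to `ν`. -/
noncomputable def mass (L : ℕ → S → Ω → ℝ≥0∞) (ν : Measure S) (s : Finset ℕ) (ω : Ω) : ℝ≥0∞ :=
  ∫⁻ θ, ∏ i ∈ s, L i θ ω ∂ν

variable {P : Measure Ω} {L : ℕ → S → Ω → ℝ≥0∞}

lemma IsCascade.measurable_process (hL : IsCascade P L) (i : ℕ) : Measurable fun ω θ => L i θ ω :=
  measurable_pi_lambda _ fun _ => (hL.measurable i).comp measurable_prodMk_left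

lemma IsCascade.fieldSigma_le (hL : IsCascade P L) (s : Finset ℕ) :
    fieldSigma L s ≤ ‹MeasurableSpace Ω› :=
  iSup₂_le fun i _ => (hL.measurable_process i).comap_le

lemma IsCascade.measurable_prod (hL : IsCascade P L) (s : Finset ℕ) :
    Measurable fun x : S × Ω => ∏ i ∈ s, L i x.1 x.2 :=
  Finset.measurable_fun_prod _ fun i _ => hL.measurable i

lemma IsCascade.measurable_prod_left (hL : IsCascade P L) (s : Finset ℕ) (ω : Ω) :
    Measurable fun θ => ∏ i ∈ s, L i θ ω :=
  (hL.measurable_prod s).comp measurable_prodMk_right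

lemma IsCascade.measurable_prod_right (hL : IsCascade P L) (s : Finset ℕ) (θ : S) :
    Measurable fun ω => ∏ i ∈ s, L i θ ω :=
  (hL.measurable_prod s).comp measurable_prodMk_left

lemma IsCascade.measurable_mass (hL : IsCascade P L) (ν : Measure S) [SFinite ν] (s : Finset ℕ) :
    Measurable (mass L ν s) :=
  (hL.measurable_prod s).lintegral_prod_left'

/-- The mass is only almost surely equal to a function of the fields with index in `s`, since the
fields need not be jointly measurable with respect to `fieldSigma L s`. -/
lemma IsCascade.exists_mass_version (hL : IsCascade P L) [IsProbabilityMeasure P]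
    (ν : Measure S) [IsFiniteMeasure ν] (s : Finset ℕ) :
    ∃ Y, Measurable[fieldSigma L s] Y ∧ mass L ν s =ᵐ[P] Y :=
  exists_measurable_ae_eq_lintegral (hL.fieldSigma_le s) P ν _ (hL.measurable_prod s)
    (measurable_prod_field s)

/-- Functions of disjoint families of fields are independent. -/
lemma IsCascade.lintegral_mul (hL : IsCascade P L) {s t : Finset ℕ} (hst : Disjoint s t)
    {f g : Ω → ℝ≥0∞} (hf : Measurable[fieldSigma L s] f) (hg : Measurable[fieldSigma L t] g) :
    ∫⁻ ω, f ω * g ω ∂P = (∫⁻ ω, f ω ∂P) * ∫⁻ ω, g ω ∂P := by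
  refine lintegral_mul_eq_lintegral_mul_lintegral_of_independent_measurableSpace
    (hL.fieldSigma_le s) (hL.fieldSigma_le t) ?_ hf hg
  refine indep_iSup_of_disjoint (fun i => (hL.measurable_process i).comap_le) ?_
    (by exact_mod_cast hst)
  exact (iIndepFun_iff_iIndep _ _ _).1 hL.indep

lemma ENNReal.prod_rpow_of_forall_ne_top {ι : Type*} (s : Finset ι) (f : ι → ℝ≥0∞)
    (hf : ∀ i, f i ≠ ∞) (r : ℝ) : (∏ i ∈ s, f i) ^ r = ∏ i ∈ s, f i ^ r := by
  classical
  induction s using Finset.induction with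
  | empty => simp
  | insert i s hi ih =>
    rw [Finset.prod_insert hi, Finset.prod_insert hi, ← ih,
      ENNReal.mul_rpow_of_ne_top (hf i) (ENNReal.prod_ne_top fun j _ => hf j)]

/-- The mixed moments of a product of independent fields are the products of the mixed moments of
the factors. -/
lemma IsCascade.lintegral_prod_moment (hL : IsCascade P L) {k : ℕ} (s : Finset ℕ)
    (θ : Fin k → S) (a : Fin k → ℝ) :
    ∫⁻ ω, ∏ j, (∏ i ∈ s, L i (θ j) ω) ^ a j ∂P =
      ∏ i ∈ s, ∫⁻ ω, ∏ j, L i (θ j) ω ^ a j ∂P := by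
  have hφ : Measurable fun h : S → ℝ≥0∞ => ∏ j, h (θ j) ^ a j :=
    Finset.measurable_fun_prod _ fun j _ => (measurable_pi_apply _).pow_const _
  have hX := hL.indep.comp (fun _ h => ∏ j, h (θ j) ^ a j) fun _ => hφ
  have := lintegral_prod_eq_prod_lintegral_of_indepFun s
    (fun i => (fun h : S → ℝ≥0∞ => ∏ j, h (θ j) ^ a j) ∘ fun ω θ => L i θ ω) hX
    fun i => hφ.comp (hL.measurable_process i)
  simp only [Function.comp_apply] at this
  rw [← this]
  refine lintegral_congr fun ω => ?_
  rw [Finset.prod_comm]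
  refine Finset.prod_congr rfl fun j _ => ?_
  rw [ENNReal.prod_rpow_of_forall_ne_top _ _ fun i => hL.ne_top i _ _]

lemma IsCascade.lintegral_prod_rpow (hL : IsCascade P L) (s : Finset ℕ) (θ : S) (q : ℝ) :
    ∫⁻ ω, (∏ i ∈ s, L i θ ω) ^ q ∂P = ∏ i ∈ s, ∫⁻ ω, L i θ ω ^ q ∂P := by
  simpa using hL.lintegral_prod_moment (k := 1) s (fun _ => θ) fun _ => q

lemma IsCascade.lintegral_prod_eq_one (hL : IsCascade P L) (s : Finset ℕ) (θ : S) :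
    ∫⁻ ω, ∏ i ∈ s, L i θ ω ∂P = 1 := by
  have := hL.lintegral_prod_rpow s θ 1
  simpa [hL.mean_eq_one] using this

lemma IsCascade.lintegral_mass (hL : IsCascade P L) [IsProbabilityMeasure P] (ν : Measure S)
    [IsFiniteMeasure ν] (s : Finset ℕ) : ∫⁻ ω, mass L ν s ω ∂P = ν Set.univ := by
  unfold mass
  rw [lintegral_lintegral_swap]
  · simp [hL.lintegral_prod_eq_one]
  · exact ((hL.measurable_prod s).comp measurable_swap).aemeasurable

end Cascade

/-! ### Jensen and Hölder inequalities for non-negative functions -/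

section Inequalities
variable {α : Type*} [MeasurableSpace α] {ν : Measure α} {f g h : α → ℝ≥0∞}

lemma ENNReal.rpow_mul_rpow_of_add_eq_one {x : ℝ≥0∞} {u v : ℝ} (hu : 0 ≤ u) (hv : 0 ≤ v)
    (huv : u + v = 1) : x ^ u * x ^ v = x := by
  rw [← ENNReal.rpow_add_of_nonneg _ _ hu hv, huv, ENNReal.rpow_one]

/-- Jensen's inequality for the power `q ≥ 1` and the weight `h`. -/
lemma lintegral_mul_rpow_le_of_one_le (hg : AEMeasurable g ν) (hh : AEMeasurable h ν) {q : ℝ}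
    (hq : 1 ≤ q) :
    (∫⁻ x, g x * h x ∂ν) ^ q ≤ (∫⁻ x, h x ∂ν) ^ (q - 1) * ∫⁻ x, g x ^ q * h x ∂ν := by
  have hq0 : 0 < q := by linarith
  have h1 : 0 ≤ 1 - 1 / q := by
    rw [sub_nonneg, div_le_one hq0]; exact hq
  have key : ∫⁻ x, g x * h x ∂ν ≤
      (∫⁻ x, g x ^ q * h x ∂ν) ^ (1 / q) * (∫⁻ x, h x ∂ν) ^ (1 - 1 / q) := by
    refine le_trans (le_of_eq (lintegral_congr fun x => ?_))
      (ENNReal.lintegral_mul_norm_pow_le ((hg.pow_const q).mul hh) hh (by positivity) h1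
        (by ring))
    simp only [Pi.mul_apply]
    rw [ENNReal.mul_rpow_of_nonneg _ _ (by positivity), ← ENNReal.rpow_mul, mul_one_div_cancel
      hq0.ne', ENNReal.rpow_one, mul_assoc,
      ENNReal.rpow_mul_rpow_of_add_eq_one (by positivity) h1 (by ring)]
  calc (∫⁻ x, g x * h x ∂ν) ^ q
      ≤ ((∫⁻ x, g x ^ q * h x ∂ν) ^ (1 / q) * (∫⁻ x, h x ∂ν) ^ (1 - 1 / q)) ^ q := by gcongr
    _ = _ := by
      rw [ENNReal.mul_rpow_of_nonneg _ _ hq0.le, ← ENNReal.rpow_mul, ← ENNReal.rpow_mul,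
        one_div_mul_cancel hq0.ne', ENNReal.rpow_one, mul_comm]
      congr 2
      field_simp

/-- Jensen's inequality for the power `q ≤ 1` and the weight `h`. -/
lemma lintegral_rpow_mul_le_of_le_one (hg : AEMeasurable g ν) (hh : AEMeasurable h ν) {q : ℝ}
    (hq0 : 0 ≤ q) (hq : q ≤ 1) :
    ∫⁻ x, g x ^ q * h x ∂ν ≤ (∫⁻ x, g x * h x ∂ν) ^ q * (∫⁻ x, h x ∂ν) ^ (1 - q) := by
  refine le_trans (le_of_eq (lintegral_congr fun x => ?_))
    (ENNReal.lintegral_mul_norm_pow_le (hg.mul hh) hh hq0 (sub_nonneg.2 hq) (by ring))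
  simp only [Pi.mul_apply]
  rw [ENNReal.mul_rpow_of_nonneg _ _ hq0, mul_assoc,
      ENNReal.rpow_mul_rpow_of_add_eq_one hq0 (sub_nonneg.2 hq) (by ring)]

lemma rpow_lintegral_le [IsProbabilityMeasure ν] (hg : AEMeasurable g ν) {q : ℝ} (hq : 1 ≤ q) :
    (∫⁻ x, g x ∂ν) ^ q ≤ ∫⁻ x, g x ^ q ∂ν := by
  simpa using lintegral_mul_rpow_le_of_one_le hg (h := fun _ => 1) aemeasurable_const hq

lemma lintegral_rpow_le [IsProbabilityMeasure ν] (hg : AEMeasurable g ν) {q : ℝ} (hq0 : 0 ≤ q)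
    (hq : q ≤ 1) : ∫⁻ x, g x ^ q ∂ν ≤ (∫⁻ x, g x ∂ν) ^ q := by
  simpa using lintegral_rpow_mul_le_of_le_one hg (h := fun _ => 1) aemeasurable_const hq0 hq

/-- A replacement for Jensen's inequality for the negative power `q - 1`. If the integral of
`g ^ (q - 1)` is finite, then `g` is almost everywhere positive, and Hölder's inequality applies
to `1 = g ^ t * g ^ (-t)` with `t = (1 - q) / (2 - q)`. -/
lemma rpow_lintegral_le_lintegral_mul [IsProbabilityMeasure ν] (hg : AEMeasurable g ν)
    (hgt : ∀ x, g x ≠ ∞) {q : ℝ} (hq0 : 0 < q) (hq : q < 1) :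
    (∫⁻ x, g x ∂ν) ^ q ≤ (∫⁻ x, g x ^ (q - 1) ∂ν) * ∫⁻ x, g x ∂ν := by
  set X := ∫⁻ x, g x ∂ν
  set I := ∫⁻ x, g x ^ (q - 1) ∂ν with hI
  have hI0 : I ≠ 0 := by
    rw [hI, Ne, lintegral_eq_zero_iff' (hg.pow_const _)]
    intro h0
    have : (ae ν).NeBot := inferInstance
    obtain ⟨x, hx⟩ := h0.exists
    rw [Pi.zero_apply, ENNReal.rpow_eq_zero_iff] at hx
    rcases hx with ⟨_, h⟩ | ⟨h, _⟩
    · linarith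
    · exact hgt x h
  rcases eq_or_ne X 0 with hX | hX
  · simp [hX, hq0]
  rcases eq_or_ne X ∞ with hXt | hXt
  · rw [hXt, ENNReal.mul_top hI0]; exact le_top
  rcases eq_or_ne I ∞ with hIt | hIt
  · rw [hIt, ENNReal.top_mul hX]; exact le_top
  have hpos : ∀ᵐ x ∂ν, g x ≠ 0 := by
    filter_upwards [ae_lt_top' (hg.pow_const _) hIt] with x hx h0
    rw [h0, ENNReal.zero_rpow_of_neg (by linarith)] at hx
    exact lt_irrefl _ hx
  have h2 : 0 < 2 - q := by linarith
  have h1 : 0 < 1 - q := by linarith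
  have key : (1 : ℝ≥0∞) ≤ X ^ ((1 - q) / (2 - q)) * I ^ (1 / (2 - q)) := by
    have := ENNReal.lintegral_mul_norm_pow_le hg (hg.pow_const (q - 1)) (p := (1 - q) / (2 - q))
      (q := 1 / (2 - q)) (by positivity) (by positivity) (by field_simp; ring)
    refine le_trans (le_of_eq ?_) this
    rw [← measure_univ (μ := ν), ← lintegral_one]
    refine lintegral_congr_ae ?_
    filter_upwards [hpos] with x hx
    rw [← ENNReal.rpow_mul, ← ENNReal.rpow_add _ _ hx (hgt x)]
    convert (ENNReal.rpow_zero).symm using 2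
    field_simp; ring
  have key2 : (1 : ℝ≥0∞) ≤ X ^ (1 - q) * I := by
    have := ENNReal.rpow_le_rpow key h2.le
    rwa [ENNReal.one_rpow, ENNReal.mul_rpow_of_nonneg _ _ h2.le, ← ENNReal.rpow_mul,
      ← ENNReal.rpow_mul, div_mul_cancel₀ _ h2.ne', div_mul_cancel₀ _ h2.ne', ENNReal.rpow_one]
      at this
  calc X ^ q = X ^ q * 1 := (mul_one _).symm
    _ ≤ X ^ q * (X ^ (1 - q) * I) := by gcongr
    _ = I * X := by
      rw [← mul_assoc, ENNReal.rpow_mul_rpow_of_add_eq_one hq0.le h1.le (by ring), mul_comm]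

/-- A function of mean one with bounded moment of order `p > 1` has moments of order `q < 1`
bounded from below: Hölder's inequality between the exponents `q < 1 < p`. -/
lemma le_lintegral_rpow_of_lintegral_eq_one (hf : AEMeasurable f ν)
    (h1 : ∫⁻ x, f x ∂ν = 1) {p q : ℝ} (hq0 : 0 ≤ q) (hq : q < 1) (hp : 1 < p) {C : ℝ≥0∞}
    (hC : ∫⁻ x, f x ^ p ∂ν ≤ C) :
    (C ^ ((1 - q) / (p - 1)))⁻¹ ≤ ∫⁻ x, f x ^ q ∂ν := by
  have hpq : 0 < p - q := by linarith
  have hp1 : 0 < p - 1 := by linarith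
  have hq1 : 0 < 1 - q := by linarith
  have hα : 0 < (p - 1) / (p - q) := by positivity
  have key : (1 : ℝ≥0∞) ≤ (∫⁻ x, f x ^ q ∂ν) ^ ((p - 1) / (p - q)) *
      C ^ ((1 - q) / (p - q)) := by
    have := ENNReal.lintegral_mul_norm_pow_le (hf.pow_const q) (hf.pow_const p)
      (p := (p - 1) / (p - q)) (q := (1 - q) / (p - q)) hα.le (by positivity)
      (by field_simp; ring)
    refine le_trans ?_ (this.trans (by gcongr))
    rw [← h1]
    refine lintegral_mono fun x => le_of_eq ?_
    rw [← ENNReal.rpow_mul, ← ENNReal.rpow_mul,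
      ENNReal.rpow_mul_rpow_of_add_eq_one (by positivity) (by positivity)]
    field_simp; ring
  have key2 := ENNReal.rpow_le_rpow key (inv_nonneg.2 hα.le)
  rw [ENNReal.one_rpow, ENNReal.mul_rpow_of_nonneg _ _ (inv_nonneg.2 hα.le), ← ENNReal.rpow_mul,
    ← ENNReal.rpow_mul, mul_inv_cancel₀ hα.ne', ENNReal.rpow_one,
    show (1 - q) / (p - q) * ((p - 1) / (p - q))⁻¹ = (1 - q) / (p - 1) by field_simp] at key2
  rcases eq_or_ne (C ^ ((1 - q) / (p - 1))) ∞ with hc | hc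
  · simp [hc]
  rwa [ENNReal.inv_le_iff_le_mul (fun _ h0 => by simp [h0] at key2) (fun h => absurd h hc),
    mul_comm]

end Inequalities

/-! ### Moments of the total mass -/

lemma mass_union {Ω S : Type*} [MeasurableSpace S] {L : ℕ → S → Ω → ℝ≥0∞}
    {ν : Measure S} {s t : Finset ℕ} (hst : Disjoint s t) (ω : Ω) :
    mass L ν (s ∪ t) ω = ∫⁻ θ, (∏ i ∈ s, L i θ ω) * ∏ i ∈ t, L i θ ω ∂ν := by
  simp_rw [mass, Finset.prod_union hst]

section Moments
variable {Ω S : Type*} [MeasurableSpace Ω] [MeasurableSpace S] {P : Measure Ω}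
  {L : ℕ → S → Ω → ℝ≥0∞}

/-- The fields with index in `s` may be averaged out in an integral with respect to the mass
built from the fields with index in a disjoint set `t`, even when that integral is weighted by a
function `w` of the fields with index in `t`. -/
lemma IsCascade.lintegral_weight_mul (hL : IsCascade P L)
    (ν : Measure S) [IsFiniteMeasure ν] {s t : Finset ℕ} (hst : Disjoint s t) (q : ℝ)
    {κ : ℝ≥0∞} (hκ : ∀ θ, ∫⁻ ω, (∏ i ∈ s, L i θ ω) ^ q ∂P = κ) {w : Ω → ℝ≥0∞}
    (hw : Measurable[fieldSigma L t] w) :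
    ∫⁻ ω, w ω * ∫⁻ θ, (∏ i ∈ s, L i θ ω) ^ q * ∏ i ∈ t, L i θ ω ∂ν ∂P =
      κ * ∫⁻ ω, w ω * mass L ν t ω ∂P := by
  have : IsProbabilityMeasure P := hL.indep.isProbabilityMeasure
  have hwm : Measurable w := hw.mono (hL.fieldSigma_le t) le_rfl
  have hs := fun ω => hL.measurable_prod_left s ω
  have ht := fun ω => hL.measurable_prod_left t ω
  have hjoint : Measurable fun x : Ω × S =>
      (∏ i ∈ s, L i x.2 x.1) ^ q * ∏ i ∈ t, L i x.2 x.1 :=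
    (((hL.measurable_prod s).comp measurable_swap).pow_const q).mul
      ((hL.measurable_prod t).comp measurable_swap)
  have e1 : ∀ θ, ∫⁻ ω, w ω * ((∏ i ∈ s, L i θ ω) ^ q * ∏ i ∈ t, L i θ ω) ∂P =
      κ * ∫⁻ ω, w ω * ∏ i ∈ t, L i θ ω ∂P := by
    intro θ
    have h3 := hL.lintegral_mul hst ((measurable_prod_field s θ).pow_const q)
      (hw.mul (measurable_prod_field t θ))
    simp only [Pi.mul_apply] at h3
    rw [← hκ θ, ← h3]
    refine lintegral_congr fun ω => ?_
    ring
  calc _ = ∫⁻ ω, ∫⁻ θ, w ω * ((∏ i ∈ s, L i θ ω) ^ q * ∏ i ∈ t, L i θ ω) ∂ν ∂P := by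
        refine lintegral_congr fun ω => ?_
        rw [lintegral_const_mul]
        exact ((hs ω).pow_const q).mul (ht ω)
    _ = ∫⁻ θ, ∫⁻ ω, w ω * ((∏ i ∈ s, L i θ ω) ^ q * ∏ i ∈ t, L i θ ω) ∂P ∂ν := by
        refine lintegral_lintegral_swap (Measurable.aemeasurable ?_)
        exact (hwm.comp measurable_fst).mul hjoint
    _ = ∫⁻ θ, κ * ∫⁻ ω, w ω * ∏ i ∈ t, L i θ ω ∂P ∂ν := by simp_rw [e1]
    _ = κ * ∫⁻ θ, ∫⁻ ω, w ω * ∏ i ∈ t, L i θ ω ∂P ∂ν := by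
        refine lintegral_const_mul _ (Measurable.lintegral_prod_right' (f := fun x : S × Ω =>
          w x.2 * ∏ i ∈ t, L i x.1 x.2) ?_)
        exact (hwm.comp measurable_snd).mul (hL.measurable_prod t)
    _ = κ * ∫⁻ ω, ∫⁻ θ, w ω * ∏ i ∈ t, L i θ ω ∂ν ∂P := by
        congr 1
        refine lintegral_lintegral_swap (Measurable.aemeasurable ?_)
        exact (hwm.comp measurable_snd).mul (hL.measurable_prod t)
    _ = _ := by
        congr 1
        refine lintegral_congr fun ω => ?_
        rw [lintegral_const_mul _ (ht ω), mass]

lemma IsCascade.lintegral_comp_mass_mul (hL : IsCascade P L)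
    (ν : Measure S) [IsFiniteMeasure ν] {s t : Finset ℕ} (hst : Disjoint s t) (q : ℝ)
    {κ : ℝ≥0∞} (hκ : ∀ θ, ∫⁻ ω, (∏ i ∈ s, L i θ ω) ^ q ∂P = κ) {φ : ℝ≥0∞ → ℝ≥0∞}
    (hφ : Measurable φ) :
    ∫⁻ ω, φ (mass L ν t ω) * ∫⁻ θ, (∏ i ∈ s, L i θ ω) ^ q * ∏ i ∈ t, L i θ ω ∂ν ∂P =
      κ * ∫⁻ ω, φ (mass L ν t ω) * mass L ν t ω ∂P := by
  have : IsProbabilityMeasure P := hL.indep.isProbabilityMeasure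
  obtain ⟨Y, hY, hYe⟩ := hL.exists_mass_version ν t
  have h1 : (fun ω => φ (mass L ν t ω)) =ᵐ[P] fun ω => φ (Y ω) := hYe.fun_comp φ
  rw [lintegral_congr_ae (h1.fun_mul (ae_eq_refl _)),
    lintegral_congr_ae (h1.fun_mul (ae_eq_refl _))]
  exact hL.lintegral_weight_mul ν hst q hκ (hφ.comp hY)

lemma IsCascade.lintegral_comp_mass [IsProbabilityMeasure P] (hL : IsCascade P L)
    (ν : Measure S) [IsFiniteMeasure ν] {s t : Finset ℕ} (hst : Disjoint s t)
    {φ : ℝ≥0∞ → ℝ≥0∞} (hφ : Measurable φ) :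
    ∫⁻ ω, φ (mass L ν t ω) * mass L ν (s ∪ t) ω ∂P =
      ∫⁻ ω, φ (mass L ν t ω) * mass L ν t ω ∂P := by
  have := hL.lintegral_comp_mass_mul ν hst 1 (κ := 1)
    (by simpa using fun θ => hL.lintegral_prod_eq_one s θ) hφ
  simpa [mass_union hst] using this

/-- The martingale property of the total mass. -/
lemma IsCascade.lintegral_weight_mass_union (hL : IsCascade P L)
    (ν : Measure S) [IsFiniteMeasure ν] {s t : Finset ℕ} (hst : Disjoint s t)
    {w : Ω → ℝ≥0∞} (hw : Measurable[fieldSigma L t] w) :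
    ∫⁻ ω, w ω * mass L ν (s ∪ t) ω ∂P = ∫⁻ ω, w ω * mass L ν t ω ∂P := by
  have := hL.lintegral_weight_mul ν hst 1 (κ := 1)
    (by simpa using fun θ => hL.lintegral_prod_eq_one s θ) hw
  simpa [mass_union hst] using this

/-- For `q ≥ 1`, the `q`-th moment of the mass is at most the product of the moments of the fields
with index in `s` and of the moment of the mass built from the other fields. -/
lemma IsCascade.lintegral_mass_rpow_le [IsProbabilityMeasure P] (hL : IsCascade P L)
    (ν : Measure S) [IsFiniteMeasure ν] {s t : Finset ℕ} (hst : Disjoint s t) {q : ℝ}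
    (hq : 1 ≤ q) {κ : ℝ≥0∞} (hκ : ∀ θ, ∫⁻ ω, (∏ i ∈ s, L i θ ω) ^ q ∂P = κ) :
    ∫⁻ ω, mass L ν (s ∪ t) ω ^ q ∂P ≤ κ * ∫⁻ ω, mass L ν t ω ^ q ∂P := by
  calc ∫⁻ ω, mass L ν (s ∪ t) ω ^ q ∂P
      ≤ ∫⁻ ω, mass L ν t ω ^ (q - 1) *
        ∫⁻ θ, (∏ i ∈ s, L i θ ω) ^ q * ∏ i ∈ t, L i θ ω ∂ν ∂P := by
        refine lintegral_mono fun ω => ?_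
        simp only [mass_union hst]
        exact lintegral_mul_rpow_le_of_one_le (hL.measurable_prod_left s ω).aemeasurable
          (hL.measurable_prod_left t ω).aemeasurable hq
    _ = κ * ∫⁻ ω, mass L ν t ω ^ (q - 1) * mass L ν t ω ∂P :=
        hL.lintegral_comp_mass_mul ν hst q hκ (φ := fun x => x ^ (q - 1)) (by fun_prop)
    _ = _ := by
        congr 1
        refine lintegral_congr fun ω => ?_
        nth_rw 2 [← ENNReal.rpow_one (mass L ν t ω)]
        rw [← ENNReal.rpow_add_of_nonneg _ _ (by linarith) zero_le_one]
        congr 1; ring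

/-- For `0 < q ≤ 1`, the `q`-th moment of the mass is at least the product of the moments of the
fields with index in `s` and of the moment of the mass built from the other fields. -/
lemma IsCascade.le_lintegral_mass_rpow [IsProbabilityMeasure P] (hL : IsCascade P L)
    (ν : Measure S) [IsFiniteMeasure ν] {s t : Finset ℕ} (hst : Disjoint s t) {q : ℝ}
    (hq0 : 0 < q) (hq : q ≤ 1) {κ : ℝ≥0∞}
    (hκ : ∀ θ, ∫⁻ ω, (∏ i ∈ s, L i θ ω) ^ q ∂P = κ) :
    κ * ∫⁻ ω, mass L ν t ω ^ q ∂P ≤ ∫⁻ ω, mass L ν (s ∪ t) ω ^ q ∂P := by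
  have hfin : ∀ᵐ ω ∂P, mass L ν t ω < ∞ :=
    ae_lt_top (hL.measurable_mass ν t) (by rw [hL.lintegral_mass]; exact measure_ne_top _ _)
  calc κ * ∫⁻ ω, mass L ν t ω ^ q ∂P
      = κ * ∫⁻ ω, mass L ν t ω ^ (q - 1) * mass L ν t ω ∂P := by
        congr 1
        refine lintegral_congr_ae ?_
        filter_upwards [hfin] with ω hω
        rcases eq_or_ne (mass L ν t ω) 0 with h0 | h0
        · simp [h0, hq0]
        nth_rw 3 [← ENNReal.rpow_one (mass L ν t ω)]
        rw [← ENNReal.rpow_add _ _ h0 hω.ne]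
        congr 1; ring
    _ = ∫⁻ ω, mass L ν t ω ^ (q - 1) *
        ∫⁻ θ, (∏ i ∈ s, L i θ ω) ^ q * ∏ i ∈ t, L i θ ω ∂ν ∂P :=
        (hL.lintegral_comp_mass_mul ν hst q hκ (φ := fun x => x ^ (q - 1)) (by fun_prop)).symm
    _ ≤ _ := by
        refine lintegral_mono fun ω => ?_
        simp only
        have := lintegral_rpow_mul_le_of_le_one (ν := ν)
          (hL.measurable_prod_left s ω).aemeasurable
          (hL.measurable_prod_left t ω).aemeasurable hq0.le hq
        rw [← mass_union hst] at this
        refine (mul_le_mul_right this _).trans ?_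
        change _ * (_ * mass L ν t ω ^ (1 - q)) ≤ _
        rw [mul_left_comm]
        refine mul_le_of_le_one_right' ?_
        rw [show q - 1 = -(1 - q) by ring, ENNReal.rpow_neg]
        exact ENNReal.inv_mul_le_one _

end Moments

/-! ### Moment bounds in terms of two-point and mixed moments -/

lemma ENNReal.rpow_sum_of_forall_nonneg {ι : Type*} (s : Finset ι) (x : ℝ≥0∞) {a : ι → ℝ}
    (ha : ∀ i, 0 ≤ a i) : x ^ (∑ i ∈ s, a i) = ∏ i ∈ s, x ^ a i := by
  classical
  induction s using Finset.induction with
  | empty => simp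
  | insert i s hi ih =>
    rw [Finset.sum_insert hi, Finset.prod_insert hi, ← ih,
      ENNReal.rpow_add_of_nonneg _ _ (ha i) (Finset.sum_nonneg fun j _ => ha j)]

section MomentBounds
variable {Ω S : Type*} [MeasurableSpace Ω] [MeasurableSpace S] {P : Measure Ω}
  {L : ℕ → S → Ω → ℝ≥0∞}

lemma IsCascade.measurable_prod_field' (hL : IsCascade P L) (s : Finset ℕ) {β : Type*}
    [MeasurableSpace β] {u : β → S} {v : β → Ω} (hu : Measurable u) (hv : Measurable v) :
    Measurable fun x => ∏ i ∈ s, L i (u x) (v x) :=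
  (hL.measurable_prod s).comp (hu.prodMk hv)

/-- For `q < 1`, the `q`-th moment of the mass is controlled by two-point moments. -/
lemma IsCascade.lintegral_mass_rpow_le_of_pair [IsProbabilityMeasure P] (hL : IsCascade P L)
    (ν : Measure S) [IsProbabilityMeasure ν] (s : Finset ℕ) {q : ℝ} (hq0 : 0 < q) (hq : q < 1)
    {B : ℝ≥0∞} (hB : ∀ᵐ θ₁ ∂ν, ∀ᵐ θ₂ ∂ν,
      ∫⁻ ω, (∏ i ∈ s, L i θ₁ ω) ^ (q - 1) * ∏ i ∈ s, L i θ₂ ω ∂P ≤ B) :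
    ∫⁻ ω, mass L ν s ω ^ q ∂P ≤ B := by
  have hm := hL.measurable_mass ν s
  calc ∫⁻ ω, mass L ν s ω ^ q ∂P
      ≤ ∫⁻ ω, ∫⁻ θ₁, (∏ i ∈ s, L i θ₁ ω) ^ (q - 1) * mass L ν s ω ∂ν ∂P := by
        refine lintegral_mono fun ω => ?_
        simp only
        rw [lintegral_mul_const _ ((hL.measurable_prod_left s ω).pow_const _)]
        exact rpow_lintegral_le_lintegral_mul (hL.measurable_prod_left s ω).aemeasurable
          (fun θ => ENNReal.prod_ne_top fun i _ => hL.ne_top i θ ω) hq0 hq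
    _ = ∫⁻ θ₁, ∫⁻ ω, (∏ i ∈ s, L i θ₁ ω) ^ (q - 1) * mass L ν s ω ∂P ∂ν := by
        refine lintegral_lintegral_swap (Measurable.aemeasurable ?_)
        exact ((hL.measurable_prod_field' s measurable_snd measurable_fst).pow_const _).mul
          (hm.comp measurable_fst)
    _ = ∫⁻ θ₁, ∫⁻ θ₂, ∫⁻ ω, (∏ i ∈ s, L i θ₁ ω) ^ (q - 1) * ∏ i ∈ s, L i θ₂ ω ∂P ∂ν ∂ν := by
        refine lintegral_congr fun θ₁ => ?_
        rw [lintegral_lintegral_swap]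
        · refine lintegral_congr fun ω => ?_
          rw [lintegral_const_mul _ (hL.measurable_prod_left s ω), mass]
        · refine Measurable.aemeasurable ?_
          exact ((hL.measurable_prod_field' s measurable_const measurable_snd).pow_const _).mul
            (hL.measurable_prod_field' s measurable_fst measurable_snd)
    _ ≤ ∫⁻ _, ∫⁻ _, B ∂ν ∂ν := by
        refine lintegral_mono_ae ?_
        filter_upwards [hB] with θ₁ h
        exact lintegral_mono_ae h
    _ = B := by simp

/-- Interpolation between two-point moments with a fixed total exponent. -/
lemma lintegral_rpow_mul_rpow_le {f g : Ω → ℝ≥0∞} (hf : AEMeasurable f P)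
    (hg : AEMeasurable g P) {q r t : ℝ} (ht0 : 0 ≤ t) (htr : t ≤ r)
    (htq : t < q) (hrq : r ≤ q) :
    ∫⁻ ω, f ω ^ r * g ω ^ (q - r) ∂P ≤
      (∫⁻ ω, f ω ^ t * g ω ^ (q - t) ∂P) ^ ((q - r) / (q - t)) *
        (∫⁻ ω, f ω ^ q ∂P) ^ ((r - t) / (q - t)) := by
  have h1 : 0 < q - t := by linarith
  have h2 : 0 ≤ q - r := by linarith
  have h3 : 0 ≤ r - t := by linarith
  have hα : 0 ≤ (q - r) / (q - t) := by positivity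
  refine le_trans (lintegral_mono fun ω => le_of_eq ?_)
    (ENNReal.lintegral_mul_norm_pow_le ((hf.pow_const t).mul (hg.pow_const (q - t)))
      (hf.pow_const q) hα (by positivity) (by field_simp; ring))
  simp only [Pi.mul_apply]
  rw [ENNReal.mul_rpow_of_nonneg _ _ hα, ← ENNReal.rpow_mul, ← ENNReal.rpow_mul,
    ← ENNReal.rpow_mul, mul_div_cancel₀ _ h1.ne', mul_right_comm, ← ENNReal.rpow_add_of_nonneg]
  · congr 2
    field_simp; ring
  · positivity
  · have : 0 ≤ q := by linarith
    positivity

lemma ENNReal.rpow_inv_mul_le_of_mul_le {A c κ : ℝ≥0∞} (hκ0 : κ ≠ 0) (hκt : κ ≠ ∞) {α β : ℝ}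
    (hα : 0 < α) (hαβ : α + β = 1) (h : c * κ ≤ A ^ α * κ ^ β) : c ^ α⁻¹ * κ ≤ A := by
  have h0 : κ ^ β ≠ 0 := by simp [ENNReal.rpow_eq_zero_iff, hκ0, hκt]
  have ht : κ ^ β ≠ ∞ := by simp [ENNReal.rpow_eq_top_iff, hκ0, hκt]
  have h1 : c * κ ^ α ≤ A ^ α := by
    refine (ENNReal.mul_le_mul_iff_left h0 ht).1 ?_
    rwa [mul_assoc, ← ENNReal.rpow_add _ _ hκ0 hκt, hαβ, ENNReal.rpow_one]
  have h2 := ENNReal.rpow_le_rpow h1 (inv_nonneg.2 hα.le)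
  rwa [ENNReal.mul_rpow_of_nonneg _ _ (inv_nonneg.2 hα.le), ← ENNReal.rpow_mul,
    ← ENNReal.rpow_mul, mul_inv_cancel₀ hα.ne', ENNReal.rpow_one, ENNReal.rpow_one] at h2

/-- For `q ≥ 1`, the `q`-th moment of the mass is bounded from below in terms of two-point
moments. As the power `q / k` may exceed `1`, the two-point moments are first
interpolated to the exponent `1 / k ≤ 1`, for which `x ↦ x ^ (1 / k)` is concave. -/
lemma IsCascade.le_lintegral_mass_rpow_of_pair [IsProbabilityMeasure P] (hL : IsCascade P L)
    (ν : Measure S) [IsProbabilityMeasure ν] (s : Finset ℕ) {q k : ℝ} (hq : 1 ≤ q) (hk : 1 < k)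
    {κ c : ℝ≥0∞} (hκ : ∀ θ, ∫⁻ ω, (∏ i ∈ s, L i θ ω) ^ q ∂P = κ) (hκ0 : κ ≠ 0) (hκt : κ ≠ ∞)
    (θ₁ : S) (hc : ∀ᵐ θ₂ ∂ν, c * κ ≤
      ∫⁻ ω, (∏ i ∈ s, L i θ₂ ω) ^ (q / k) * (∏ i ∈ s, L i θ₁ ω) ^ (q - q / k) ∂P) :
    (c ^ ((q - q / k) / (q - 1 / k))⁻¹) ^ (1 / k / q)⁻¹ * κ ≤ ∫⁻ ω, mass L ν s ω ^ q ∂P := by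
  have hk0 : 0 < k := by linarith
  have hq0 : 0 < q := by linarith
  have hr : q / k < q := div_lt_self hq0 hk
  have hk1 : 1 / k < 1 := by rw [div_lt_one hk0]; exact hk
  have htr : 1 / k ≤ q / k := by gcongr
  have htq : 1 / k < q := by linarith
  have h1 : 0 < q - 1 / k := by linarith
  have h2 : 0 < q - q / k := by linarith
  have hm := hL.measurable_mass ν s
  have hmθ := fun θ => hL.measurable_prod_right s θ
  refine ENNReal.rpow_inv_mul_le_of_mul_le hκ0 hκt (α := 1 / k / q) (β := (q - 1 / k) / q)
    (by positivity) (by field_simp; ring) ?_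
  -- the two-point moments with exponent `1 / k`
  have hA : ∀ᵐ θ₂ ∂ν, c ^ ((q - q / k) / (q - 1 / k))⁻¹ * κ ≤
      ∫⁻ ω, (∏ i ∈ s, L i θ₂ ω) ^ (1 / k) * (∏ i ∈ s, L i θ₁ ω) ^ (q - 1 / k) ∂P := by
    filter_upwards [hc] with θ₂ h
    refine ENNReal.rpow_inv_mul_le_of_mul_le hκ0 hκt (β := (q / k - 1 / k) / (q - 1 / k))
      (by positivity) ?_ (h.trans ?_)
    · rw [← add_div, div_eq_one_iff_eq h1.ne']; ring
    · rw [← hκ θ₂]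
      exact lintegral_rpow_mul_rpow_le (hmθ _).aemeasurable (hmθ _).aemeasurable
        (by positivity) htr htq hr.le
  calc c ^ ((q - q / k) / (q - 1 / k))⁻¹ * κ
      = ∫⁻ _, c ^ ((q - q / k) / (q - 1 / k))⁻¹ * κ ∂ν := by simp
    _ ≤ ∫⁻ θ₂, ∫⁻ ω, (∏ i ∈ s, L i θ₂ ω) ^ (1 / k) * (∏ i ∈ s, L i θ₁ ω) ^ (q - 1 / k) ∂P ∂ν :=
        lintegral_mono_ae hA
    _ = ∫⁻ ω, ∫⁻ θ₂, (∏ i ∈ s, L i θ₂ ω) ^ (1 / k) * (∏ i ∈ s, L i θ₁ ω) ^ (q - 1 / k) ∂ν ∂P := by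
        refine lintegral_lintegral_swap (Measurable.aemeasurable ?_)
        exact ((hL.measurable_prod_field' s measurable_fst measurable_snd).pow_const _).mul
          ((hL.measurable_prod_field' s measurable_const measurable_snd).pow_const _)
    _ ≤ ∫⁻ ω, (mass L ν s ω ^ q) ^ (1 / k / q) *
          ((∏ i ∈ s, L i θ₁ ω) ^ q) ^ ((q - 1 / k) / q) ∂P := by
        refine lintegral_mono fun ω => ?_
        simp only
        rw [lintegral_mul_const _ ((hL.measurable_prod_left s ω).pow_const _),
          ← ENNReal.rpow_mul, ← ENNReal.rpow_mul, mul_div_cancel₀ _ hq0.ne',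
          mul_div_cancel₀ _ hq0.ne']
        gcongr
        exact lintegral_rpow_le (hL.measurable_prod_left s ω).aemeasurable (by positivity) hk1.le
    _ ≤ (∫⁻ ω, mass L ν s ω ^ q ∂P) ^ (1 / k / q) * κ ^ ((q - 1 / k) / q) := by
        rw [← hκ θ₁]
        exact ENNReal.lintegral_mul_norm_pow_le (hm.pow_const q).aemeasurable
          ((hmθ θ₁).pow_const q).aemeasurable (by positivity) (by positivity)
          (by field_simp; ring)

/-- The moment of order `p = ∑ a j` of the mass is at most the average, over tuples of independent
points, of the mixed moments. -/
lemma IsCascade.lintegral_mass_rpow_le_lintegral_pi [IsProbabilityMeasure P] (hL : IsCascade P L)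
    (ν : Measure S) [IsProbabilityMeasure ν] (s : Finset ℕ) {k : ℕ} {a : Fin k → ℝ} {p : ℝ}
    (ha : ∀ j, 1 ≤ a j) (hap : ∑ j, a j = p) :
    ∫⁻ ω, mass L ν s ω ^ p ∂P ≤
      ∫⁻ θ : Fin k → S, ∏ i ∈ s, ∫⁻ ω, ∏ j, L i (θ j) ω ^ a j ∂P ∂Measure.pi fun _ => ν := by
  have hind : iIndepFun (fun (j : Fin k) (θ : Fin k → S) => θ j) (Measure.pi fun _ => ν) :=
    iIndepFun_pi (X := fun _ => id) fun _ => aemeasurable_id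
  calc ∫⁻ ω, mass L ν s ω ^ p ∂P
      ≤ ∫⁻ ω, ∫⁻ θ : Fin k → S, ∏ j, (∏ i ∈ s, L i (θ j) ω) ^ a j ∂Measure.pi (fun _ => ν) ∂P := by
        refine lintegral_mono fun ω => ?_
        simp only
        have hg := hL.measurable_prod_left s ω
        rw [lintegral_prod_eq_prod_lintegral_of_indepFun Finset.univ
          (fun (j : Fin k) (θ : Fin k → S) => (∏ i ∈ s, L i (θ j) ω) ^ a j)
          (hind.comp (fun j x => (∏ i ∈ s, L i x ω) ^ a j) fun j => hg.pow_const _)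
          fun j => (hg.pow_const _).comp (measurable_pi_apply j), ← hap,
          ENNReal.rpow_sum_of_forall_nonneg _ _ fun j => zero_le_one.trans (ha j)]
        refine Finset.prod_le_prod' fun j _ => ?_
        rw [(measurePreserving_eval (fun _ : Fin k => ν) j).lintegral_comp
          (f := fun x => (∏ i ∈ s, L i x ω) ^ a j) (hg.pow_const _)]
        exact rpow_lintegral_le hg.aemeasurable (ha j)
    _ = ∫⁻ θ : Fin k → S, ∫⁻ ω, ∏ j, (∏ i ∈ s, L i (θ j) ω) ^ a j ∂P ∂Measure.pi fun _ => ν := by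
        refine lintegral_lintegral_swap (Measurable.aemeasurable ?_)
        exact Finset.measurable_fun_prod _ fun j _ => (hL.measurable_prod_field' s
          ((measurable_pi_apply j).comp measurable_snd) measurable_fst).pow_const _
    _ = _ := by simp_rw [hL.lintegral_prod_moment]

/-- The average of a function of two coordinates. -/
lemma lintegral_pi_pair (ν : Measure S) [IsProbabilityMeasure ν] {k : ℕ} {h m : Fin k}
    (hne : h ≠ m) {F : S → S → ℝ≥0∞} (hF : Measurable fun x : S × S => F x.1 x.2) :
    ∫⁻ θ : Fin k → S, F (θ h) (θ m) ∂Measure.pi (fun _ => ν) = ∫⁻ x, ∫⁻ y, F x y ∂ν ∂ν := by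
  have hind : iIndepFun (fun (j : Fin k) (θ : Fin k → S) => θ j) (Measure.pi fun _ => ν) :=
    iIndepFun_pi (X := fun _ => id) fun _ => aemeasurable_id
  have hpair := (indepFun_iff_map_prod_eq_prod_map_map (measurable_pi_apply h).aemeasurable
    (measurable_pi_apply m).aemeasurable).1 (hind.indepFun hne)
  have h1 := (measurePreserving_eval (fun _ : Fin k => ν) h).map_eq
  have h2 := (measurePreserving_eval (fun _ : Fin k => ν) m).map_eq
  change Measure.map (fun θ : Fin k → S => θ h) _ = ν at h1
  change Measure.map (fun θ : Fin k → S => θ m) _ = ν at h2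
  rw [h1, h2] at hpair
  rw [← lintegral_prod _ hF.aemeasurable, ← hpair, lintegral_map hF (by fun_prop)]

end MomentBounds

/-! ### Limits of the total mass -/

section Limits
variable {Ω : Type*} [MeasurableSpace Ω] {P : Measure Ω}

/-- A sequence bounded in `L^p`, `p > 1`, does not exceed its almost sure limit by more than an
amount that tends to `0` in mean. -/
lemma tendsto_lintegral_sub_of_bounded [IsProbabilityMeasure P] {X : ℕ → Ω → ℝ≥0∞}
    {Y : Ω → ℝ≥0∞} (hX : ∀ n, Measurable (X n))
    (hlim : ∀ᵐ ω ∂P, Tendsto (fun n => X n ω) atTop (𝓝 (Y ω))) {p : ℝ} (hp : 1 < p) {C : ℝ≥0∞}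
    (hC : C ≠ ∞) (hb : ∀ n, ∫⁻ ω, X n ω ^ p ∂P ≤ C) :
    Tendsto (fun n => ∫⁻ ω, (X n ω - Y ω) ∂P) atTop (𝓝 0) := by
  have hY : AEMeasurable Y P :=
    aemeasurable_of_tendsto_metrizable_ae' (fun n => (hX n).aemeasurable) hlim
  have hp1 : 0 < p - 1 := by linarith
  -- truncation at a level `M`
  have htr : ∀ M : ℝ≥0∞, M ≠ 0 → M ≠ ∞ → ∀ x y : ℝ≥0∞,
      x - y ≤ (min x M - y) + x ^ p * M ^ (1 - p) := by
    intro M hM0 hMt x y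
    rcases le_total x M with h | h
    · rw [min_eq_left h]; exact le_self_add
    · refine le_add_of_nonneg_of_le bot_le (tsub_le_self.trans ?_)
      rcases eq_or_ne x ∞ with hx | hx
      · rw [hx, ENNReal.top_rpow_of_pos (by linarith), ENNReal.top_mul]
        simp [ENNReal.rpow_eq_zero_iff, hM0, hMt]
      have hx0 : x ≠ 0 := fun h0 => hM0 (le_antisymm (h0 ▸ h) bot_le)
      calc x = x ^ p * x ^ (1 - p) := by
            rw [← ENNReal.rpow_add _ _ hx0 hx]; simp
        _ ≤ x ^ p * M ^ (1 - p) := by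
            rw [show 1 - p = -(p - 1) by ring, ENNReal.rpow_neg, ENNReal.rpow_neg]
            gcongr
  have hdct : ∀ M : ℝ≥0∞, M ≠ ∞ →
      Tendsto (fun n => ∫⁻ ω, (min (X n ω) M - Y ω) ∂P) atTop (𝓝 0) := by
    intro M hMt
    have := tendsto_lintegral_of_dominated_convergence' (μ := P)
      (F := fun n ω => min (X n ω) M - Y ω) (f := fun _ => 0) (fun _ => M)
      (fun n => ((hX n).min measurable_const).aemeasurable.sub hY)
      (fun n => ae_of_all _ fun ω => tsub_le_self.trans (min_le_right _ _)) (by simpa using hMt) ?_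
    · simpa using this
    · filter_upwards [hlim] with ω hω
      have h1 : Tendsto (fun n => min (X n ω) M) atTop (𝓝 (min (Y ω) M)) :=
        hω.min tendsto_const_nhds
      have h2 := ENNReal.Tendsto.sub h1 (tendsto_const_nhds (x := Y ω))
        (Or.inl ((min_le_right _ _).trans_lt hMt.lt_top).ne)
      rwa [tsub_eq_zero_of_le (min_le_left _ _)] at h2
  rw [ENNReal.tendsto_nhds_zero]
  intro ε hε
  have hε2 : 0 < ε / 2 := ENNReal.half_pos hε.ne'
  -- the level is chosen such that the tail contributes at most `ε / 2`
  obtain ⟨M, hM0, hMt, hM⟩ : ∃ M : ℝ≥0∞, M ≠ 0 ∧ M ≠ ∞ ∧ C * M ^ (1 - p) ≤ ε / 2 := by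
    have h1 : Tendsto (fun n : ℕ => C * ((n : ℝ≥0∞) ^ (p - 1))⁻¹) atTop
        (𝓝 (C * (∞ ^ (p - 1))⁻¹)) := by
      refine ENNReal.Tendsto.const_mul ?_ (Or.inr hC)
      exact (continuous_inv.tendsto _).comp
        ((ENNReal.continuous_rpow_const.tendsto _).comp ENNReal.tendsto_nat_nhds_top)
    rw [ENNReal.top_rpow_of_pos hp1, ENNReal.inv_top, mul_zero] at h1
    obtain ⟨n, hn, hn1⟩ :=
      ((ENNReal.tendsto_nhds_zero.1 h1 _ hε2).and (eventually_ge_atTop 1)).exists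
    refine ⟨n, by positivity, ENNReal.natCast_ne_top n, ?_⟩
    rwa [show 1 - p = -(p - 1) by ring, ENNReal.rpow_neg]
  filter_upwards [ENNReal.tendsto_nhds_zero.1 (hdct M hMt) _ hε2] with n hn
  calc ∫⁻ ω, (X n ω - Y ω) ∂P
      ≤ ∫⁻ ω, (min (X n ω) M - Y ω) + X n ω ^ p * M ^ (1 - p) ∂P :=
        lintegral_mono fun ω => htr M hM0 hMt _ _
    _ = ∫⁻ ω, (min (X n ω) M - Y ω) ∂P + (∫⁻ ω, X n ω ^ p ∂P) * M ^ (1 - p) := by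
        rw [lintegral_add_right _ (((hX n).pow_const p).mul_const _),
          lintegral_mul_const _ ((hX n).pow_const p)]
    _ ≤ ε / 2 + ε / 2 := add_le_add hn ((mul_le_mul_left (hb n) _).trans hM)
    _ = ε := ENNReal.add_halves ε

lemma lintegral_rpow_le_of_tendsto {X : ℕ → Ω → ℝ≥0∞}
    {Y : Ω → ℝ≥0∞} (hX : ∀ n, Measurable (X n))
    (hlim : ∀ᵐ ω ∂P, Tendsto (fun n => X n ω) atTop (𝓝 (Y ω))) {q : ℝ} {C : ℝ≥0∞}
    (hb : ∀ᶠ n in atTop, ∫⁻ ω, X n ω ^ q ∂P ≤ C) : ∫⁻ ω, Y ω ^ q ∂P ≤ C := by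
  calc ∫⁻ ω, Y ω ^ q ∂P = ∫⁻ ω, liminf (fun n => X n ω ^ q) atTop ∂P := by
        refine lintegral_congr_ae ?_
        filter_upwards [hlim] with ω hω
        exact (((ENNReal.continuous_rpow_const.tendsto _).comp hω).liminf_eq).symm
    _ ≤ liminf (fun n => ∫⁻ ω, X n ω ^ q ∂P) atTop :=
        lintegral_liminf_le fun n => (hX n).pow_const q
    _ ≤ C := liminf_le_of_frequently_le' hb.frequently

/-- A lower bound for moments of order `q ≤ 1` passes to the limit. -/
lemma le_lintegral_rpow_of_tendsto [IsProbabilityMeasure P] {X : ℕ → Ω → ℝ≥0∞}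
    {Y : Ω → ℝ≥0∞} (hX : ∀ n, Measurable (X n)) (hY : AEMeasurable Y P)
    (hsub : Tendsto (fun n => ∫⁻ ω, (X n ω - Y ω) ∂P) atTop (𝓝 0)) {q : ℝ} (hq0 : 0 < q)
    (hq : q ≤ 1) {c : ℝ≥0∞} (hb : ∀ᶠ n in atTop, c ≤ ∫⁻ ω, X n ω ^ q ∂P) :
    c ≤ ∫⁻ ω, Y ω ^ q ∂P := by
  have h1 : ∀ n, ∫⁻ ω, X n ω ^ q ∂P ≤
      ∫⁻ ω, Y ω ^ q ∂P + (∫⁻ ω, (X n ω - Y ω) ∂P) ^ q := by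
    intro n
    have hm : AEMeasurable (fun ω => X n ω - Y ω) P := (hX n).aemeasurable.sub hY
    calc ∫⁻ ω, X n ω ^ q ∂P ≤ ∫⁻ ω, Y ω ^ q + (X n ω - Y ω) ^ q ∂P := by
          refine lintegral_mono fun ω => ?_
          exact (ENNReal.rpow_le_rpow le_add_tsub hq0.le).trans
            (ENNReal.rpow_add_le_add_rpow _ _ hq0.le hq)
      _ = ∫⁻ ω, Y ω ^ q ∂P + ∫⁻ ω, (X n ω - Y ω) ^ q ∂P := by
          rw [lintegral_add_right' _ (hm.pow_const q)]
      _ ≤ _ := by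
          gcongr
          exact lintegral_rpow_le hm hq0.le hq
  have h2 : Tendsto (fun n => ∫⁻ ω, Y ω ^ q ∂P + (∫⁻ ω, (X n ω - Y ω) ∂P) ^ q) atTop
      (𝓝 (∫⁻ ω, Y ω ^ q ∂P + 0)) := by
    refine tendsto_const_nhds.add ?_
    have := (ENNReal.continuous_rpow_const (y := q)).tendsto 0 |>.comp hsub
    simpa [ENNReal.zero_rpow_of_pos hq0, Function.comp_def] using this
  rw [add_zero] at h2
  refine ge_of_tendsto h2 ?_
  filter_upwards [hb] with n hn
  exact hn.trans (h1 n)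

/-- Moments of order `q ≥ 1` do not decrease in the limit of a sequence with the martingale property
`E φ(Z) Xₙ = E φ(Z) Z`, where `Z` is an early member of the sequence: by duality, as
`E Z ^ q ≤ E Z ^ (q - 1) Y ≤ (E Z ^ q) ^ (1 - 1 / q) (E Y ^ q) ^ (1 / q)`. -/
lemma lintegral_rpow_le_lintegral_rpow_limit [IsProbabilityMeasure P] {X : ℕ → Ω → ℝ≥0∞}
    {Y Z : Ω → ℝ≥0∞} (hX : ∀ n, Measurable (X n)) (hZ : Measurable Z) (hY : AEMeasurable Y P)
    (hsub : Tendsto (fun n => ∫⁻ ω, (X n ω - Y ω) ∂P) atTop (𝓝 0)) {q : ℝ} (hq : 1 ≤ q)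
    (hmart : ∀ φ : ℝ≥0∞ → ℝ≥0∞, Measurable φ → ∀ᶠ n in atTop,
      ∫⁻ ω, φ (Z ω) * X n ω ∂P = ∫⁻ ω, φ (Z ω) * Z ω ∂P)
    (hfin : ∫⁻ ω, Z ω ^ q ∂P ≠ ∞) : ∫⁻ ω, Z ω ^ q ∂P ≤ ∫⁻ ω, Y ω ^ q ∂P := by
  have hq0 : 0 < q := by linarith
  have hq1 : 0 ≤ q - 1 := by linarith
  -- the inequality `E Z ^ q ≤ E Z ^ (q - 1) Y`, by truncation of the weight
  have htr : ∀ M : ℕ, ∫⁻ ω, min (Z ω ^ (q - 1)) M * Z ω ∂P ≤ ∫⁻ ω, Z ω ^ (q - 1) * Y ω ∂P := by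
    intro M
    have hφ : Measurable fun x : ℝ≥0∞ => min (x ^ (q - 1)) (M : ℝ≥0∞) := by fun_prop
    have h2 : Tendsto (fun n => ∫⁻ ω, Z ω ^ (q - 1) * Y ω ∂P + M * ∫⁻ ω, (X n ω - Y ω) ∂P) atTop
        (𝓝 (∫⁻ ω, Z ω ^ (q - 1) * Y ω ∂P + M * 0)) :=
      tendsto_const_nhds.add (ENNReal.Tendsto.const_mul hsub (Or.inr (ENNReal.natCast_ne_top M)))
    rw [mul_zero, add_zero] at h2
    refine ge_of_tendsto h2 ?_
    filter_upwards [hmart _ hφ] with n hn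
    have hm : AEMeasurable (fun ω => X n ω - Y ω) P := (hX n).aemeasurable.sub hY
    rw [← hn, ← lintegral_const_mul'' _ hm, ← lintegral_add_right' _ (hm.const_mul _)]
    refine lintegral_mono fun ω => ?_
    calc min (Z ω ^ (q - 1)) (M : ℝ≥0∞) * X n ω
        ≤ min (Z ω ^ (q - 1)) (M : ℝ≥0∞) * (Y ω + (X n ω - Y ω)) := by
          gcongr; exact le_add_tsub
      _ ≤ _ := by
          rw [mul_add]
          gcongr
          · exact min_le_left _ _
          · exact min_le_right _ _
  have hsup : ∫⁻ ω, Z ω ^ q ∂P ≤ ∫⁻ ω, Z ω ^ (q - 1) * Y ω ∂P := by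
    have : ∀ ω, Z ω ^ q = ⨆ M : ℕ, min (Z ω ^ (q - 1)) (M : ℝ≥0∞) * Z ω := by
      intro ω
      rw [← ENNReal.iSup_mul, ← inf_iSup_eq, ENNReal.iSup_natCast, inf_top_eq]
      nth_rw 3 [← ENNReal.rpow_one (Z ω)]
      rw [← ENNReal.rpow_add_of_nonneg _ _ hq1 zero_le_one]
      congr 1; ring
    simp_rw [this]
    rw [lintegral_iSup]
    · exact iSup_le htr
    · exact fun M => ((hZ.pow_const _).min measurable_const).mul hZ
    · intro a b hab ω
      dsimp only
      gcongr
  have hold : ∫⁻ ω, Z ω ^ (q - 1) * Y ω ∂P ≤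
      (∫⁻ ω, Z ω ^ q ∂P) ^ ((q - 1) / q) * (∫⁻ ω, Y ω ^ q ∂P) ^ (1 / q) := by
    refine le_trans (le_of_eq (lintegral_congr fun ω => ?_))
      (ENNReal.lintegral_mul_norm_pow_le (hZ.pow_const q).aemeasurable (hY.pow_const q)
        (by positivity) (by positivity) (by field_simp; ring))
    rw [← ENNReal.rpow_mul, ← ENNReal.rpow_mul, mul_div_cancel₀ _ hq0.ne',
      mul_one_div_cancel hq0.ne', ENNReal.rpow_one]
  rcases eq_or_ne (∫⁻ ω, Z ω ^ q ∂P) 0 with h0 | h0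
  · rw [h0]; exact bot_le
  have := ENNReal.rpow_inv_mul_le_of_mul_le (c := 1) h0 hfin (α := 1 / q) (β := (q - 1) / q)
    (by positivity) (by field_simp; ring) (A := ∫⁻ ω, Y ω ^ q ∂P)
    (by rw [one_mul, mul_comm]; exact hsup.trans hold)
  simpa using this

end Limits

/-! ### Existence of the limiting random measure -/

section LimitMass
variable {Ω S : Type*} [MeasurableSpace S] {L : ℕ → S → Ω → ℝ≥0∞}

/-- The upper limit of the masses that the measures with densities `∏ i < n, L i` give to `B`. -/
noncomputable def limitMass (L : ℕ → S → Ω → ℝ≥0∞) (σ : Measure S) (B : Set S) (ω : Ω) : ℝ≥0∞ :=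
  limsup (fun n => mass L (σ.restrict B) (Finset.range n) ω) atTop

lemma limitMass_mono {σ : Measure S} {A B : Set S} (h : A ⊆ B) (ω : Ω) :
    limitMass L σ A ω ≤ limitMass L σ B ω :=
  limsup_le_limsup (Eventually.of_forall fun _ =>
    lintegral_mono' (Measure.restrict_mono h le_rfl) le_rfl)

lemma limitMass_empty (σ : Measure S) (ω : Ω) : limitMass L σ ∅ ω = 0 := by
  simp [limitMass, mass]

lemma mass_restrict_le (σ : Measure S) (B : Set S) (s : Finset ℕ) (ω : Ω) :
    mass L (σ.restrict B) s ω ≤ mass L σ s ω :=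
  lintegral_mono' Measure.restrict_le_self le_rfl

/-- A criterion for the normalization of a function on the rationals to be a distribution function,
with continuity conditions along sequences only. -/
lemma isRatStieltjesPoint_of_sequences {Ω : Type*} (u : Ω → ℚ → ℝ≥0∞) (T : Ω → ℝ≥0∞) (ω : Ω)
    (hu : Monotone (u ω)) (hT0 : T ω ≠ 0) (hTt : T ω ≠ ∞) (huT : ∀ r, u ω r ≤ T ω)
    (htop : ⨆ n : ℕ, u ω n = T ω) (hbot : ⨅ n : ℕ, u ω (-n) = 0)
    (hright : ∀ t, ⨅ n : ℕ, u ω (t + 1 / (n + 1)) = u ω t) :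
    IsRatStieltjesPoint (fun ω r => (u ω r / T ω).toReal) ω := by
  have hdt : ∀ r, u ω r / T ω ≠ ∞ := fun r =>
    (ENNReal.div_lt_top ((huT r).trans_lt hTt.lt_top).ne hT0).ne
  have hmono : Monotone fun r => (u ω r / T ω).toReal := fun r r' h =>
    ENNReal.toReal_mono (hdt _) (ENNReal.div_le_div_right (hu h) _)
  have hcont : ∀ {β : Type} {l : Filter β} {f : β → ℝ≥0∞} {x : ℝ≥0∞}, x ≤ T ω →
      Tendsto f l (𝓝 x) → Tendsto (fun r => (f r / T ω).toReal) l (𝓝 (x / T ω).toReal) := by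
    intro β l f x hx hf
    exact (ENNReal.tendsto_toReal
      (ENNReal.div_lt_top (hx.trans_lt hTt.lt_top).ne hT0).ne).comp
      (ENNReal.Tendsto.div_const hf (Or.inr hT0))
  refine ⟨hmono, ?_, ?_, fun t => le_antisymm ?_ ?_⟩
  · have h1 : ⨆ r, u ω r = T ω := le_antisymm (iSup_le huT)
      (htop ▸ iSup_le fun n => le_iSup (u ω) n)
    have := hcont le_rfl (h1 ▸ tendsto_atTop_iSup hu)
    rwa [ENNReal.div_self hT0 hTt, ENNReal.toReal_one] at this
  · have h1 : ⨅ r, u ω r = 0 := le_antisymm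
      (hbot ▸ le_iInf fun n => iInf_le (u ω) (-(n : ℚ))) bot_le
    have := hcont bot_le (h1 ▸ tendsto_atBot_iInf hu)
    simpa using this
  · have hanti : Antitone fun n : ℕ => u ω (t + 1 / (n + 1)) := fun m n h => hu (by gcongr)
    have h1 := hcont (huT t) (hright t ▸ tendsto_atTop_iInf hanti)
    refine ge_of_tendsto' h1 fun n => ?_
    refine ciInf_le (f := fun r : Set.Ioi t => (u ω r / T ω).toReal)
      ⟨0, by rintro _ ⟨r, rfl⟩; exact ENNReal.toReal_nonneg⟩
      ⟨t + 1 / (n + 1), ?_⟩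
    have : (0 : ℚ) < 1 / (n + 1) := by positivity
    simp only [Set.mem_Ioi]; linarith
  · have : Nonempty (Set.Ioi t) := ⟨⟨t + 1, by simp⟩⟩
    exact le_ciInf fun r => hmono r.2.le

variable [MeasurableSpace Ω] {P : Measure Ω}

lemma IsCascade.measurable_limitMass (hL : IsCascade P L) (σ : Measure S) [IsFiniteMeasure σ]
    (B : Set S) : Measurable (limitMass L σ B) :=
  Measurable.limsup fun _ => hL.measurable_mass _ _

/-- The masses converge almost surely, as they form a non-negative martingale for the filtration
generated by the fields, up to modification on null sets. -/
lemma IsCascade.exists_tendsto_mass (hL : IsCascade P L) (ν : Measure S) [IsFiniteMeasure ν] :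
    ∀ᵐ ω ∂P, ∃ x, Tendsto (fun n => mass L ν (Finset.range n) ω) atTop (𝓝 x) := by
  have : IsProbabilityMeasure P := hL.indep.isProbabilityMeasure
  choose Y hY hYe using fun n => hL.exists_mass_version ν (Finset.range n)
  have hYm : ∀ n, Measurable (Y n) := fun n => (hY n).mono (hL.fieldSigma_le _) le_rfl
  have hEY : ∀ n, ∫⁻ ω, Y n ω ∂P = ν Set.univ := fun n => by
    rw [← lintegral_congr_ae (hYe n), hL.lintegral_mass]
  have hEYt : ∀ n, ∫⁻ ω, Y n ω ∂P ≠ ∞ := fun n => by rw [hEY]; exact measure_ne_top _ _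
  have hfin : ∀ n, ∀ᵐ ω ∂P, Y n ω < ∞ := fun n => ae_lt_top (hYm n) (hEYt n)
  let 𝒢 : Filtration ℕ (inferInstance : MeasurableSpace Ω) :=
    { seq := fun n => fieldSigma L (Finset.range n)
      mono' := fun m n hmn => fieldSigma_mono (Finset.range_subset_range.2 hmn)
      le' := fun n => hL.fieldSigma_le _ }
  have hint : ∀ n, Integrable (fun ω => (Y n ω).toReal) P := fun n =>
    integrable_toReal_of_lintegral_ne_top (hYm n).aemeasurable (hEYt n)
  have hmart : Martingale (fun n ω => (Y n ω).toReal) 𝒢 P := by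
    refine martingale_of_setIntegral_eq_succ
      (fun n => ((hY n).ennreal_toReal).stronglyMeasurable) hint fun n A hA => ?_
    have hA' : MeasurableSet A := hL.fieldSigma_le _ _ hA
    rw [integral_toReal (hYm _).aemeasurable (ae_restrict_of_ae (hfin _)),
      integral_toReal (hYm _).aemeasurable (ae_restrict_of_ae (hfin _)),
      ← lintegral_indicator hA', ← lintegral_indicator hA']
    congr 1
    have hw : Measurable[fieldSigma L (Finset.range n)] (A.indicator fun _ => (1 : ℝ≥0∞)) :=
      measurable_const.indicator hA
    have h1 := hL.lintegral_weight_mass_union ν (s := {n}) (t := Finset.range n) (by simp) hw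
    have h2 : {n} ∪ Finset.range n = Finset.range (n + 1) := by
      rw [Finset.range_add_one, Finset.insert_eq]
    rw [h2] at h1
    have h3 : ∀ m, ∫⁻ ω, A.indicator (Y m) ω ∂P =
        ∫⁻ ω, A.indicator (fun _ => (1 : ℝ≥0∞)) ω * mass L ν (Finset.range m) ω ∂P := by
      intro m
      refine lintegral_congr_ae ?_
      filter_upwards [hYe m] with ω hω
      by_cases h : ω ∈ A <;> simp [h, hω]
    change ∫⁻ ω, A.indicator (Y n) ω ∂P = ∫⁻ ω, A.indicator (Y (n + 1)) ω ∂P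
    rw [h3, h3, h1]
  have hbdd : ∀ n, eLpNorm (fun ω => (Y n ω).toReal) 1 P ≤ ((ν Set.univ).toNNReal : ℝ≥0∞) := by
    intro n
    rw [eLpNorm_one_eq_lintegral_enorm, ENNReal.coe_toNNReal (measure_ne_top _ _), ← hEY n]
    refine lintegral_mono fun ω => ?_
    simp only
    rw [Real.enorm_eq_ofReal ENNReal.toReal_nonneg]
    exact ENNReal.ofReal_toReal_le
  filter_upwards [hmart.submartingale.ae_tendsto_limitProcess hbdd, ae_all_iff.2 hYe,
    ae_all_iff.2 hfin] with ω h1 h2 h3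
  refine ⟨_, (ENNReal.tendsto_ofReal h1).congr fun n => ?_⟩
  rw [ENNReal.ofReal_toReal (h3 n).ne, h2 n]

lemma IsCascade.tendsto_limitMass (hL : IsCascade P L) (σ : Measure S) [IsFiniteMeasure σ]
    (B : Set S) : ∀ᵐ ω ∂P, Tendsto (fun n => mass L (σ.restrict B) (Finset.range n) ω) atTop
      (𝓝 (limitMass L σ B ω)) := by
  filter_upwards [hL.exists_tendsto_mass (σ.restrict B)] with ω ⟨x, hx⟩
  rwa [limitMass, hx.limsup_eq]

variable {σ : Measure S} [IsFiniteMeasure σ] {p : ℝ} {C : ℝ≥0∞}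

/-- No mass is lost in the limit, since the masses are bounded in `L^p` with `p > 1`. -/
lemma IsCascade.lintegral_limitMass (hL : IsCascade P L) (hp : 1 < p) (hC : C ≠ ∞)
    (hb : ∀ n, ∫⁻ ω, mass L σ (Finset.range n) ω ^ p ∂P ≤ C) (B : Set S) :
    ∫⁻ ω, limitMass L σ B ω ∂P = σ B := by
  have : IsProbabilityMeasure P := hL.indep.isProbabilityMeasure
  have hm := fun n => hL.measurable_mass (σ.restrict B) (Finset.range n)
  have hE : ∀ n, ∫⁻ ω, mass L (σ.restrict B) (Finset.range n) ω ^ (1 : ℝ) ∂P = σ B := fun n => by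
    simp [hL.lintegral_mass]
  have hlim := hL.tendsto_limitMass σ B
  refine le_antisymm ?_ ?_
  · have := lintegral_rpow_le_of_tendsto hm hlim (q := 1) (Eventually.of_forall fun n => (hE n).le)
    simpa using this
  · have hb' : ∀ n, ∫⁻ ω, mass L (σ.restrict B) (Finset.range n) ω ^ p ∂P ≤ C := fun n =>
      le_trans (lintegral_mono fun ω => ENNReal.rpow_le_rpow (mass_restrict_le σ B _ ω)
        (by linarith)) (hb n)
    have := le_lintegral_rpow_of_tendsto hm (hL.measurable_limitMass σ B).aemeasurable
      (tendsto_lintegral_sub_of_bounded hm hlim hp hC hb') zero_lt_one le_rfl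
      (Eventually.of_forall fun n => (hE n).ge)
    simpa using this

/-- Countable additivity. One inequality is Fatou's lemma for sums, and both sides have the same
finite mean. The exceptional null set depends on the sequence of sets. -/
lemma IsCascade.limitMass_iUnion (hL : IsCascade P L) (hp : 1 < p) (hC : C ≠ ∞)
    (hb : ∀ n, ∫⁻ ω, mass L σ (Finset.range n) ω ^ p ∂P ≤ C) {A : ℕ → Set S}
    (hd : Pairwise (Function.onFun Disjoint A)) (hA : ∀ i, MeasurableSet (A i)) :
    ∀ᵐ ω ∂P, limitMass L σ (⋃ i, A i) ω = ∑' i, limitMass L σ (A i) ω := by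
  have hle : ∀ᵐ ω ∂P, ∑' i, limitMass L σ (A i) ω ≤ limitMass L σ (⋃ i, A i) ω := by
    filter_upwards [hL.tendsto_limitMass σ (⋃ i, A i),
      ae_all_iff.2 fun i => hL.tendsto_limitMass σ (A i)] with ω h1 h2
    rw [ENNReal.tsum_eq_iSup_sum]
    refine iSup_le fun s => ?_
    refine le_of_tendsto_of_tendsto' (tendsto_finsetSum s fun i _ => h2 i) h1 fun n => ?_
    refine (ENNReal.sum_le_tsum s).trans (le_of_eq ?_)
    simp only [mass]
    rw [lintegral_iUnion hA hd]
  refine (ae_eq_of_ae_le_of_lintegral_le hle ?_ (hL.measurable_limitMass σ _).aemeasurable ?_).symm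
  · rw [lintegral_tsum fun i => (hL.measurable_limitMass σ _).aemeasurable]
    simp_rw [hL.lintegral_limitMass hp hC hb]
    rw [← measure_iUnion hd hA]
    exact measure_ne_top _ _
  · rw [lintegral_tsum fun i => (hL.measurable_limitMass σ _).aemeasurable]
    simp_rw [hL.lintegral_limitMass hp hC hb]
    rw [← measure_iUnion hd hA]

lemma IsCascade.limitMass_add_compl (hL : IsCascade P L) {A : Set S} (hA : MeasurableSet A) :
    ∀ᵐ ω ∂P, limitMass L σ A ω + limitMass L σ Aᶜ ω = limitMass L σ Set.univ ω := by
  filter_upwards [hL.tendsto_limitMass σ A, hL.tendsto_limitMass σ Aᶜ,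
    hL.tendsto_limitMass σ Set.univ] with ω h1 h2 h3
  refine tendsto_nhds_unique ((h1.add h2).congr fun n => ?_) h3
  simp only [mass, Measure.restrict_univ]
  exact lintegral_add_compl _ hA

lemma IsCascade.limitMass_monotone_iUnion (hL : IsCascade P L) (hp : 1 < p) (hC : C ≠ ∞)
    (hb : ∀ n, ∫⁻ ω, mass L σ (Finset.range n) ω ^ p ∂P ≤ C) {A : ℕ → Set S} (hA : Monotone A) :
    ∀ᵐ ω ∂P, ⨆ i, limitMass L σ (A i) ω = limitMass L σ (⋃ i, A i) ω := by
  have hE : ∫⁻ ω, ⨆ i, limitMass L σ (A i) ω ∂P = σ (⋃ i, A i) := by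
    rw [lintegral_iSup (fun i => hL.measurable_limitMass σ _)
      fun i j hij ω => limitMass_mono (hA hij) ω]
    simp_rw [hL.lintegral_limitMass hp hC hb]
    exact hA.measure_iUnion.symm
  refine ae_eq_of_ae_le_of_lintegral_le
    (ae_of_all _ fun ω => iSup_le fun i => limitMass_mono (Set.subset_iUnion A i) ω) ?_
    (hL.measurable_limitMass σ _).aemeasurable ?_
  · rw [hE]; exact measure_ne_top _ _
  · rw [hE, hL.lintegral_limitMass hp hC hb]

lemma IsCascade.limitMass_antitone_iInter (hL : IsCascade P L) (hp : 1 < p) (hC : C ≠ ∞)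
    (hb : ∀ n, ∫⁻ ω, mass L σ (Finset.range n) ω ^ p ∂P ≤ C) {A : ℕ → Set S} (hA : Antitone A)
    (hAm : ∀ i, MeasurableSet (A i)) :
    ∀ᵐ ω ∂P, limitMass L σ (⋂ i, A i) ω = ⨅ i, limitMass L σ (A i) ω := by
  have hE : ∫⁻ ω, ⨅ i, limitMass L σ (A i) ω ∂P = σ (⋂ i, A i) := by
    rw [lintegral_iInf (fun i => hL.measurable_limitMass σ _)
      (fun i j hij ω => limitMass_mono (hA hij) ω)
      (by rw [hL.lintegral_limitMass hp hC hb]; exact measure_ne_top _ _)]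
    simp_rw [hL.lintegral_limitMass hp hC hb]
    exact (hA.measure_iInter (fun i => (hAm i).nullMeasurableSet) ⟨0, measure_ne_top _ _⟩).symm
  refine ae_eq_of_ae_le_of_lintegral_le
    (ae_of_all _ fun ω => le_iInf fun i => limitMass_mono (Set.iInter_subset A i) ω) ?_
    (Measurable.iInf fun i => hL.measurable_limitMass σ _).aemeasurable ?_
  · rw [hL.lintegral_limitMass hp hC hb]; exact measure_ne_top _ _
  · rw [hE, hL.lintegral_limitMass hp hC hb]

/-- The limit masses are the values of a random measure. After an embedding of `S` into the real
line, that measure is built from its random distribution function. -/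
theorem IsCascade.exists_limit_kernel [StandardBorelSpace S] (hL : IsCascade P L) (hp : 1 < p)
    (hC : C ≠ ∞) (hb : ∀ n, ∫⁻ ω, mass L σ (Finset.range n) ω ^ p ∂P ≤ C) :
    ∃ μ : Kernel Ω S, ∀ B, MeasurableSet B → ∀ᵐ ω ∂P, μ ω B = limitMass L σ B ω := by
  set e := embeddingReal S
  have he : MeasurableEmbedding e := measurableEmbedding_embeddingReal S
  have hem : Measurable e := he.measurable
  set u : Ω → ℚ → ℝ≥0∞ := fun ω r => limitMass L σ (e ⁻¹' Set.Iic (r : ℝ)) ω with hu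
  -- the distribution function is normalized by the total mass `T`; where `T = 0`, the measure
  -- `T ω • κ ω` is zero, whatever `κ ω` is
  set T : Ω → ℝ≥0∞ := limitMass L σ Set.univ with hT
  have hTm : Measurable T := hL.measurable_limitMass σ _
  have hGm : Measurable fun (ω : Ω) (r : ℚ) => (u ω r / T ω).toReal :=
    measurable_pi_lambda _ fun r => ((hL.measurable_limitMass σ _).div hTm).ennreal_toReal
  set κ : Ω → Measure ℝ := fun ω => (stieltjesOfMeasurableRat _ hGm ω).measure with hκ
  have hκm : Measurable κ := measurable_measure_stieltjesOfMeasurableRat hGm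
  have hTfin : ∀ᵐ ω ∂P, T ω < ∞ := ae_lt_top hTm (by
    rw [hL.lintegral_limitMass hp hC hb]; exact measure_ne_top _ _)
  have hpoint : ∀ᵐ ω ∂P, T ω ≠ 0 →
      IsRatStieltjesPoint (fun ω r => (u ω r / T ω).toReal) ω := by
    have htop : ∀ᵐ ω ∂P, ⨆ n : ℕ, u ω n = T ω := by
      have := hL.limitMass_monotone_iUnion hp hC hb
        (A := fun n : ℕ => e ⁻¹' Set.Iic ((n : ℚ) : ℝ))
        (fun m n h => Set.preimage_mono (Set.Iic_subset_Iic.2 (by exact_mod_cast h)))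
      have h2 : ⋃ n : ℕ, e ⁻¹' Set.Iic ((n : ℚ) : ℝ) = Set.univ := by
        refine Set.eq_univ_of_forall fun x => Set.mem_iUnion.2 ?_
        obtain ⟨n, hn⟩ := exists_nat_ge (e x)
        exact ⟨n, by simpa using hn⟩
      rwa [h2] at this
    have hbot : ∀ᵐ ω ∂P, ⨅ n : ℕ, u ω (-n) = 0 := by
      have := hL.limitMass_antitone_iInter hp hC hb
        (A := fun n : ℕ => e ⁻¹' Set.Iic ((-n : ℚ) : ℝ))
        (fun m n h => Set.preimage_mono (Set.Iic_subset_Iic.2 (by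
          have : (m : ℝ) ≤ n := by exact_mod_cast h
          push_cast; linarith)))
        fun n => hem measurableSet_Iic
      have h2 : ⋂ n : ℕ, e ⁻¹' Set.Iic ((-n : ℚ) : ℝ) = ∅ := by
        refine Set.eq_empty_of_forall_notMem fun x hx => ?_
        obtain ⟨n, hn⟩ := exists_nat_gt (-e x)
        have := Set.mem_iInter.1 hx n
        simp only [Set.mem_preimage, Set.mem_Iic] at this
        push_cast at this
        linarith
      rw [h2] at this
      filter_upwards [this] with ω hω
      rw [limitMass_empty] at hω
      exact hω.symm
    have hright : ∀ᵐ ω ∂P, ∀ t : ℚ, ⨅ n : ℕ, u ω (t + 1 / (n + 1)) = u ω t := by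
      refine ae_all_iff.2 fun t => ?_
      have := hL.limitMass_antitone_iInter hp hC hb
        (A := fun n : ℕ => e ⁻¹' Set.Iic ((t + 1 / (n + 1) : ℚ) : ℝ))
        (fun m n h => Set.preimage_mono (Set.Iic_subset_Iic.2 (by
          have : (t + 1 / (n + 1) : ℚ) ≤ t + 1 / (m + 1) := by gcongr
          exact_mod_cast this)))
        fun n => hem measurableSet_Iic
      have h2 : ⋂ n : ℕ, e ⁻¹' Set.Iic ((t + 1 / (n + 1) : ℚ) : ℝ) = e ⁻¹' Set.Iic (t : ℝ) := by
        ext x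
        simp only [Set.mem_iInter, Set.mem_preimage, Set.mem_Iic]
        constructor
        · intro h
          have h3 : Tendsto (fun n : ℕ => (t : ℝ) + 1 / ((n : ℝ) + 1)) atTop (𝓝 (t + 0)) :=
            tendsto_const_nhds.add tendsto_one_div_add_atTop_nhds_zero_nat
          rw [add_zero] at h3
          exact ge_of_tendsto' h3 fun n => by simpa using h n
        · intro h n
          have : (t : ℝ) ≤ ((t + 1 / (n + 1) : ℚ) : ℝ) := by
            have : (0 : ℚ) ≤ 1 / (n + 1) := by positivity
            exact_mod_cast (by linarith : t ≤ t + 1 / (n + 1))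
          exact h.trans this
      rw [h2] at this
      filter_upwards [this] with ω hω
      exact hω.symm
    filter_upwards [htop, hbot, hright, hTfin] with ω h1 h2 h3 h4 h0
    exact isRatStieltjesPoint_of_sequences u T ω
      (fun r r' h => limitMass_mono (Set.preimage_mono (Set.Iic_subset_Iic.2
        (by exact_mod_cast h))) ω) h0 h4.ne
      (fun r => limitMass_mono (Set.subset_univ _) ω) h1 h2 h3
  have hall : ∀ A : Set ℝ, MeasurableSet A →
      ∀ᵐ ω ∂P, T ω * κ ω A = limitMass L σ (e ⁻¹' A) ω := by
    intro A hA
    induction A, hA using MeasurableSpace.induction_on_inter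
      ((BorelSpace.measurable_eq (α := ℝ)).trans Real.borel_eq_generateFrom_Iic_rat)
      Real.isPiSystem_Iic_rat with
    | empty => simp [limitMass_empty]
    | basic A hA =>
      obtain ⟨r, rfl⟩ : ∃ r : ℚ, Set.Iic (r : ℝ) = A := by simpa using hA
      filter_upwards [hpoint, hTfin] with ω h1 h2
      rcases eq_or_ne (T ω) 0 with h0 | h0
      · have : limitMass L σ (e ⁻¹' Set.Iic (r : ℝ)) ω ≤ T ω :=
          limitMass_mono (Set.subset_univ _) ω
        rw [h0] at this ⊢
        rw [le_antisymm this bot_le]; simp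
      · simp only [hκ]
        rw [measure_stieltjesOfMeasurableRat_Iic, stieltjesOfMeasurableRat_eq,
          toRatCDF_of_isRatStieltjesPoint (h1 h0), ENNReal.ofReal_toReal,
          ENNReal.mul_div_cancel h0 h2.ne]
        have : u ω r ≤ T ω := limitMass_mono (Set.subset_univ _) ω
        exact (ENNReal.div_lt_top (this.trans_lt h2).ne h0).ne
    | compl A hA ih =>
      filter_upwards [ih, hL.limitMass_add_compl (σ := σ) (hem hA), hTfin] with ω h1 h2 h3
      have h4 : T ω * κ ω A + T ω * κ ω Aᶜ = T ω := by
        rw [← mul_add, measure_add_measure_compl hA]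
        simp [hκ]
      rw [← h1, Set.preimage_compl.symm] at h2
      have h5 : T ω * κ ω A ≠ ∞ := by
        intro h; rw [h, top_add] at h4; exact h3.ne h4.symm
      exact (ENNReal.add_right_inj h5).1 (h4.trans h2.symm)
    | iUnion A hd hA ih =>
      filter_upwards [ae_all_iff.2 ih, hL.limitMass_iUnion hp hC hb (A := fun i => e ⁻¹' A i)
        (fun i j hij => (hd hij).preimage e) fun i => hem (hA i)] with ω h1 h2
      rw [Set.preimage_iUnion, h2, measure_iUnion hd hA, ← ENNReal.tsum_mul_left]
      simp_rw [h1]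
  refine ⟨⟨fun ω => T ω • (κ ω).comap e, ?_⟩, fun B hB => ?_⟩
  · refine Measure.measurable_of_measurable_coe _ fun B hB => ?_
    simp only [Measure.smul_apply, smul_eq_mul, he.comap_apply]
    exact hTm.mul ((Measure.measurable_coe (he.measurableSet_image.2 hB)).comp hκm)
  · filter_upwards [hall (e '' B) (he.measurableSet_image.2 hB)] with ω h
    change (T ω • (κ ω).comap e) B = _
    rw [Measure.smul_apply, smul_eq_mul, he.comap_apply, h, Set.preimage_image_eq _ he.injective]

end LimitMass

/-! ### Geometry of the sphere -/

/-- Two vectors of equal norm are related by a rotation, the product of the reflection that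
exchanges them and of a reflection that fixes the second one. -/
lemma exists_isometry_det_eq_one {E : Type*} [NormedAddCommGroup E] [InnerProductSpace ℝ E]
    [FiniteDimensional ℝ E] (hE : 2 ≤ Module.finrank ℝ E) {x y : E} (hxy : ‖x‖ = ‖y‖)
    (hy : y ≠ 0) :
    ∃ g : E ≃ₗᵢ[ℝ] E, LinearMap.det (g.toLinearEquiv : E →ₗ[ℝ] E) = 1 ∧ g x = y := by
  rcases eq_or_ne x y with rfl | hne
  · exact ⟨LinearIsometryEquiv.refl ℝ E, LinearMap.det_id, rfl⟩
  have hdet : ∀ v : E, v ≠ 0 →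
      LinearMap.det (((ℝ ∙ v)ᗮ).reflection.toLinearEquiv : E →ₗ[ℝ] E) = -1 := by
    intro v hv
    have := ((ℝ ∙ v)ᗮ).det_reflection
    rw [Submodule.orthogonal_orthogonal, finrank_span_singleton hv, pow_one] at this
    exact this
  obtain ⟨z, hz, hz0⟩ : ∃ z ∈ (ℝ ∙ y)ᗮ, z ≠ 0 := by
    refine Submodule.exists_mem_ne_zero_of_ne_bot fun hbot => ?_
    have h1 := (ℝ ∙ y).finrank_add_finrank_orthogonal
    rw [hbot, finrank_bot, finrank_span_singleton hy] at h1
    omega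
  refine ⟨((ℝ ∙ (x - y))ᗮ).reflection.trans ((ℝ ∙ z)ᗮ).reflection, ?_, ?_⟩
  · have h3 := LinearMap.det_comp (((ℝ ∙ z)ᗮ).reflection.toLinearEquiv : E →ₗ[ℝ] E)
      ((((ℝ ∙ (x - y))ᗮ).reflection).toLinearEquiv : E →ₗ[ℝ] E)
    rw [hdet _ (sub_ne_zero.2 hne), hdet _ hz0] at h3
    norm_num at h3
    exact h3
  · change ((ℝ ∙ z)ᗮ).reflection (((ℝ ∙ (x - y))ᗮ).reflection x) = y
    rw [Submodule.reflection_sub hxy]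
    refine Submodule.reflection_mem_subspace_eq_self ?_
    rw [Submodule.mem_orthogonal_singleton_iff_inner_right] at hz ⊢
    rw [real_inner_comm]; exact hz

section Sphere
variable {d : ℕ}

lemma norm_sph (x : Sph d) : ‖(x : EuclideanSpace ℝ (Fin (d + 1)))‖ = 1 := by
  simp

lemma sph_ne_zero (x : Sph d) : (x : EuclideanSpace ℝ (Fin (d + 1))) ≠ 0 := by
  intro h; simpa [h] using norm_sph x

/-- The rotation group acts transitively on a sphere of positive dimension: a reflection that maps
`x` to `y` is composed with a reflection that fixes `y`. -/
lemma exists_rotation (hd : 1 ≤ d) (x y : Sph d) :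
    ∃ g : EuclideanSpace ℝ (Fin (d + 1)) ≃ₗᵢ[ℝ] EuclideanSpace ℝ (Fin (d + 1)),
      LinearMap.det (g.toLinearEquiv :
        EuclideanSpace ℝ (Fin (d + 1)) →ₗ[ℝ] EuclideanSpace ℝ (Fin (d + 1))) = 1 ∧
      actSph g x = y := by
  obtain ⟨g, h1, h2⟩ := exists_isometry_det_eq_one (E := EuclideanSpace ℝ (Fin (d + 1)))
    (by rw [finrank_euclideanSpace_fin]; omega) (x := x) (y := y)
    (by rw [norm_sph, norm_sph]) (sph_ne_zero y)
  exact ⟨g, h1, Subtype.ext h2⟩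

lemma angDist_comm (x y : Sph d) : angDist x y = angDist y x := InnerProductGeometry.angle_comm _ _

lemma angDist_nonneg (x y : Sph d) : 0 ≤ angDist x y := InnerProductGeometry.angle_nonneg _ _

lemma angDist_le_pi (x y : Sph d) : angDist x y ≤ Real.pi := InnerProductGeometry.angle_le_pi _ _

lemma angDist_self (x : Sph d) : angDist x x = 0 := InnerProductGeometry.angle_self (sph_ne_zero x)

lemma angDist_triangle (x y z : Sph d) : angDist x z ≤ angDist x y + angDist y z :=
  InnerProductGeometry.angle_le_angle_add_angle _ _ _

lemma angDist_actSph (g : EuclideanSpace ℝ (Fin (d + 1)) ≃ₗᵢ[ℝ] EuclideanSpace ℝ (Fin (d + 1)))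
    (x y : Sph d) : angDist (actSph g x) (actSph g y) = angDist x y :=
  g.toLinearIsometry.angle_map _ _

lemma continuous_angDist : Continuous fun x : Sph d × Sph d => angDist x.1 x.2 := by
  refine continuous_iff_continuousAt.2 fun x => ?_
  have h1 := InnerProductGeometry.continuousAt_angle
    (x := ((x.1 : EuclideanSpace ℝ (Fin (d + 1))), (x.2 : EuclideanSpace ℝ (Fin (d + 1)))))
    (sph_ne_zero _) (sph_ne_zero _)
  exact ContinuousAt.comp (g := fun y : EuclideanSpace ℝ (Fin (d + 1)) ×
    EuclideanSpace ℝ (Fin (d + 1)) => InnerProductGeometry.angle y.1 y.2)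
    (f := fun x : Sph d × Sph d => ((x.1 : EuclideanSpace ℝ (Fin (d + 1))),
      (x.2 : EuclideanSpace ℝ (Fin (d + 1))))) h1 (by fun_prop)

lemma measurable_angDist : Measurable fun x : Sph d × Sph d => angDist x.1 x.2 :=
  continuous_angDist.measurable

lemma measurable_angDist_left (x : Sph d) : Measurable fun y : Sph d => angDist x y :=
  Measurable.comp (g := fun x : Sph d × Sph d => angDist x.1 x.2) (f := fun y => (x, y))
    measurable_angDist measurable_prodMk_left

lemma measurable_angDist_right (x : Sph d) : Measurable fun y : Sph d => angDist y x :=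
  Measurable.comp (g := fun x : Sph d × Sph d => angDist x.1 x.2) (f := fun y => (y, x))
    measurable_angDist measurable_prodMk_right

lemma measurableSet_sphCap (x : Sph d) (u : ℝ) : MeasurableSet (sphCap x u) :=
  measurableSet_le (measurable_angDist_right x) measurable_const

/-- The chord of an arc. -/
lemma norm_sub_eq_two_mul_sin (x y : Sph d) :
    ‖(x : EuclideanSpace ℝ (Fin (d + 1))) - y‖ = 2 * Real.sin (angDist x y / 2) := by
  have h0 : 0 ≤ Real.sin (angDist x y / 2) := Real.sin_nonneg_of_nonneg_of_le_pi
    (by linarith [angDist_nonneg x y]) (by linarith [angDist_le_pi x y, Real.pi_pos])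
  have h1 := InnerProductGeometry.cos_angle_mul_norm_mul_norm
    (x : EuclideanSpace ℝ (Fin (d + 1))) y
  rw [norm_sph, norm_sph] at h1
  rw [← sq_eq_sq₀ (norm_nonneg _) (by positivity), mul_pow, Real.sin_sq_eq_half_sub,
    @norm_sub_sq_real, norm_sph, norm_sph, ← h1, angDist, mul_div_cancel₀ _ two_ne_zero]
  ring

lemma norm_sub_le_angDist (x y : Sph d) :
    ‖(x : EuclideanSpace ℝ (Fin (d + 1))) - y‖ ≤ angDist x y := by
  rw [norm_sub_eq_two_mul_sin]
  have := Real.sin_le (x := angDist x y / 2) (by linarith [angDist_nonneg x y])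
  linarith

lemma angDist_le_norm_sub (x y : Sph d) :
    angDist x y ≤ 2 * ‖(x : EuclideanSpace ℝ (Fin (d + 1))) - y‖ := by
  rw [norm_sub_eq_two_mul_sin]
  have h1 := Real.mul_le_sin (x := angDist x y / 2) (by linarith [angDist_nonneg x y])
    (by linarith [angDist_le_pi x y])
  have h2 : (1 : ℝ) / 2 ≤ 2 / Real.pi := by
    rw [div_le_div_iff₀ two_pos Real.pi_pos]; linarith [Real.pi_le_four]
  have h3 : 1 / 2 * (angDist x y / 2) ≤ 2 / Real.pi * (angDist x y / 2) :=
    mul_le_mul_of_nonneg_right h2 (by linarith [angDist_nonneg x y])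
  linarith

open scoped Pointwise in
/-- The open cone of height `t` over a set of points of the sphere. -/
def cone (A : Set (Sph d)) (t : ℝ) : Set (EuclideanSpace ℝ (Fin (d + 1))) :=
  Set.Ioo (0 : ℝ) t • (Subtype.val '' A)

open scoped Pointwise in
lemma mem_cone {A : Set (Sph d)} {t : ℝ} {z : EuclideanSpace ℝ (Fin (d + 1))} :
    z ∈ cone A t ↔ ∃ r, 0 < r ∧ r < t ∧ ∃ y ∈ A, r • (y : EuclideanSpace ℝ (Fin (d + 1))) = z := by
  simp only [cone, Set.mem_smul, Set.mem_Ioo, Set.mem_image, and_assoc, exists_exists_and_eq_and]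

open scoped Pointwise in
/-- The measure on the sphere is defined by cones of height `1`; the other heights follow by
scaling. -/
lemma volume_cone {A : Set (Sph d)} (hA : MeasurableSet A) {t : ℝ} (ht : 0 < t) :
    ((d : ℝ≥0∞) + 1) * volume (cone A t) = ENNReal.ofReal (t ^ (d + 1)) * surfaceMeasure d A := by
  have h1 : Set.Ioo (0 : ℝ) t = t • Set.Ioo (0 : ℝ) 1 := by simp [LinearOrderedField.smul_Ioo ht]
  rw [surfaceMeasure, Measure.toSphere_apply' _ hA, cone, h1, smul_assoc,
    Measure.addHaar_smul_of_nonneg _ ht.le, finrank_euclideanSpace_fin]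
  push_cast
  ring

lemma volume_cone_ne_top {A : Set (Sph d)} {t : ℝ} : volume (cone A t) ≠ ∞ := by
  refine ((measure_mono ?_).trans_lt (measure_ball_lt_top (x := 0) (r := t))).ne
  intro z hz
  obtain ⟨r, h0, hr, y, -, rfl⟩ := mem_cone.1 hz
  simpa [norm_smul, abs_of_pos h0] using hr

lemma volume_real_cone {A : Set (Sph d)} (hA : MeasurableSet A) {t : ℝ} (ht : 0 < t) :
    ((d : ℝ) + 1) * volume.real (cone A t) = t ^ (d + 1) * (surfaceMeasure d).real A := by
  have := congrArg ENNReal.toReal (volume_cone hA ht)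
  rw [ENNReal.toReal_mul, ENNReal.toReal_mul, ENNReal.toReal_ofReal (by positivity)] at this
  rw [Measure.real, Measure.real, ← this]
  congr 1

/-- The measure of a cap of radius `r` is at most of order `r ^ d`: the shell of thickness `r` over
the cap lies in a ball of radius `2 * r`. -/
lemma exists_surface_cap_le (d : ℕ) : ∃ C : ℝ, 0 < C ∧ ∀ (x : Sph d) (r : ℝ), 0 < r →
    (surfaceMeasure d).real (sphCap x r) ≤ C * r ^ d := by
  set v := volume.real (Metric.closedBall (0 : EuclideanSpace ℝ (Fin (d + 1))) 1) with hv
  set s := (surfaceMeasure d).real Set.univ with hs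
  have hs0 : 0 ≤ s := measureReal_nonneg
  have hv0 : 0 ≤ v := measureReal_nonneg
  have hfin : IsFiniteMeasure (surfaceMeasure d) := by unfold surfaceMeasure; infer_instance
  refine ⟨s + (d + 1) * 2 ^ (d + 1) * v + 1, by positivity, fun x r hr => ?_⟩
  rcases le_or_gt 1 r with h1 | h1
  · calc (surfaceMeasure d).real (sphCap x r) ≤ s * 1 := by
          rw [mul_one]; exact measureReal_mono (Set.subset_univ _)
      _ ≤ _ := by
          have : 0 ≤ ((d : ℝ) + 1) * 2 ^ (d + 1) * v := by positivity
          have h2 := one_le_pow₀ h1 (n := d)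
          exact mul_le_mul (by linarith) h2 zero_le_one (by positivity)
  set A := sphCap x r with hA
  have hAm : MeasurableSet A := measurableSet_sphCap x r
  have hsub : cone A 1 ⊆ cone A (1 - r) ∪
      Metric.closedBall (x : EuclideanSpace ℝ (Fin (d + 1))) (2 * r) := by
    intro z hz
    obtain ⟨t, h0, ht, y, hy, rfl⟩ := mem_cone.1 hz
    rcases lt_or_ge t (1 - r) with h | h
    · exact Or.inl (mem_cone.2 ⟨t, h0, h, y, hy, rfl⟩)
    · right
      have h2 : ‖(y : EuclideanSpace ℝ (Fin (d + 1))) - x‖ ≤ r := (norm_sub_le_angDist y x).trans hy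
      rw [mem_closedBall_iff_norm]
      calc ‖t • (y : EuclideanSpace ℝ (Fin (d + 1))) - x‖
          = ‖(t - 1) • (y : EuclideanSpace ℝ (Fin (d + 1))) + (y - x)‖ := by
            congr 1; module
        _ ≤ ‖(t - 1) • (y : EuclideanSpace ℝ (Fin (d + 1)))‖ +
            ‖(y : EuclideanSpace ℝ (Fin (d + 1))) - x‖ := norm_add_le _ _
        _ ≤ r + r := by
            gcongr
            rw [norm_smul, norm_sph, mul_one, Real.norm_eq_abs, abs_le]
            constructor <;> linarith
        _ = 2 * r := by ring
  have hvol : volume.real (cone A 1) ≤ volume.real (cone A (1 - r)) + (2 * r) ^ (d + 1) * v := by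
    have hb : volume.real (Metric.closedBall (x : EuclideanSpace ℝ (Fin (d + 1))) (2 * r)) =
        (2 * r) ^ (d + 1) * v := by
      rw [hv, Measure.addHaar_real_closedBall' _ _ (by positivity), finrank_euclideanSpace_fin]
    rw [← hb]
    refine (measureReal_mono hsub ?_).trans (measureReal_union_le _ _)
    exact measure_union_ne_top volume_cone_ne_top measure_closedBall_lt_top.ne
  have e1 := volume_real_cone hAm one_pos
  have e2 := volume_real_cone hAm (t := 1 - r) (by linarith)
  rw [one_pow, one_mul] at e1
  set a := (surfaceMeasure d).real A
  have ha0 : 0 ≤ a := measureReal_nonneg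
  have h3 : (1 - r) ^ (d + 1) ≤ 1 - r := by
    rw [pow_succ]
    exact mul_le_of_le_one_left (by linarith) (pow_le_one₀ (by linarith) (by linarith))
  have h4 : a * r ≤ ((d : ℝ) + 1) * 2 ^ (d + 1) * v * r ^ d * r := by
    have h5 := mul_le_mul_of_nonneg_left hvol (show (0 : ℝ) ≤ d + 1 by positivity)
    rw [mul_add, e1, e2] at h5
    have h6 : (1 - r) ^ (d + 1) * a ≤ (1 - r) * a := by gcongr
    have h7 : ((d : ℝ) + 1) * ((2 * r) ^ (d + 1) * v) =
        ((d : ℝ) + 1) * 2 ^ (d + 1) * v * r ^ d * r := by ring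
    linarith
  have h8 := le_of_mul_le_mul_right h4 hr
  refine h8.trans ?_
  gcongr
  linarith

/-- The measure of a cap of radius `r ≤ 1` is at least of order `r ^ d`: a ball of radius
`r / 4` is contained in a shell of thickness `r / 2` over the cap. -/
lemma exists_le_surface_cap (d : ℕ) : ∃ c : ℝ, 0 < c ∧ ∀ (x : Sph d) (r : ℝ), 0 < r → r ≤ 1 →
    c * r ^ d ≤ (surfaceMeasure d).real (sphCap x r) := by
  set v := volume.real (Metric.ball (0 : EuclideanSpace ℝ (Fin (d + 1))) 1) with hv
  have hv0 : 0 < v := ENNReal.toReal_pos (Metric.measure_ball_pos _ _ one_pos).ne'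
    measure_ball_lt_top.ne
  refine ⟨v * (1 / 4) ^ d / 2 ^ (d + 2), by positivity, fun x r hr hr1 => ?_⟩
  set ρ := r / 4 with hρ
  have hρ0 : 0 < ρ := by positivity
  set A := sphCap x r with hA
  have hAm : MeasurableSet A := measurableSet_sphCap x r
  have hnorm : ∀ z ∈ Metric.ball (x : EuclideanSpace ℝ (Fin (d + 1))) ρ,
      1 - ρ < ‖z‖ ∧ ‖z‖ < 1 + ρ := by
    intro z hz
    rw [mem_ball_iff_norm] at hz
    have h1 := abs_norm_sub_norm_le z (x : EuclideanSpace ℝ (Fin (d + 1)))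
    rw [norm_sph] at h1
    have h2 := abs_lt.1 (h1.trans_lt hz)
    constructor <;> linarith
  have hsub : Metric.ball (x : EuclideanSpace ℝ (Fin (d + 1))) ρ ⊆ cone A (1 + ρ) := by
    intro z hz
    obtain ⟨h1, h2⟩ := hnorm z hz
    have hz0 : 0 < ‖z‖ := by linarith
    have hy1 : ‖‖z‖⁻¹ • z‖ = 1 := by
      rw [norm_smul, norm_inv, norm_norm, inv_mul_cancel₀ hz0.ne']
    refine mem_cone.2 ⟨‖z‖, hz0, h2, ⟨‖z‖⁻¹ • z, by simpa using hy1⟩, ?_, ?_⟩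
    · refine (angDist_le_norm_sub _ _).trans ?_
      have h3 : ‖‖z‖⁻¹ • z - z‖ ≤ ρ := by
        have : ‖z‖⁻¹ • z - z = (1 - ‖z‖) • (‖z‖⁻¹ • z) := by
          rw [sub_smul, one_smul, smul_smul, mul_inv_cancel₀ hz0.ne', one_smul]
        rw [this, norm_smul, hy1, mul_one, Real.norm_eq_abs, abs_le]
        constructor <;> linarith
      have h4 := norm_sub_le_norm_sub_add_norm_sub (‖z‖⁻¹ • z) z
        (x : EuclideanSpace ℝ (Fin (d + 1)))
      rw [mem_ball_iff_norm] at hz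
      change 2 * ‖‖z‖⁻¹ • z - (x : EuclideanSpace ℝ (Fin (d + 1)))‖ ≤ r
      linarith
    · change ‖z‖ • (‖z‖⁻¹ • z) = z
      rw [smul_smul, mul_inv_cancel₀ hz0.ne', one_smul]
  have hdisj : Disjoint (cone A (1 - ρ)) (Metric.ball (x : EuclideanSpace ℝ (Fin (d + 1))) ρ) := by
    rw [Set.disjoint_left]
    intro z hz hz'
    obtain ⟨t, h0, ht, y, -, rfl⟩ := mem_cone.1 hz
    have := (hnorm _ hz').1
    rw [norm_smul, norm_sph, mul_one, Real.norm_eq_abs, abs_of_pos h0] at this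
    linarith
  have hvol : volume.real (cone A (1 - ρ)) + ρ ^ (d + 1) * v ≤ volume.real (cone A (1 + ρ)) := by
    have hb : volume.real (Metric.ball (x : EuclideanSpace ℝ (Fin (d + 1))) ρ) =
        ρ ^ (d + 1) * v := by
      rw [hv, Measure.real, Measure.real, Measure.addHaar_ball _ _ hρ0.le, ENNReal.toReal_mul,
        finrank_euclideanSpace_fin, ENNReal.toReal_ofReal (by positivity)]
    rw [← hb, ← measureReal_union hdisj measurableSet_ball volume_cone_ne_top
      measure_ball_lt_top.ne]
    refine measureReal_mono (Set.union_subset ?_ hsub) volume_cone_ne_top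
    intro z hz
    obtain ⟨t, h0, ht, y, hy, rfl⟩ := mem_cone.1 hz
    exact mem_cone.2 ⟨t, h0, by linarith, y, hy, rfl⟩
  have e1 := volume_real_cone hAm (t := 1 + ρ) (by linarith)
  have e2 := volume_real_cone hAm (t := 1 - ρ) (by linarith)
  set a := (surfaceMeasure d).real A
  have ha0 : 0 ≤ a := measureReal_nonneg
  have hup : ∀ n : ℕ, (1 + ρ) ^ n ≤ 1 + ρ * (2 ^ n - 1) := by
    intro n
    induction n with
    | zero => simp
    | succ n ih =>
      have h1 : (1 : ℝ) ≤ 2 ^ n := one_le_pow₀ one_le_two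
      have h2 : ρ * (ρ * (2 ^ n - 1)) ≤ 1 * (ρ * (2 ^ n - 1)) := by
        exact mul_le_mul_of_nonneg_right (by linarith) (mul_nonneg hρ0.le (by linarith))
      calc (1 + ρ) ^ (n + 1) = (1 + ρ) ^ n * (1 + ρ) := pow_succ _ _
        _ ≤ (1 + ρ * (2 ^ n - 1)) * (1 + ρ) := by gcongr
        _ ≤ 1 + ρ * (2 ^ (n + 1) - 1) := by rw [pow_succ]; nlinarith
  have hlow := one_add_mul_le_pow (a := -ρ) (by linarith) (d + 1)
  have hd2 : (d : ℝ) + 1 ≤ 2 ^ (d + 1) := by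
    exact_mod_cast (Nat.lt_two_pow_self (n := d + 1)).le
  have h5 := mul_le_mul_of_nonneg_left hvol (show (0 : ℝ) ≤ d + 1 by positivity)
  rw [mul_add, e1, e2] at h5
  have h6 : (1 + ρ) ^ (d + 1) - (1 - ρ) ^ (d + 1) ≤ ρ * (2 ^ (d + 1) + ((d : ℝ) + 1)) := by
    have := hup (d + 1)
    push_cast at hlow
    rw [← sub_eq_add_neg] at hlow
    nlinarith
  have h7 : ((d : ℝ) + 1) * (ρ ^ d * v) * ρ ≤ (2 ^ (d + 1) + ((d : ℝ) + 1)) * a * ρ := by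
    have := mul_le_mul_of_nonneg_right h6 ha0
    have e : ((d : ℝ) + 1) * (ρ ^ (d + 1) * v) = ((d : ℝ) + 1) * (ρ ^ d * v) * ρ := by ring
    nlinarith
  have h8 := le_of_mul_le_mul_right h7 hρ0
  have hpos : (0 : ℝ) < 2 ^ (d + 2) := by positivity
  rw [div_mul_eq_mul_div, div_le_iff₀ hpos]
  have e : v * (1 / 4) ^ d * r ^ d = ρ ^ d * v := by rw [hρ, div_pow, div_pow]; ring
  rw [e]
  calc ρ ^ d * v ≤ ((d : ℝ) + 1) * (ρ ^ d * v) :=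
        le_mul_of_one_le_left (by positivity) (by linarith [Nat.cast_nonneg (α := ℝ) d])
    _ ≤ (2 ^ (d + 1) + ((d : ℝ) + 1)) * a := h8
    _ ≤ (2 ^ (d + 1) + 2 ^ (d + 1)) * a := by gcongr
    _ = a * 2 ^ (d + 2) := by ring

end Sphere

/-! ### Uniform bound for the moment of order `p` -/

/-- A function with values in `[0, 1]` whose sublevel sets `{u ≤ t}` have measure at most
`A * t ^ d` has a finite moment of order `-β` for every `β < d`, by comparison with a dyadic sum. -/
lemma exists_lintegral_rpow_neg_le {S : Type*} [MeasurableSpace S] {d : ℕ} {β A : ℝ} (hβ0 : 0 < β)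
    (hβ : β < d) (hA : 0 ≤ A) : ∃ K : ℝ≥0∞, K ≠ ∞ ∧ ∀ (ν : Measure S) (u : S → ℝ), Measurable u →
      (∀ᵐ x ∂ν, 0 ≤ u x ∧ u x ≤ 1) →
      (∀ t, 0 < t → t ≤ 1 → ν {x | u x ≤ t} ≤ ENNReal.ofReal (A * t ^ d)) →
      ∫⁻ x, ENNReal.ofReal (u x) ^ (-β) ∂ν ≤ K := by
  set r : ℝ≥0∞ := ENNReal.ofReal (2 ^ (β - d)) with hr
  have hr1 : r < 1 := by
    rw [hr, ENNReal.ofReal_lt_one]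
    exact Real.rpow_lt_one_of_one_lt_of_neg one_lt_two (by linarith)
  set c : ℕ → ℝ≥0∞ := fun j => ENNReal.ofReal ((2 : ℝ) ^ (((j : ℝ) + 1) * β)) with hc
  refine ⟨ENNReal.ofReal (2 ^ β * A) * (1 - r)⁻¹,
    ENNReal.mul_ne_top ENNReal.ofReal_ne_top (ENNReal.inv_ne_top.2 (tsub_pos_of_lt hr1).ne'), ?_⟩
  intro ν u hu hu01 hνu
  have hset : ∀ j : ℕ, MeasurableSet {x | u x ≤ (1 / 2 : ℝ) ^ j} := fun j =>
    measurableSet_le hu measurable_const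
  calc ∫⁻ x, ENNReal.ofReal (u x) ^ (-β) ∂ν
      ≤ ∫⁻ x, ∑' j, {x | u x ≤ (1 / 2 : ℝ) ^ j}.indicator (fun _ => c j) x ∂ν := by
        refine lintegral_mono_ae ?_
        filter_upwards [hu01] with x hx
        rcases hx.1.eq_or_lt with h0 | h0
        · have : ∀ j : ℕ, (1 : ℝ≥0∞) ≤
              {x | u x ≤ (1 / 2 : ℝ) ^ j}.indicator (fun _ => c j) x := by
            intro j
            rw [Set.indicator_of_mem (by simp [← h0])]
            rw [hc, ENNReal.one_le_ofReal]
            exact Real.one_le_rpow one_le_two (by positivity)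
          have h2 := ENNReal.tsum_le_tsum this
          rw [ENNReal.tsum_const_eq_top_of_ne_zero one_ne_zero, top_le_iff] at h2
          rw [h2]; exact le_top
        · obtain ⟨j, hj1, hj2⟩ := exists_nat_pow_near_of_lt_one h0 hx.2
            (show (0 : ℝ) < 1 / 2 by norm_num) (by norm_num)
          refine le_trans ?_ (ENNReal.le_tsum j)
          rw [Set.indicator_of_mem (by simpa using hj2), hc,
            ENNReal.ofReal_rpow_of_pos h0]
          refine ENNReal.ofReal_le_ofReal ?_
          calc u x ^ (-β) ≤ ((1 / 2 : ℝ) ^ (j + 1)) ^ (-β) :=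
                Real.rpow_le_rpow_of_nonpos (by positivity) hj1.le (by linarith)
            _ = (2 : ℝ) ^ (((j : ℝ) + 1) * β) := by
                rw [one_div, inv_pow, Real.inv_rpow (by positivity),
                  Real.rpow_neg (by positivity), inv_inv, ← Real.rpow_natCast,
                  ← Real.rpow_mul two_pos.le]
                push_cast; rfl
    _ = ∑' j, c j * ν {x | u x ≤ (1 / 2 : ℝ) ^ j} := by
        rw [lintegral_tsum fun j => (measurable_const.indicator (hset j)).aemeasurable]
        congr 1 with j
        rw [lintegral_indicator_const (hset j)]
    _ ≤ ∑' j : ℕ, ENNReal.ofReal (2 ^ β * A) * r ^ j := by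
        refine ENNReal.tsum_le_tsum fun j => ?_
        refine (mul_le_mul_right (hνu _ (by positivity)
          (pow_le_one₀ (by norm_num) (by norm_num))) _).trans (le_of_eq ?_)
        rw [hc, hr, ← ENNReal.ofReal_pow (by positivity), ← ENNReal.ofReal_mul (by positivity),
          ← ENNReal.ofReal_mul (by positivity)]
        congr 1
        have e1 : ((1 / 2 : ℝ) ^ j) ^ d = 2 ^ (-((j : ℝ) * d)) := by
          rw [one_div, inv_pow, inv_pow, ← pow_mul, Real.rpow_neg two_pos.le, ← Real.rpow_natCast]
          push_cast; rfl
        have e2 : ((2 : ℝ) ^ (β - d)) ^ j = 2 ^ ((β - d) * j) := by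
          rw [← Real.rpow_natCast, ← Real.rpow_mul two_pos.le]
        rw [e1, e2, mul_left_comm, ← Real.rpow_add two_pos, mul_right_comm, ← Real.rpow_add two_pos,
          mul_comm A]
        congr 2
        ring
    _ = _ := by rw [ENNReal.tsum_mul_left, ENNReal.tsum_geometric]

lemma ofReal_le_ofReal_exp_abs_log (x : ℝ) :
    ENNReal.ofReal x ≤ ENNReal.ofReal (Real.exp |Real.log x|) := by
  rcases le_or_gt x 0 with h | h
  · rw [ENNReal.ofReal_of_nonpos h]; exact bot_le
  · refine ENNReal.ofReal_le_ofReal ?_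
    nth_rw 1 [← Real.exp_log h]
    exact Real.exp_le_exp.2 (le_abs_self _)

lemma prod_ofReal_exp_abs_le {f : ℕ → ℝ} (hf : Summable f) (N : ℕ) :
    ∏ i ∈ Finset.range N, ENNReal.ofReal (Real.exp |f i|) ≤
      ENNReal.ofReal (Real.exp (∑' i, |f i|)) := by
  rw [← ENNReal.ofReal_prod_of_nonneg fun i _ => (Real.exp_pos _).le, ← Real.exp_sum]
  exact ENNReal.ofReal_le_ofReal (Real.exp_le_exp.2
    (hf.abs.sum_le_tsum _ fun i _ => abs_nonneg _))

/-- If two points are at distance `u`, then about `log_b (1 / u)` factors of the product are bounded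
by `ρ 0 ≤ b ^ β` only, and the remaining ones by the terms of a convergent product. -/
lemma exists_prod_mixing_le {ρ : ℝ → ℝ} {b β : ℝ} (hb : 1 < b) (hβ0 : 0 < β)
    (hρ : AntitoneOn ρ (Set.Ici 0)) (hρ0 : ρ 0 ≤ b ^ β)
    (hsum : Summable fun i : ℕ => Real.log (ρ (b ^ i))) :
    ∃ C : ℝ≥0∞, C ≠ ∞ ∧ ∀ u : ℝ, 0 ≤ u → ∀ N : ℕ,
      ∏ i ∈ Finset.range N, ENNReal.ofReal (ρ (b ^ i * u)) ≤
        C * (1 + ENNReal.ofReal u ^ (-β)) := by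
  have hb0 : 0 < b := by linarith
  have hbβ : 1 ≤ b ^ β := Real.one_le_rpow hb.le hβ0.le
  set R := Real.exp (∑' i, |Real.log (ρ (b ^ i))|) with hR
  have hR1 : 1 ≤ R := Real.one_le_exp (tsum_nonneg fun i => abs_nonneg _)
  -- the bound for products that start at distance at least `1`
  have hfar : ∀ v : ℝ, 1 ≤ v → ∀ N : ℕ,
      ∏ i ∈ Finset.range N, ENNReal.ofReal (ρ (b ^ i * v)) ≤ ENNReal.ofReal R := by
    intro v hv N
    refine le_trans (Finset.prod_le_prod' fun i _ => ?_) (prod_ofReal_exp_abs_le hsum N)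
    refine le_trans (ENNReal.ofReal_le_ofReal ?_) (ofReal_le_ofReal_exp_abs_log _)
    have h1 : 0 < b ^ i := by positivity
    exact hρ h1.le (mul_nonneg h1.le (by linarith)) (le_mul_of_one_le_right h1.le hv)
  have hC1 : (1 : ℝ≥0∞) ≤ ENNReal.ofReal (b ^ β * R) := by
    rw [ENNReal.one_le_ofReal]; nlinarith
  refine ⟨ENNReal.ofReal (b ^ β * R), ENNReal.ofReal_ne_top, fun u hu N => ?_⟩
  rcases hu.eq_or_lt with h0 | h0
  · rw [← h0, ENNReal.ofReal_zero, ENNReal.zero_rpow_of_neg (by linarith), add_top,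
      ENNReal.mul_top (by intro h; simp [h] at hC1)]
    exact le_top
  rcases le_or_gt 1 u with h1 | h1
  · refine (hfar u h1 N).trans ?_
    calc ENNReal.ofReal R ≤ ENNReal.ofReal (b ^ β * R) * 1 := by
          rw [mul_one]
          exact ENNReal.ofReal_le_ofReal (by nlinarith)
      _ ≤ _ := by gcongr; exact le_self_add
  obtain ⟨J, hJ1, hJ2⟩ := exists_nat_pow_near ((one_le_inv₀ h0).2 h1.le) hb
  have hJ3 : 1 ≤ b ^ (J + 1) * u := by
    rw [inv_lt_iff_one_lt_mul₀ h0] at hJ2; linarith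
  have hnear : ∀ i, ENNReal.ofReal (ρ (b ^ i * u)) ≤ ENNReal.ofReal (b ^ β) := fun i =>
    ENNReal.ofReal_le_ofReal (le_trans (hρ (Set.mem_Ici.2 le_rfl)
      (Set.mem_Ici.2 (by positivity)) (by positivity)) hρ0)
  have hprod : ∀ M, ∏ i ∈ Finset.range M, ENNReal.ofReal (ρ (b ^ i * u)) ≤
      ENNReal.ofReal (b ^ β) ^ (J + 1) * ENNReal.ofReal R := by
    intro M
    rcases le_or_gt M (J + 1) with h | h
    · calc ∏ i ∈ Finset.range M, ENNReal.ofReal (ρ (b ^ i * u))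
          ≤ ∏ _i ∈ Finset.range M, ENNReal.ofReal (b ^ β) := Finset.prod_le_prod' fun i _ => hnear i
        _ = ENNReal.ofReal (b ^ β) ^ M := by simp
        _ ≤ ENNReal.ofReal (b ^ β) ^ (J + 1) * 1 := by
            rw [mul_one]
            exact pow_le_pow_right₀ (ENNReal.one_le_ofReal.2 hbβ) h
        _ ≤ _ := by gcongr; exact ENNReal.one_le_ofReal.2 hR1
    · obtain ⟨M', rfl⟩ := Nat.exists_eq_add_of_le h.le
      rw [Finset.prod_range_add]
      refine mul_le_mul' ?_ ?_
      · calc _ ≤ ∏ _i ∈ Finset.range (J + 1), ENNReal.ofReal (b ^ β) :=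
              Finset.prod_le_prod' fun i _ => hnear i
          _ = _ := by simp
      · refine le_trans (le_of_eq (Finset.prod_congr rfl fun i _ => ?_)) (hfar _ hJ3 M')
        rw [pow_add]; congr 2; ring
  calc _ ≤ ENNReal.ofReal (b ^ β) ^ (J + 1) * ENNReal.ofReal R := hprod N
    _ ≤ ENNReal.ofReal (b ^ β * R) * ENNReal.ofReal u ^ (-β) := by
        rw [← ENNReal.ofReal_pow (by positivity), ← ENNReal.ofReal_mul (by positivity),
          ENNReal.ofReal_rpow_of_pos h0, ← ENNReal.ofReal_mul (by positivity)]
        refine ENNReal.ofReal_le_ofReal ?_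
        have h5 : (b ^ β) ^ J ≤ u ^ (-β) := by
          calc (b ^ β) ^ J = (b ^ J) ^ β := by
                rw [← Real.rpow_natCast, ← Real.rpow_natCast, ← Real.rpow_mul hb0.le,
                  ← Real.rpow_mul hb0.le, mul_comm]
            _ ≤ (u⁻¹) ^ β := Real.rpow_le_rpow (by positivity) hJ1 hβ0.le
            _ = u ^ (-β) := by rw [Real.inv_rpow h0.le, Real.rpow_neg h0.le]
        rw [pow_succ]
        calc (b ^ β) ^ J * b ^ β * R ≤ u ^ (-β) * b ^ β * R := by gcongr
          _ = b ^ β * R * u ^ (-β) := by ring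
    _ ≤ _ := by gcongr; exact le_add_self

lemma minDist_nonneg {d k : ℕ} (θ : Fin k → Sph d) : 0 ≤ minDist θ :=
  Real.iInf_nonneg fun _ => angDist_nonneg _ _

lemma exists_minDist_eq {d k : ℕ} (hk : 2 ≤ k) (θ : Fin k → Sph d) :
    ∃ mh : {mh : Fin k × Fin k // mh.1 ≠ mh.2}, minDist θ = angDist (θ mh.1.1) (θ mh.1.2) := by
  have : Nonempty {mh : Fin k × Fin k // mh.1 ≠ mh.2} :=
    ⟨⟨(⟨0, by omega⟩, ⟨1, by omega⟩), by simp⟩⟩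
  obtain ⟨mh, h⟩ := exists_eq_ciInf_of_finite
    (f := fun mh : {mh : Fin k × Fin k // mh.1 ≠ mh.2} => angDist (θ mh.1.1) (θ mh.1.2))
  exact ⟨mh, h.symm⟩

lemma ENNReal.rpow_neg_antitone {x y : ℝ≥0∞} (h : x ≤ y) {β : ℝ} (hβ : 0 ≤ β) :
    y ^ (-β) ≤ x ^ (-β) := by
  rw [ENNReal.rpow_neg, ENNReal.rpow_neg]
  gcongr

/-- A probability measure on the sphere that is spread, up to the constant `A`, at least as evenly
as the uniform distribution on a set of diameter `δ`. -/
structure IsSpread {d : ℕ} (ν : Measure (Sph d)) (δ A : ℝ) : Prop where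
  dist_le : ∀ᵐ x ∂ν, ∀ᵐ y ∂ν, angDist x y ≤ δ
  cap_le : ∀ᵐ x ∂ν, ∀ t, 0 < t → t ≤ 1 → ν {y | angDist x y ≤ t * δ} ≤ ENNReal.ofReal (A * t ^ d)

/-- The moments of order `p` of the mass built from the fields with index at least `n` are bounded,
uniformly in all sets of a diameter `δ` of order at least `b ^ (-n)`. -/
lemma exists_lintegral_mass_rpow_le {Ω : Type*} [MeasurableSpace Ω] {P : Measure Ω}
    [IsProbabilityMeasure P] {d k : ℕ} {L : ℕ → Sph d → Ω → ℝ≥0∞} (hL : IsCascade P L)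
    {a : Fin k → ℝ} {p b : ℝ} (hb : 1 < b) (hk : 2 ≤ k) (ha : ∀ j, 1 ≤ a j)
    (hap : ∑ j, a j = p) {ρ : ℝ → ℝ} (hρ : AntitoneOn ρ (Set.Ici 0))
    (hmix : ∀ i (θ : Fin k → Sph d), ∫⁻ ω, ∏ j, L i (θ j) ω ^ a j ∂P ≤
      ENNReal.ofReal (ρ (b ^ i * minDist θ)))
    (hsum : Summable fun i : ℕ => Real.log (ρ (b ^ i))) {β : ℝ} (hβ0 : 0 < β) (hβ : β < d)
    (hρ0 : ρ 0 ≤ b ^ β) {A : ℝ} (hA : 0 ≤ A) :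
    ∃ C : ℝ≥0∞, C ≠ ∞ ∧ ∀ (ν : Measure (Sph d)) (δ : ℝ), IsProbabilityMeasure ν → 0 < δ →
      IsSpread ν δ A → ∀ n N : ℕ, 1 ≤ b ^ (n + 1) * δ →
      ∫⁻ ω, mass L ν (Finset.Ico n N) ω ^ p ∂P ≤ C := by
  obtain ⟨C, hC, hCb⟩ := exists_prod_mixing_le hb hβ0 hρ hρ0 hsum
  obtain ⟨K, hK, hKb⟩ := exists_lintegral_rpow_neg_le (S := Sph d) hβ0 hβ hA
  set I := {mh : Fin k × Fin k // mh.1 ≠ mh.2}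
  have hb0 : 0 < b := by linarith
  refine ⟨C * (1 + ∑ _mh : I, ENNReal.ofReal b ^ β * K), ENNReal.mul_ne_top hC
    (ENNReal.add_ne_top.2 ⟨ENNReal.one_ne_top, ENNReal.sum_ne_top.2 fun _ _ =>
      ENNReal.mul_ne_top (ENNReal.rpow_ne_top_of_nonneg hβ0.le ENNReal.ofReal_ne_top) hK⟩), ?_⟩
  intro ν δ hν hδ hs n N hn
  have hmeas : Measurable fun x : Sph d × Sph d =>
      ENNReal.ofReal (b ^ n * angDist x.1 x.2) ^ (-β) :=
    ((measurable_angDist.const_mul _).ennreal_ofReal).pow_const _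
  have hbn : ENNReal.ofReal (b ^ n * δ) ^ (-β) ≤ ENNReal.ofReal b ^ β := by
    have h1 : b⁻¹ ≤ b ^ n * δ := by
      rw [inv_le_iff_one_le_mul₀ hb0]; rw [pow_succ] at hn; linarith
    refine (ENNReal.rpow_neg_antitone (ENNReal.ofReal_le_ofReal h1) hβ0.le).trans (le_of_eq ?_)
    rw [ENNReal.ofReal_inv_of_pos hb0, ENNReal.rpow_neg, ENNReal.inv_rpow, inv_inv]
  have hpair : ∀ mh : I, ∫⁻ θ : Fin k → Sph d,
      ENNReal.ofReal (b ^ n * angDist (θ mh.1.1) (θ mh.1.2)) ^ (-β) ∂Measure.pi (fun _ => ν) ≤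
        ENNReal.ofReal b ^ β * K := by
    intro mh
    rw [lintegral_pi_pair ν mh.2
      (F := fun x y => ENNReal.ofReal (b ^ n * angDist x y) ^ (-β)) hmeas]
    calc ∫⁻ x, ∫⁻ y, ENNReal.ofReal (b ^ n * angDist x y) ^ (-β) ∂ν ∂ν
        ≤ ∫⁻ _x, ENNReal.ofReal b ^ β * K ∂ν := by
          refine lintegral_mono_ae ?_
          filter_upwards [hs.dist_le, hs.cap_le] with x hx1 hx2
          have hum : Measurable fun y => angDist x y / δ := (measurable_angDist_left x).div_const _
          have h1 := hKb ν (fun y => angDist x y / δ) hum (by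
            filter_upwards [hx1] with y hy
            exact ⟨div_nonneg (angDist_nonneg _ _) hδ.le, (div_le_one hδ).2 hy⟩) (by
            intro t ht0 ht1
            simp_rw [div_le_iff₀ hδ]
            exact hx2 t ht0 ht1)
          calc ∫⁻ y, ENNReal.ofReal (b ^ n * angDist x y) ^ (-β) ∂ν
              = ∫⁻ y, ENNReal.ofReal (b ^ n * δ) ^ (-β) *
                  ENNReal.ofReal (angDist x y / δ) ^ (-β) ∂ν := by
                refine lintegral_congr fun y => ?_
                rw [← ENNReal.mul_rpow_of_ne_top ENNReal.ofReal_ne_top ENNReal.ofReal_ne_top,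
                  ← ENNReal.ofReal_mul (by positivity)]
                congr 2
                field_simp
            _ = ENNReal.ofReal (b ^ n * δ) ^ (-β) *
                  ∫⁻ y, ENNReal.ofReal (angDist x y / δ) ^ (-β) ∂ν :=
                lintegral_const_mul _ (hum.ennreal_ofReal.pow_const _)
            _ ≤ _ := mul_le_mul' hbn h1
      _ = _ := by simp
  calc ∫⁻ ω, mass L ν (Finset.Ico n N) ω ^ p ∂P
      ≤ ∫⁻ θ : Fin k → Sph d, ∏ i ∈ Finset.Ico n N, ∫⁻ ω, ∏ j, L i (θ j) ω ^ a j ∂P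
          ∂Measure.pi fun _ => ν := hL.lintegral_mass_rpow_le_lintegral_pi ν _ ha hap
    _ ≤ ∫⁻ θ : Fin k → Sph d, C * (1 + ∑ mh : I,
          ENNReal.ofReal (b ^ n * angDist (θ mh.1.1) (θ mh.1.2)) ^ (-β))
            ∂Measure.pi fun _ => ν := by
        refine lintegral_mono fun θ => ?_
        obtain ⟨mh, hmh⟩ := exists_minDist_eq hk θ
        have h1 : ∏ i ∈ Finset.Ico n N, ∫⁻ ω, ∏ j, L i (θ j) ω ^ a j ∂P ≤
            ∏ i ∈ Finset.range (N - n), ENNReal.ofReal (ρ (b ^ i * (b ^ n * minDist θ))) := by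
          rw [Finset.prod_Ico_eq_prod_range]
          refine Finset.prod_le_prod' fun i _ => (hmix _ θ).trans (le_of_eq ?_)
          rw [pow_add]; congr 2; ring
        refine h1.trans ((hCb _ (mul_nonneg (by positivity) (minDist_nonneg θ)) _).trans ?_)
        gcongr
        -- the least distance is one of the distances, so its power is one of the summands
        rw [hmh]
        exact Finset.single_le_sum (f := fun mh : I =>
          ENNReal.ofReal (b ^ n * angDist (θ mh.1.1) (θ mh.1.2)) ^ (-β))
          (fun _ _ => bot_le) (Finset.mem_univ mh)
    _ ≤ _ := by
        have hm1 : ∀ mh : I, Measurable fun θ : Fin k → Sph d =>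
            ENNReal.ofReal (b ^ n * angDist (θ mh.1.1) (θ mh.1.2)) ^ (-β) := fun mh =>
          Measurable.comp (g := fun x : Sph d × Sph d =>
              ENNReal.ofReal (b ^ n * angDist x.1 x.2) ^ (-β))
            (f := fun θ : Fin k → Sph d => (θ mh.1.1, θ mh.1.2)) hmeas
            ((measurable_pi_apply _).prodMk (measurable_pi_apply _))
        have hms : Measurable fun θ : Fin k → Sph d => ∑ mh : I,
            ENNReal.ofReal (b ^ n * angDist (θ mh.1.1) (θ mh.1.2)) ^ (-β) :=
          Finset.measurable_fun_sum _ fun mh _ => hm1 mh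
        have hms' : Measurable fun θ : Fin k → Sph d => 1 + ∑ mh : I,
            ENNReal.ofReal (b ^ n * angDist (θ mh.1.1) (θ mh.1.2)) ^ (-β) :=
          measurable_const.add hms
        rw [lintegral_const_mul _ hms', lintegral_add_left measurable_const,
          lintegral_finsetSum _ fun mh _ => hm1 mh]
        gcongr with mh
        · simp
        · exact hpair mh

/-! ### Moments of the limit -/

lemma mass_empty_eq_one {Ω S : Type*} [MeasurableSpace S] {L : ℕ → S → Ω → ℝ≥0∞} (ν : Measure S)
    [IsProbabilityMeasure ν] (ω : Ω) : mass L ν ∅ ω = 1 := by simp [mass]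

section
variable {Ω S : Type*} [MeasurableSpace Ω] [MeasurableSpace S] {P : Measure Ω}
  [IsProbabilityMeasure P] {L : ℕ → S → Ω → ℝ≥0∞}

lemma IsCascade.ae_mass_ne_top (hL : IsCascade P L) (ν : Measure S) [IsFiniteMeasure ν]
    (s : Finset ℕ) : ∀ᵐ ω ∂P, mass L ν s ω ≠ ∞ := by
  have h := ae_lt_top (hL.measurable_mass ν s)
    (by rw [hL.lintegral_mass]; exact measure_ne_top _ _)
  filter_upwards [h] with ω hω using hω.ne

/-- Conditional Jensen inequality for the concave power `q ≤ 1`: with `Z` the mass for `t` and `X`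
the mass for `s ∪ t`, Hölder's inequality for `X ^ q = (X * Z ^ (q - 1)) ^ q * (Z ^ q) ^ (1 - q)`
and the martingale property. -/
lemma IsCascade.lintegral_mass_union_rpow_le (hL : IsCascade P L) (ν : Measure S)
    [IsFiniteMeasure ν] {s t : Finset ℕ} (hst : Disjoint s t) {q : ℝ} (hq0 : 0 < q)
    (hq : q ≤ 1) :
    ∫⁻ ω, mass L ν (s ∪ t) ω ^ q ∂P ≤ ∫⁻ ω, mass L ν t ω ^ q ∂P := by
  set X := mass L ν (s ∪ t)
  set Z := mass L ν t
  have hX : Measurable X := hL.measurable_mass ν _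
  have hZ : Measurable Z := hL.measurable_mass ν _
  -- the martingale does not leave zero
  have h0 : ∀ᵐ ω ∂P, Z ω = 0 → X ω = 0 := by
    have hφ : Measurable (fun z : ℝ≥0∞ => if z = 0 then (1 : ℝ≥0∞) else 0) :=
      Measurable.ite (measurableSet_singleton 0) measurable_const measurable_const
    have h1 := hL.lintegral_comp_mass ν hst hφ
    have h2 : ∫⁻ ω, (if Z ω = 0 then (1 : ℝ≥0∞) else 0) * Z ω ∂P = 0 := by
      refine (lintegral_congr fun ω => ?_).trans lintegral_zero
      by_cases h : Z ω = 0 <;> simp [h]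
    have h3 := (lintegral_eq_zero_iff (f := fun ω => (if Z ω = 0 then (1 : ℝ≥0∞) else 0) * X ω)
      ((hφ.comp hZ).mul hX)).1 (h1.trans h2)
    filter_upwards [h3] with ω hω hz
    have hω' : (if Z ω = 0 then (1 : ℝ≥0∞) else 0) * X ω = 0 := hω
    simpa [hz] using hω'
  have hZt := hL.ae_mass_ne_top ν t
  calc ∫⁻ ω, X ω ^ q ∂P = ∫⁻ ω, (X ω * (Z ω)⁻¹) ^ q * Z ω ^ q ∂P := by
        refine lintegral_congr_ae ?_
        filter_upwards [h0, hZt] with ω h1 h2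
        change Z ω ≠ ∞ at h2
        by_cases hz : Z ω = 0
        · simp [h1 hz, hz, hq0]
        · rw [← ENNReal.mul_rpow_of_nonneg _ _ hq0.le, mul_assoc, ENNReal.inv_mul_cancel hz h2,
            mul_one]
    _ ≤ (∫⁻ ω, X ω * (Z ω)⁻¹ * Z ω ^ q ∂P) ^ q * (∫⁻ ω, Z ω ^ q ∂P) ^ (1 - q) :=
        lintegral_rpow_mul_le_of_le_one (hX.mul hZ.inv).aemeasurable (hZ.pow_const q).aemeasurable
          hq0.le hq
    _ = (∫⁻ ω, Z ω ^ (q - 1) * X ω ∂P) ^ q * (∫⁻ ω, Z ω ^ q ∂P) ^ (1 - q) := by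
        congr 2
        refine lintegral_congr_ae ?_
        filter_upwards [h0, hZt] with ω h1 h2
        change Z ω ≠ ∞ at h2
        by_cases hz : Z ω = 0
        · simp [h1 hz]
        · rw [ENNReal.rpow_sub _ _ hz h2, ENNReal.rpow_one, div_eq_mul_inv]; ring
    _ = (∫⁻ ω, Z ω ^ q ∂P) ^ q * (∫⁻ ω, Z ω ^ q ∂P) ^ (1 - q) := by
        congr 2
        rw [hL.lintegral_comp_mass ν hst (φ := fun z => z ^ (q - 1)) (by fun_prop)]
        refine lintegral_congr_ae ?_
        filter_upwards [hZt] with ω h2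
        change Z ω ≠ ∞ at h2
        by_cases hz : Z ω = 0
        · change Z ω ^ (q - 1) * Z ω = _
          simp [hz, hq0]
        · change Z ω ^ (q - 1) * Z ω = _
          nth_rw 2 [← ENNReal.rpow_one (Z ω)]
          rw [← ENNReal.rpow_add _ _ hz h2]; congr 1; ring
    _ = _ := ENNReal.rpow_mul_rpow_of_add_eq_one hq0.le (by linarith) (by ring)

lemma range_eq_Ico_union {n N : ℕ} (h : n ≤ N) :
    Finset.range N = Finset.range n ∪ Finset.Ico n N := by
  ext i; simp only [Finset.mem_range, Finset.mem_union, Finset.mem_Ico]; omega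

lemma disjoint_range_Ico (n N : ℕ) : Disjoint (Finset.range n) (Finset.Ico n N) := by
  rw [Finset.disjoint_left]; intro i; simp only [Finset.mem_range, Finset.mem_Ico]; omega

lemma lintegral_rpow_le_rpow_div {X : Ω → ℝ≥0∞} (hX : AEMeasurable X P) {p q : ℝ} (hp : 0 < p)
    (hq0 : 0 ≤ q) (hqp : q ≤ p) {C : ℝ≥0∞} (hC : ∫⁻ ω, X ω ^ p ∂P ≤ C) :
    ∫⁻ ω, X ω ^ q ∂P ≤ C ^ (q / p) := by
  calc ∫⁻ ω, X ω ^ q ∂P = ∫⁻ ω, (X ω ^ p) ^ (q / p) ∂P := by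
        refine lintegral_congr fun ω => ?_
        rw [← ENNReal.rpow_mul]; congr 1; field_simp
    _ ≤ (∫⁻ ω, X ω ^ p ∂P) ^ (q / p) :=
        lintegral_rpow_le (hX.pow_const p) (by positivity) ((div_le_one hp).2 hqp)
    _ ≤ _ := ENNReal.rpow_le_rpow hC (by positivity)

variable {ν : Measure S} [IsProbabilityMeasure ν] {n : ℕ} {p q : ℝ} {C κ : ℝ≥0∞}

lemma IsCascade.lintegral_mass_range_rpow_le (hL : IsCascade P L) (hq : 1 ≤ q) (hqp : q ≤ p)
    (hκ : ∀ θ, ∫⁻ ω, (∏ i ∈ Finset.range n, L i θ ω) ^ q ∂P = κ)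
    (hC : ∀ N, ∫⁻ ω, mass L ν (Finset.Ico n N) ω ^ p ∂P ≤ C) {N : ℕ} (hN : n ≤ N) :
    ∫⁻ ω, mass L ν (Finset.range N) ω ^ q ∂P ≤ κ * C ^ (q / p) := by
  rw [range_eq_Ico_union hN]
  refine (hL.lintegral_mass_rpow_le ν (disjoint_range_Ico n N) hq hκ).trans ?_
  gcongr
  exact lintegral_rpow_le_rpow_div (hL.measurable_mass ν _).aemeasurable (by linarith)
    (by linarith) hqp (hC N)

variable {Y : Ω → ℝ≥0∞}

lemma IsCascade.tendsto_lintegral_mass_sub (hL : IsCascade P L) (hp : 1 < p)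
    (hκ : ∀ θ, ∫⁻ ω, (∏ i ∈ Finset.range n, L i θ ω) ^ p ∂P = κ) (hκt : κ ≠ ∞) (hCt : C ≠ ∞)
    (hC : ∀ N, ∫⁻ ω, mass L ν (Finset.Ico n N) ω ^ p ∂P ≤ C)
    (hlim : ∀ᵐ ω ∂P, Tendsto (fun N => mass L ν (Finset.range N) ω) atTop (𝓝 (Y ω))) :
    Tendsto (fun N => ∫⁻ ω, (mass L ν (Finset.range (N + n)) ω - Y ω) ∂P) atTop (𝓝 0) := by
  refine tendsto_lintegral_sub_of_bounded (fun N => hL.measurable_mass ν _) ?_ hp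
    (ENNReal.mul_ne_top hκt hCt) fun N => ?_
  · filter_upwards [hlim] with ω hω using hω.comp (tendsto_add_atTop_nat n)
  · have := hL.lintegral_mass_range_rpow_le hp.le le_rfl hκ hC (Nat.le_add_left n N)
    rwa [div_self (by linarith), ENNReal.rpow_one] at this

/-- Upper bound for the moments of order `q ≥ 1` of the limit. -/
lemma IsCascade.lintegral_limit_rpow_le (hL : IsCascade P L) (hq : 1 ≤ q) (hqp : q ≤ p)
    (hκ : ∀ θ, ∫⁻ ω, (∏ i ∈ Finset.range n, L i θ ω) ^ q ∂P = κ)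
    (hC : ∀ N, ∫⁻ ω, mass L ν (Finset.Ico n N) ω ^ p ∂P ≤ C)
    (hlim : ∀ᵐ ω ∂P, Tendsto (fun N => mass L ν (Finset.range N) ω) atTop (𝓝 (Y ω))) :
    ∫⁻ ω, Y ω ^ q ∂P ≤ κ * C ^ (q / p) := by
  refine lintegral_rpow_le_of_tendsto (fun N => hL.measurable_mass ν _) hlim ?_
  filter_upwards [eventually_ge_atTop n] with N hN
  exact hL.lintegral_mass_range_rpow_le hq hqp hκ hC hN

/-- Upper bound for the moments of order `q < 1` of the limit, which do not exceed those of the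
mass of the first `n` fields. -/
lemma IsCascade.lintegral_limit_rpow_le_of_pair (hL : IsCascade P L) (hq0 : 0 < q) (hq : q < 1)
    {B : ℝ≥0∞} (hB : ∀ᵐ θ₁ ∂ν, ∀ᵐ θ₂ ∂ν, ∫⁻ ω, (∏ i ∈ Finset.range n, L i θ₁ ω) ^ (q - 1) *
      ∏ i ∈ Finset.range n, L i θ₂ ω ∂P ≤ B)
    (hlim : ∀ᵐ ω ∂P, Tendsto (fun N => mass L ν (Finset.range N) ω) atTop (𝓝 (Y ω))) :
    ∫⁻ ω, Y ω ^ q ∂P ≤ B := by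
  refine lintegral_rpow_le_of_tendsto (fun N => hL.measurable_mass ν _) hlim ?_
  filter_upwards [eventually_ge_atTop n] with N hN
  rw [range_eq_Ico_union hN, Finset.union_comm]
  exact (hL.lintegral_mass_union_rpow_le ν (disjoint_range_Ico n N).symm hq0 hq.le).trans
    (hL.lintegral_mass_rpow_le_of_pair ν _ hq0 hq hB)

variable {κp : ℝ≥0∞}

/-- Lower bound for the moments of order `q < 1` of the limit. -/
lemma IsCascade.le_lintegral_limit_rpow (hL : IsCascade P L) (hq0 : 0 < q) (hq : q < 1)
    (hp : 1 < p) (hκ : ∀ θ, ∫⁻ ω, (∏ i ∈ Finset.range n, L i θ ω) ^ q ∂P = κ)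
    (hκp : ∀ θ, ∫⁻ ω, (∏ i ∈ Finset.range n, L i θ ω) ^ p ∂P = κp) (hκpt : κp ≠ ∞) (hCt : C ≠ ∞)
    (hC : ∀ N, ∫⁻ ω, mass L ν (Finset.Ico n N) ω ^ p ∂P ≤ C) (hY : AEMeasurable Y P)
    (hlim : ∀ᵐ ω ∂P, Tendsto (fun N => mass L ν (Finset.range N) ω) atTop (𝓝 (Y ω))) :
    κ * (C ^ ((1 - q) / (p - 1)))⁻¹ ≤ ∫⁻ ω, Y ω ^ q ∂P := by
  refine le_lintegral_rpow_of_tendsto (fun N => hL.measurable_mass ν _) hY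
    (hL.tendsto_lintegral_mass_sub hp hκp hκpt hCt hC hlim) hq0 hq.le
    (Eventually.of_forall fun N => ?_)
  rw [range_eq_Ico_union (Nat.le_add_left n N)]
  refine le_trans ?_ (hL.le_lintegral_mass_rpow ν (disjoint_range_Ico n (N + n)) hq0 hq.le hκ)
  gcongr
  exact le_lintegral_rpow_of_lintegral_eq_one (hL.measurable_mass ν _).aemeasurable
    (by rw [hL.lintegral_mass, measure_univ]) hq0.le hq hp (hC _)

/-- Lower bound for the moments of order `q ≥ 1` of the limit, which are at least those of the
mass of the first `n` fields. -/
lemma IsCascade.le_lintegral_limit_rpow_of_pair (hL : IsCascade P L) (hq : 1 ≤ q)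
    (hp : 1 < p) (hκ : ∀ θ, ∫⁻ ω, (∏ i ∈ Finset.range n, L i θ ω) ^ q ∂P = κ) (hκ0 : κ ≠ 0)
    (hκt : κ ≠ ∞)
    (hκp : ∀ θ, ∫⁻ ω, (∏ i ∈ Finset.range n, L i θ ω) ^ p ∂P = κp) (hκpt : κp ≠ ∞) (hCt : C ≠ ∞)
    (hC : ∀ N, ∫⁻ ω, mass L ν (Finset.Ico n N) ω ^ p ∂P ≤ C) (hY : AEMeasurable Y P)
    (hlim : ∀ᵐ ω ∂P, Tendsto (fun N => mass L ν (Finset.range N) ω) atTop (𝓝 (Y ω)))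
    {k : ℝ} (hk : 1 < k) {c : ℝ≥0∞} (θ₁ : S) (hc : ∀ᵐ θ₂ ∂ν, c * κ ≤
      ∫⁻ ω, (∏ i ∈ Finset.range n, L i θ₂ ω) ^ (q / k) *
        (∏ i ∈ Finset.range n, L i θ₁ ω) ^ (q - q / k) ∂P) :
    (c ^ ((q - q / k) / (q - 1 / k))⁻¹) ^ (1 / k / q)⁻¹ * κ ≤ ∫⁻ ω, Y ω ^ q ∂P := by
  refine (hL.le_lintegral_mass_rpow_of_pair ν _ hq hk hκ hκ0 hκt θ₁ hc).trans ?_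
  refine lintegral_rpow_le_lintegral_rpow_limit
    (X := fun N => mass L ν (Finset.range (N + n))) (fun N => hL.measurable_mass ν _)
    (hL.measurable_mass ν _) hY (hL.tendsto_lintegral_mass_sub hp hκp hκpt hCt hC hlim) hq
    (fun φ hφ => Eventually.of_forall fun N => ?_) ?_
  · rw [range_eq_Ico_union (Nat.le_add_left n N), Finset.union_comm]
    exact hL.lintegral_comp_mass ν (disjoint_range_Ico n (N + n)).symm hφ
  · have h := hL.lintegral_mass_rpow_le ν (Finset.disjoint_empty_right (Finset.range n)) hq hκ
    simp only [Finset.union_empty, mass_empty_eq_one, ENNReal.one_rpow, lintegral_one,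
      measure_univ, mul_one] at h
    exact ne_top_of_le_ne_top hκt h

end

/-! ### Moments of the random fields -/

section
variable {Ω : Type*} [MeasurableSpace Ω] {P : Measure Ω} {d k : ℕ} {Λ : ℕ → Sph d → Ω → ℝ}
  {b p : ℝ} {a : Fin k → ℝ}

/-- The fields as functions with values in `[0, ∞]`; negative values, which occur on a null set
only, become `0`. -/
abbrev ennField (Λ : ℕ → Sph d → Ω → ℝ) (i : ℕ) (θ : Sph d) (ω : Ω) : ℝ≥0∞ :=
  ENNReal.ofReal (Λ i θ ω)

lemma ConvergenceConditions.isCascade [IsProbabilityMeasure P]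
    (h : ConvergenceConditions P Λ b p a) : IsCascade P (ennField Λ) where
  measurable i := (h.field i).measurable.ennreal_ofReal
  indep := h.indep.comp (fun _ (x : Sph d → ℝ) θ => ENNReal.ofReal (x θ)) fun _ =>
    measurable_pi_lambda _ fun θ => (measurable_pi_apply θ).ennreal_ofReal
  mean_eq_one i θ := by
    rw [← ofReal_integral_eq_lintegral_ofReal
      (((h.field i).memLp_two θ).integrable one_le_two), (h.field i).mean_eq_one θ,
      ENNReal.ofReal_one]
    filter_upwards [(h.field i).nonneg] with ω hω using hω θ
  ne_top _ _ _ := ENNReal.ofReal_ne_top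

lemma ConvergenceConditions.cumMeasure_eq_mass (h : ConvergenceConditions P Λ b p a) :
    ∀ᵐ ω ∂P, ∀ n B, MeasurableSet B → cumMeasure Λ n ω B =
      mass (ennField Λ) ((surfaceMeasure d).restrict B) (Finset.range (n + 1)) ω := by
  filter_upwards [ae_all_iff.2 fun i => (h.field i).nonneg] with ω hω n B hB
  rw [cumMeasure, withDensity_apply _ hB, mass]
  refine lintegral_congr fun θ => ?_
  rw [ENNReal.ofReal_prod_of_nonneg fun i _ => hω i θ]

lemma ConvergenceConditions.tendsto_mass_of_tendsto (h : ConvergenceConditions P Λ b p a)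
    {B : Set (Sph d)} (hB : MeasurableSet B) {Y : Ω → ℝ≥0∞}
    (hY : ∀ᵐ ω ∂P, Tendsto (fun n => cumMeasure Λ n ω B) atTop (𝓝 (Y ω))) :
    ∀ᵐ ω ∂P, Tendsto (fun N => mass (ennField Λ) ((surfaceMeasure d).restrict B)
      (Finset.range N) ω) atTop (𝓝 (Y ω)) := by
  filter_upwards [h.cumMeasure_eq_mass, hY] with ω h1 h2
  rw [← tendsto_add_atTop_iff_nat 1]
  exact h2.congr fun n => h1 n B hB

lemma minDist_const (hk : 2 ≤ k) (θ : Sph d) : minDist (fun _ : Fin k => θ) = 0 := by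
  obtain ⟨mh, h⟩ := exists_minDist_eq hk (fun _ : Fin k => θ)
  rw [h, angDist_self]

lemma minDist_pair (x y : Sph d) : minDist ![x, y] = angDist x y := by
  obtain ⟨⟨⟨m, n⟩, hne⟩, h⟩ := exists_minDist_eq le_rfl ![x, y]
  rw [h]
  fin_cases m <;> fin_cases n
  · exact absurd rfl hne
  · rfl
  · exact angDist_comm y x
  · exact absurd rfl hne

lemma powMoment_ne_top_of_le [IsProbabilityMeasure P] {X : Ω → ℝ} {q : ℝ} (hX : Measurable X)
    (hq : 0 ≤ q) (hqp : q ≤ p) (hp : 0 < p) (hfin : powMoment P X p ≠ ∞) :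
    powMoment P X q ≠ ∞ := by
  refine ne_top_of_le_ne_top ?_ (lintegral_rpow_le_rpow_div hX.ennreal_ofReal.aemeasurable hp hq
    hqp (C := powMoment P X p) le_rfl)
  exact ENNReal.rpow_ne_top_of_nonneg (by positivity) hfin

lemma ConvergenceConditions.powMoment_le [IsProbabilityMeasure P]
    (h : ConvergenceConditions P Λ b p a) {ρ : ℝ → ℝ} (hρ : MixingBound P Λ b a ρ) (i : ℕ)
    (θ : Sph d) : powMoment P (Λ i θ) p ≤ ENNReal.ofReal (ρ 0) := by
  have hk := h.two_le_card
  have h1 := hρ i fun _ => θ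
  rw [minDist_const hk, mul_zero] at h1
  refine le_trans (le_of_eq ?_) h1
  refine lintegral_congr fun ω => ?_
  rw [← ENNReal.rpow_sum_of_forall_nonneg _ _ fun j => zero_le_one.trans (h.one_le_exponent j),
    h.sum_exponent]

lemma ConvergenceConditions.powMoment_ne_top [IsProbabilityMeasure P]
    (h : ConvergenceConditions P Λ b p a) {q : ℝ} (hq : q ∈ Set.Icc 0 p) (i : ℕ) (θ : Sph d) :
    powMoment P (Λ i θ) q ≠ ∞ := by
  obtain ⟨ρ, -, hρ, -⟩ := h.mixing
  have hp := h.two_le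
  refine powMoment_ne_top_of_le ((h.field i).measurable.comp measurable_prodMk_left) hq.1 hq.2
    (by linarith) ?_
  exact ne_top_of_le_ne_top ENNReal.ofReal_ne_top (h.powMoment_le hρ i θ)

lemma ConvergenceConditions.powMoment_ne_zero [IsProbabilityMeasure P]
    (h : ConvergenceConditions P Λ b p a) (q : ℝ) (i : ℕ) (θ : Sph d) :
    powMoment P (Λ i θ) q ≠ 0 := by
  have hm : Measurable (Λ i θ) := (h.field i).measurable.comp measurable_prodMk_left
  intro h0
  rw [powMoment, lintegral_eq_zero_iff (hm.ennreal_ofReal.pow_const q)] at h0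
  have h1 := h.isCascade.mean_eq_one i θ
  have h2 : ∫⁻ ω, ennField Λ i θ ω ∂P = 0 := by
    rw [lintegral_eq_zero_iff hm.ennreal_ofReal]
    filter_upwards [h0] with ω hω
    have hω' : ENNReal.ofReal (Λ i θ ω) ^ q = 0 := hω
    rcases ENNReal.rpow_eq_zero_iff.1 hω' with h | h
    · exact h.1
    · exact absurd h.1 ENNReal.ofReal_ne_top
  rw [h1] at h2
  exact one_ne_zero h2

lemma ConvergenceConditions.integral_rpow_eq (h : ConvergenceConditions P Λ b p a) {q : ℝ}
    (hq : 0 ≤ q) (i : ℕ) (θ : Sph d) :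
    ∫ ω, Λ i θ ω ^ q ∂P = (powMoment P (Λ i θ) q).toReal := by
  have hm : Measurable (Λ i θ) := (h.field i).measurable.comp measurable_prodMk_left
  have h0 : ∀ᵐ ω ∂P, 0 ≤ Λ i θ ω := (h.field i).nonneg.mono fun ω hω => hω θ
  rw [integral_eq_lintegral_of_nonneg_ae (h0.mono fun ω hω => Real.rpow_nonneg hω q)
    (hm.pow_const q).aestronglyMeasurable, powMoment]
  congr 1
  refine lintegral_congr_ae (h0.mono fun ω hω => ?_)
  exact (ENNReal.ofReal_rpow_of_nonneg hω hq).symm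

/-- The condition `r ^ (1 / d) < b` on `r = ρ 0` leaves room for a decay exponent `β` strictly less
than the dimension, so that `dist ^ (-β)` is integrable on the sphere. -/
lemma exists_le_rpow_lt (hd : 1 ≤ d) (hb : 1 < b) {r : ℝ} (hr0 : 0 ≤ r)
    (hr : r ^ (1 / (d : ℝ)) < b) : ∃ β : ℝ, 0 < β ∧ β < d ∧ r ≤ b ^ β := by
  have hd' : (0 : ℝ) < d := by exact_mod_cast hd
  have hb0 : 0 < b := by linarith
  have h1 : r < b ^ (d : ℝ) := by
    have := Real.rpow_lt_rpow (by positivity) hr hd'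
    rwa [← Real.rpow_mul hr0, one_div_mul_cancel hd'.ne', Real.rpow_one] at this
  rcases hr0.eq_or_lt with h0 | h0
  · exact ⟨d / 2, by positivity, by linarith, by rw [← h0]; positivity⟩
  · refine ⟨max (Real.logb b r) (d / 2), lt_max_of_lt_right (by positivity),
      max_lt ?_ (by linarith), ?_⟩
    · rwa [Real.logb_lt_iff_lt_rpow hb h0]
    · calc r = b ^ Real.logb b r := (Real.rpow_logb hb0 hb.ne' h0).symm
        _ ≤ _ := Real.rpow_le_rpow_of_exponent_le hb.le (le_max_left _ _)

/-- Uniform bound for the moments of order `p` at all scales. -/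
lemma ConvergenceConditions.exists_lintegral_mass_rpow_le [IsProbabilityMeasure P] (hd : 1 ≤ d)
    (h : ConvergenceConditions P Λ b p a) {A : ℝ} (hA : 0 ≤ A) :
    ∃ C : ℝ≥0∞, C ≠ ∞ ∧ ∀ (ν : Measure (Sph d)) (δ : ℝ), IsProbabilityMeasure ν → 0 < δ →
      IsSpread ν δ A → ∀ n N : ℕ, 1 ≤ b ^ (n + 1) * δ →
      ∫⁻ ω, mass (ennField Λ) ν (Finset.Ico n N) ω ^ p ∂P ≤ C := by
  obtain ⟨ρ, hanti, hρ, hρb, hsum⟩ := h.mixing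
  have hρ0 : 0 ≤ ρ 0 := by
    by_contra hneg
    have h1 := h.powMoment_le hρ 0 (northPole d)
    rw [ENNReal.ofReal_of_nonpos (by linarith), nonpos_iff_eq_zero] at h1
    exact h.powMoment_ne_zero p 0 _ h1
  obtain ⟨β, hβ0, hβ, hle⟩ := exists_le_rpow_lt hd h.one_lt_scale hρ0 hρb
  exact _root_.exists_lintegral_mass_rpow_le h.isCascade h.one_lt_scale h.two_le_card
    h.one_le_exponent h.sum_exponent hanti hρ hsum hβ0 hβ hle hA

end

/-- A product of factors close to `κ` is of the order of a power of `κ`. The factors are taken in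
reverse order, since the deviation from `κ` decreases with the distance of the index from `n`. -/
lemma prod_ofReal_le_pow_mul {f : ℕ → ℝ} {κ : ℝ} (hκ : 0 < κ)
    (hf : Summable fun j => Real.log (f j / κ)) (n : ℕ) :
    ∏ i ∈ Finset.range n, ENNReal.ofReal (f (n - i)) ≤
      ENNReal.ofReal κ ^ n * ENNReal.ofReal (Real.exp (∑' j, |Real.log (f (j + 1) / κ)|)) := by
  rw [← Finset.prod_range_reflect]
  calc ∏ j ∈ Finset.range n, ENNReal.ofReal (f (n - (n - 1 - j)))
      ≤ ∏ j ∈ Finset.range n,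
          (ENNReal.ofReal κ * ENNReal.ofReal (Real.exp |Real.log (f (j + 1) / κ)|)) := by
        refine Finset.prod_le_prod' fun j hj => ?_
        rw [Finset.mem_range] at hj
        rw [show n - (n - 1 - j) = j + 1 by omega]
        calc ENNReal.ofReal (f (j + 1)) = ENNReal.ofReal κ * ENNReal.ofReal (f (j + 1) / κ) := by
              rw [← ENNReal.ofReal_mul hκ.le]; congr 1; field_simp
          _ ≤ _ := by exact mul_le_mul_right (ofReal_le_ofReal_exp_abs_log _) _
    _ = ENNReal.ofReal κ ^ n *
          ∏ j ∈ Finset.range n, ENNReal.ofReal (Real.exp |Real.log (f (j + 1) / κ)|) := by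
        rw [Finset.prod_mul_distrib, Finset.prod_const, Finset.card_range]
    _ ≤ _ := by
        gcongr
        exact prod_ofReal_exp_abs_le ((summable_nat_add_iff 1).2 hf) n

lemma pow_mul_le_prod_ofReal {f : ℕ → ℝ} {κ : ℝ} (hκ : 0 < κ) (hf0 : ∀ j, 0 < f j)
    (hf : Summable fun j => Real.log (κ / f j)) (n : ℕ) :
    (ENNReal.ofReal (Real.exp (∑' j, |Real.log (κ / f (j + 1))|)))⁻¹ * ENNReal.ofReal κ ^ n ≤
      ∏ i ∈ Finset.range n, ENNReal.ofReal (f (n - i)) := by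
  have hsum : Summable fun j => Real.log ((f j)⁻¹ / κ⁻¹) := by
    refine hf.congr fun j => ?_
    rw [div_inv_eq_mul, div_eq_mul_inv, mul_comm]
  have h := prod_ofReal_le_pow_mul (f := fun j => (f j)⁻¹) (inv_pos.2 hκ) hsum n
  have h' := ENNReal.inv_le_inv.2 h
  rw [ENNReal.mul_inv (Or.inr ENNReal.ofReal_ne_top) (Or.inl (by simp)),
    ENNReal.ofReal_inv_of_pos hκ, ENNReal.inv_pow, inv_inv, mul_comm] at h'
  refine le_trans (le_of_eq ?_) (h'.trans (le_of_eq ?_))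
  · congr 4
    refine tsum_congr fun j => ?_
    rw [div_inv_eq_mul, div_eq_mul_inv, mul_comm]
  · simp_rw [fun i => ENNReal.ofReal_inv_of_pos (hf0 i)]
    rw [ENNReal.prod_inv_distrib fun i _ j _ _ => Or.inr
      (ENNReal.inv_ne_top.2 (ENNReal.ofReal_pos.2 (hf0 _)).ne')]
    simp_rw [inv_inv]

/-! ### Two-sided moment bounds at a given scale -/

section
variable {Ω : Type*} [MeasurableSpace Ω] {P : Measure Ω} {d k : ℕ} {Λ : ℕ → Sph d → Ω → ℝ}
  {b p : ℝ} {a : Fin k → ℝ}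

lemma StronglyIsotropic.mixedMoment_actSph {T : Sph d → Ω → ℝ} (hT : StronglyIsotropic P T)
    {g : EuclideanSpace ℝ (Fin (d + 1)) ≃ₗᵢ[ℝ] EuclideanSpace ℝ (Fin (d + 1))}
    (hg : LinearMap.det (g.toLinearEquiv :
      EuclideanSpace ℝ (Fin (d + 1)) →ₗ[ℝ] EuclideanSpace ℝ (Fin (d + 1))) = 1)
    (θ : Fin k → Sph d) (a : Fin k → ℝ) :
    mixedMoment P T (fun j => actSph g (θ j)) a = mixedMoment P T θ a := by
  have hu : Measurable fun x : Fin k → ℝ => ∏ j, ENNReal.ofReal (x j) ^ a j := by fun_prop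
  exact ((hT k θ g hg).comp hu).lintegral_eq.symm

lemma IsotropyConditions.lintegral_prod_rpow [IsProbabilityMeasure P]
    (h : ConvergenceConditions P Λ b p a) (hiso : IsotropyConditions P Λ p) {q : ℝ}
    (hq : q ∈ Set.Icc 0 p) (n : ℕ) (θ : Sph d) :
    ∫⁻ ω, (∏ i ∈ Finset.range n, ennField Λ i θ ω) ^ q ∂P =
      powMoment P (Λ 0 (northPole d)) q ^ n := by
  rw [h.isCascade.lintegral_prod_rpow]
  calc ∏ i ∈ Finset.range n, ∫⁻ ω, ennField Λ i θ ω ^ q ∂P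
      = ∏ _i ∈ Finset.range n, powMoment P (Λ 0 (northPole d)) q :=
        Finset.prod_congr rfl fun i _ => (hiso.moments q hq 0 i θ).symm
    _ = _ := by rw [Finset.prod_const, Finset.card_range]

lemma pow_mul_le_inv_pow_sub (hb : 0 < b) {n i : ℕ} (hi : i ≤ n) {δ : ℝ} (hn : b ^ n * δ ≤ 1) :
    b ^ i * δ ≤ (b ^ (n - i))⁻¹ := by
  rw [← one_div, le_div_iff₀ (by positivity)]
  calc b ^ i * δ * b ^ (n - i) = b ^ n * δ := by
        rw [mul_right_comm, ← pow_add, Nat.add_sub_cancel' hi]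
    _ ≤ 1 := hn

/-- Upper bound for the pair moments of order `q < 1`, at distances up to `b ^ (-n)`. -/
lemma exists_pair_moment_le [IsProbabilityMeasure P]
    (h : ConvergenceConditions P Λ b p a) (hiso : IsotropyConditions P Λ p) {q : ℝ}
    (hq0 : 0 < q) (hq : q < 1) (hs : SmallExponentCondition P Λ b q) :
    ∃ C : ℝ≥0∞, C ≠ ∞ ∧ ∀ (n : ℕ) (δ : ℝ), 0 < δ → b ^ n * δ ≤ 1 → ∀ θ₁ θ₂ : Sph d,
      angDist θ₁ θ₂ ≤ δ →
      ∫⁻ ω, (∏ i ∈ Finset.range n, ennField Λ i θ₁ ω) ^ (q - 1) *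
        ∏ i ∈ Finset.range n, ennField Λ i θ₂ ω ∂P ≤
        C * powMoment P (Λ 0 (northPole d)) q ^ n := by
  obtain ⟨ρ, hmono, hρ, hsum⟩ := hs
  have hqp : q ∈ Set.Icc 0 p := ⟨hq0.le, by linarith [h.two_le]⟩
  have hb0 : 0 < b := by linarith [h.one_lt_scale]
  set K := powMoment P (Λ 0 (northPole d)) q
  have hKt : K ≠ ∞ := h.powMoment_ne_top hqp _ _
  have hK0 : K ≠ 0 := h.powMoment_ne_zero _ _ _
  have hKi : ∀ i, powMoment P (Λ i (northPole d)) q = K := fun i =>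
    hiso.moments q hqp i 0 (northPole d)
  simp_rw [hKi] at hsum
  refine ⟨ENNReal.ofReal (Real.exp (∑' j, |Real.log (ρ ((b ^ (j + 1))⁻¹) / K.toReal)|)),
    ENNReal.ofReal_ne_top, fun n δ hδ hn θ₁ θ₂ hθ => ?_⟩
  calc ∫⁻ ω, (∏ i ∈ Finset.range n, ennField Λ i θ₁ ω) ^ (q - 1) *
        ∏ i ∈ Finset.range n, ennField Λ i θ₂ ω ∂P
      = ∫⁻ ω, ∏ j, (∏ i ∈ Finset.range n, ennField Λ i (![θ₁, θ₂] j) ω) ^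
          (![q - 1, 1] : Fin 2 → ℝ) j ∂P := by
        refine lintegral_congr fun ω => ?_
        simp [Fin.prod_univ_two]
    _ = ∏ i ∈ Finset.range n, mixedMoment P (Λ i) ![θ₁, θ₂] ![q - 1, 1] :=
        h.isCascade.lintegral_prod_moment _ _ _
    _ ≤ ∏ i ∈ Finset.range n, ENNReal.ofReal (ρ ((b ^ (n - i))⁻¹)) := by
        refine Finset.prod_le_prod' fun i hi => (hρ i _).trans (ENNReal.ofReal_le_ofReal ?_)
        rw [minDist_pair]
        have hd0 := angDist_nonneg θ₁ θ₂
        refine hmono (Set.mem_Ici.2 (by positivity)) (Set.mem_Ici.2 (by positivity)) ?_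
        refine le_trans ?_ (pow_mul_le_inv_pow_sub hb0 (Finset.mem_range.1 hi).le hn)
        gcongr
    _ ≤ ENNReal.ofReal K.toReal ^ n * ENNReal.ofReal _ :=
        prod_ofReal_le_pow_mul (f := fun j => ρ ((b ^ j)⁻¹)) (ENNReal.toReal_pos hK0 hKt) hsum n
    _ = _ := by rw [ENNReal.ofReal_toReal hKt, mul_comm]

/-- Lower bound for the mixed moments of order `q ≥ 1`, at distances up to `b ^ (-n)`. -/
lemma exists_le_pair_moment [IsProbabilityMeasure P] (hd : 1 ≤ d)
    (h : ConvergenceConditions P Λ b p a) (hiso : IsotropyConditions P Λ p) {q : ℝ}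
    (hq : q ∈ Set.Icc 1 p) (hs : LargeExponentCondition P Λ b k q) :
    ∃ c : ℝ≥0∞, c ≠ 0 ∧ ∀ (n : ℕ) (δ : ℝ), 0 < δ → δ ≤ 1 → b ^ n * δ ≤ 1 → ∀ θ₁ θ₂ : Sph d,
      angDist θ₁ θ₂ ≤ δ → c * powMoment P (Λ 0 (northPole d)) q ^ n ≤
      ∫⁻ ω, (∏ i ∈ Finset.range n, ennField Λ i θ₂ ω) ^ (q / k) *
        (∏ i ∈ Finset.range n, ennField Λ i θ₁ ω) ^ (q - q / k) ∂P := by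
  obtain ⟨θ₀, υ, hanti, hpos, hυ, hsum⟩ := hs
  have hqp : q ∈ Set.Icc 0 p := ⟨by linarith [hq.1], hq.2⟩
  have hb0 : 0 < b := by linarith [h.one_lt_scale]
  set K := powMoment P (Λ 0 (northPole d)) q
  have hKt : K ≠ ∞ := h.powMoment_ne_top hqp _ _
  have hK0 : K ≠ 0 := h.powMoment_ne_zero _ _ _
  have hKi : ∀ i, powMoment P (Λ i θ₀) q = K := fun i => (hiso.moments q hqp 0 i θ₀).symm
  simp_rw [hKi] at hsum
  refine ⟨(ENNReal.ofReal (Real.exp (∑' j, |Real.log (K.toReal / υ ((b ^ (j + 1))⁻¹))|)))⁻¹,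
    ENNReal.inv_ne_zero.2 ENNReal.ofReal_ne_top, fun n δ hδ hδ1 hn θ₁ θ₂ hθ => ?_⟩
  -- the tuple `(θ₂, θ₁, …, θ₁)`, rotated so that `θ₁` becomes the centre `θ₀` of the caps
  obtain ⟨m, rfl⟩ : ∃ m, k = m + 1 := ⟨k - 1, by have := h.two_le_card; omega⟩
  set θ : Fin (m + 1) → Sph d := Fin.cons θ₂ fun _ => θ₁ with hθdef
  have hθcap : ∀ j, angDist (θ j) θ₁ ≤ δ := by
    intro j
    refine Fin.cases ?_ (fun i => ?_) j
    · rw [angDist_comm]; exact hθ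
    · change angDist θ₁ θ₁ ≤ δ
      rw [angDist_self]; exact hδ.le
  obtain ⟨g, hg, hgθ⟩ := exists_rotation hd θ₁ θ₀
  calc _ ≤ ∏ i ∈ Finset.range n, ENNReal.ofReal (υ ((b ^ (n - i))⁻¹)) := by
        have := pow_mul_le_prod_ofReal (f := fun j => υ ((b ^ j)⁻¹)) (ENNReal.toReal_pos hK0 hKt)
          (fun j => hpos _ (by positivity)) hsum n
        rwa [ENNReal.ofReal_toReal hKt] at this
    _ ≤ ∏ i ∈ Finset.range n, mixedMoment P (Λ i) θ fun _ => q / ((m + 1 : ℕ) : ℝ) := by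
        refine Finset.prod_le_prod' fun i hi => ?_
        rw [← (hiso.isotropic i).mixedMoment_actSph hg]
        refine le_trans (ENNReal.ofReal_le_ofReal ?_) (hυ i δ ⟨hδ.le, ?_⟩ _ fun j => ?_)
        · exact hanti (Set.mem_Ici.2 (by positivity)) (Set.mem_Ici.2 (by positivity))
            (pow_mul_le_inv_pow_sub hb0 (Finset.mem_range.1 hi).le hn)
        · linarith [Real.pi_gt_three]
        · change angDist (actSph g (θ j)) θ₀ ≤ δ
          rw [← hgθ, angDist_actSph]; exact hθcap j
    _ = ∫⁻ ω, ∏ j, (∏ i ∈ Finset.range n, ennField Λ i (θ j) ω) ^ (q / ((m + 1 : ℕ) : ℝ)) ∂P :=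
        (h.isCascade.lintegral_prod_moment _ _ _).symm
    _ = _ := by
        refine lintegral_congr fun ω => ?_
        rw [Fin.prod_univ_succ]
        simp only [hθdef, Fin.cons_zero, Fin.cons_succ, Finset.prod_const, Finset.card_univ,
          Fintype.card_fin]
        rw [← ENNReal.rpow_natCast, ← ENNReal.rpow_mul]
        congr 2
        push_cast
        field_simp
        ring

/-- The moments of the mass of a small cell, with the normalized surface measure `ν` of the cell,
are of the order of the moments at a point of the product of the first `n` fields, where `b ^ (-n)`
is comparable to the diameter `δ` of the cell. -/
theorem exists_moment_bounds [IsProbabilityMeasure P] (hd : 1 ≤ d)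
    (h : ConvergenceConditions P Λ b p a) (hiso : IsotropyConditions P Λ p)
    (hsmall : ∀ q ∈ Set.Ioo (0 : ℝ) 1, SmallExponentCondition P Λ b q)
    (hlarge : ∀ q ∈ Set.Icc (1 : ℝ) p, LargeExponentCondition P Λ b k q)
    {q : ℝ} (hq0 : 0 < q) (hqp : q ≤ p) {A : ℝ} (hA : 0 ≤ A) :
    ∃ c C : ℝ≥0∞, c ≠ 0 ∧ C ≠ ∞ ∧ ∀ (ν : Measure (Sph d)) (δ : ℝ) (n : ℕ) (Y : Ω → ℝ≥0∞),
      IsProbabilityMeasure ν → IsSpread ν δ A → 0 < δ → δ ≤ 1 → b ^ n * δ ≤ 1 →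
      1 ≤ b ^ (n + 1) * δ → AEMeasurable Y P →
      (∀ᵐ ω ∂P, Tendsto (fun N => mass (ennField Λ) ν (Finset.range N) ω) atTop (𝓝 (Y ω))) →
      c * powMoment P (Λ 0 (northPole d)) q ^ n ≤ ∫⁻ ω, Y ω ^ q ∂P ∧
      ∫⁻ ω, Y ω ^ q ∂P ≤ C * powMoment P (Λ 0 (northPole d)) q ^ n := by
  have hp2 := h.two_le
  have hqI : q ∈ Set.Icc 0 p := ⟨hq0.le, hqp⟩
  have hpI : p ∈ Set.Icc 0 p := ⟨by linarith, le_rfl⟩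
  set K := powMoment P (Λ 0 (northPole d))
  have hKt : K q ≠ ∞ := h.powMoment_ne_top hqI _ _
  have hK0 : K q ≠ 0 := h.powMoment_ne_zero _ _ _
  have hKpt : K p ≠ ∞ := h.powMoment_ne_top hpI _ _
  obtain ⟨C, hCt, hC⟩ := h.exists_lintegral_mass_rpow_le hd hA
  have hL := h.isCascade
  have hκ := fun n => hiso.lintegral_prod_rpow h hqI n
  have hκp := fun n => hiso.lintegral_prod_rpow h hpI n
  rcases lt_or_ge q 1 with hq | hq
  · obtain ⟨C', hCt', hC'⟩ := exists_pair_moment_le h hiso hq0 hq (hsmall q ⟨hq0, hq⟩)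
    refine ⟨(C ^ ((1 - q) / (p - 1)))⁻¹, C', ENNReal.inv_ne_zero.2
      (ENNReal.rpow_ne_top_of_nonneg (div_nonneg (by linarith) (by linarith)) hCt), hCt',
      fun ν δ n Y hν hs hδ hδ1 hn hn1 hY hlim => ⟨?_, ?_⟩⟩
    · rw [mul_comm]
      exact hL.le_lintegral_limit_rpow hq0 hq (by linarith) (hκ n) (hκp n)
        (ENNReal.pow_ne_top hKpt) hCt (fun N => hC ν δ hν hδ hs n N hn1) hY hlim
    · refine hL.lintegral_limit_rpow_le_of_pair hq0 hq (n := n) ?_ hlim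
      filter_upwards [hs.dist_le] with θ₁ h1
      filter_upwards [h1] with θ₂ h2
      exact hC' n δ hδ hn θ₁ θ₂ h2
  · obtain ⟨c, hc0, hc⟩ := exists_le_pair_moment hd h hiso ⟨hq, hqp⟩ (hlarge q ⟨hq, hqp⟩)
    have hk : (1 : ℝ) < k := by exact_mod_cast h.two_le_card
    refine ⟨(c ^ ((q - q / k) / (q - 1 / k))⁻¹) ^ (1 / k / q : ℝ)⁻¹, C ^ (q / p), ?_,
      ENNReal.rpow_ne_top_of_nonneg (by positivity) hCt,
      fun ν δ n Y hν hs hδ hδ1 hn hn1 hY hlim => ⟨?_, ?_⟩⟩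
    · have e1 : 0 ≤ ((q - q / k) / (q - 1 / k))⁻¹ := by
        have : q / k ≤ q := div_le_self hq0.le hk.le
        have : 1 / (k : ℝ) ≤ 1 := by rw [div_le_one (by linarith)]; exact hk.le
        exact inv_nonneg.2 (div_nonneg (by linarith) (by linarith))
      exact (ENNReal.rpow_pos_of_nonneg (ENNReal.rpow_pos_of_nonneg (pos_iff_ne_zero.2 hc0) e1)
        (by positivity)).ne'
    · obtain ⟨θ₁, h1⟩ := hs.dist_le.exists
      refine hL.le_lintegral_limit_rpow_of_pair hq (by linarith) (hκ n)
        (pow_ne_zero _ hK0) (ENNReal.pow_ne_top hKt) (hκp n) (ENNReal.pow_ne_top hKpt) hCt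
        (fun N => hC ν δ hν hδ hs n N hn1) hY hlim hk θ₁ ?_
      filter_upwards [h1] with θ₂ h2
      exact hc n δ hδ hδ1 hn θ₁ θ₂ h2
    · rw [mul_comm]
      exact hL.lintegral_limit_rpow_le hq hqp (hκ n) (fun N => hC ν δ hν hδ hs n N hn1) hlim

end

/-! ### Exponential growth -/

/-- The sequence `S` is of exact order `exp (s * l)`, up to constant factors. In particular it is
eventually positive and finite. -/
def HasExpGrowth (S : ℕ → ℝ≥0∞) (s : ℝ) : Prop :=
  ∃ C : ℝ, ∀ᶠ l : ℕ in atTop, ∃ u : ℝ, S l = ENNReal.ofReal (Real.exp u) ∧ |u - s * l| ≤ C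

lemma HasExpGrowth.mul {S T : ℕ → ℝ≥0∞} {s t : ℝ} (hS : HasExpGrowth S s)
    (hT : HasExpGrowth T t) : HasExpGrowth (fun l => S l * T l) (s + t) := by
  obtain ⟨C, hC⟩ := hS
  obtain ⟨C', hC'⟩ := hT
  refine ⟨C + C', ?_⟩
  filter_upwards [hC, hC'] with l ⟨u, h1, h2⟩ ⟨v, h3, h4⟩
  refine ⟨u + v, ?_, ?_⟩
  · rw [h1, h3, ← ENNReal.ofReal_mul (Real.exp_pos _).le, Real.exp_add]
  · calc |u + v - (s + t) * l| = |(u - s * l) + (v - t * l)| := by congr 1; ring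
      _ ≤ |u - s * l| + |v - t * l| := abs_add_le _ _
      _ ≤ _ := add_le_add h2 h4

lemma HasExpGrowth.rpow {S : ℕ → ℝ≥0∞} {s : ℝ} (hS : HasExpGrowth S s) (q : ℝ) :
    HasExpGrowth (fun l => S l ^ q) (s * q) := by
  obtain ⟨C, hC⟩ := hS
  refine ⟨C * |q|, ?_⟩
  filter_upwards [hC] with l ⟨u, h1, h2⟩
  refine ⟨u * q, ?_, ?_⟩
  · rw [h1, ENNReal.ofReal_rpow_of_pos (Real.exp_pos _), ← Real.exp_mul]
  · calc |u * q - s * q * l| = |u - s * l| * |q| := by rw [← abs_mul]; congr 1; ring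
      _ ≤ _ := by gcongr

lemma HasExpGrowth.of_le {S T : ℕ → ℝ≥0∞} {s : ℝ} (hS : HasExpGrowth S s) {c C : ℝ≥0∞}
    (hc : c ≠ 0) (hC : C ≠ ∞) (h : ∀ᶠ l in atTop, c * S l ≤ T l ∧ T l ≤ C * S l) :
    HasExpGrowth T s := by
  obtain ⟨B, hB⟩ := hS
  refine ⟨B + max |Real.log C.toReal| |Real.log c.toReal|, ?_⟩
  filter_upwards [h, hB] with l ⟨h1, h2⟩ ⟨u, h3, h4⟩
  rw [h3] at h1 h2
  have he : ENNReal.ofReal (Real.exp u) ≠ 0 := by simp [Real.exp_pos]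
  have hTt : T l ≠ ∞ := ne_top_of_le_ne_top (ENNReal.mul_ne_top hC ENNReal.ofReal_ne_top) h2
  have hT0 : T l ≠ 0 := fun h0 => mul_ne_zero hc he (le_antisymm (h0 ▸ h1) bot_le)
  have hct : c ≠ ∞ := by
    rintro rfl
    rw [ENNReal.top_mul he] at h1
    exact hTt (top_le_iff.1 h1)
  have hC0 : C ≠ 0 := by
    rintro rfl
    rw [zero_mul] at h2
    exact hT0 (le_antisymm h2 bot_le)
  have hTpos := ENNReal.toReal_pos hT0 hTt
  have h1' := ENNReal.toReal_mono hTt h1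
  have h2' := ENNReal.toReal_mono (ENNReal.mul_ne_top hC ENNReal.ofReal_ne_top) h2
  rw [ENNReal.toReal_mul, ENNReal.toReal_ofReal (Real.exp_pos _).le] at h1' h2'
  have hcp := ENNReal.toReal_pos hc hct
  have hCp := ENNReal.toReal_pos hC0 hC
  have h1'' := Real.log_le_log (by positivity) h1'
  have h2'' := Real.log_le_log hTpos h2'
  rw [Real.log_mul hcp.ne' (Real.exp_pos _).ne', Real.log_exp] at h1''
  rw [Real.log_mul hCp.ne' (Real.exp_pos _).ne', Real.log_exp] at h2''
  refine ⟨Real.log (T l).toReal, ?_, ?_⟩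
  · rw [Real.exp_log hTpos, ENNReal.ofReal_toReal hTt]
  · have m1 := le_max_left |Real.log C.toReal| |Real.log c.toReal|
    have m2 := le_max_right |Real.log C.toReal| |Real.log c.toReal|
    have a1 := le_abs_self (Real.log C.toReal)
    have a2 := neg_abs_le (Real.log c.toReal)
    rw [abs_le] at h4 ⊢
    constructor <;> linarith [h4.1, h4.2]

lemma hasExpGrowth_ofReal_exp (s C : ℝ) :
    HasExpGrowth (fun l => ENNReal.ofReal (Real.exp (s * l + C))) s :=
  ⟨|C|, Eventually.of_forall fun l => ⟨_, rfl, by simp⟩⟩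

lemma hasExpGrowth_pow {K : ℝ≥0∞} (hK0 : K ≠ 0) (hKt : K ≠ ∞) {n : ℕ → ℕ} {s C : ℝ}
    (hn : ∀ᶠ l : ℕ in atTop, |n l - s * l| ≤ C) :
    HasExpGrowth (fun l => K ^ n l) (s * Real.log K.toReal) := by
  refine ⟨C * |Real.log K.toReal|, ?_⟩
  filter_upwards [hn] with l hl
  refine ⟨n l * Real.log K.toReal, ?_, ?_⟩
  · rw [Real.exp_nat_mul, Real.exp_log (ENNReal.toReal_pos hK0 hKt),
      ENNReal.ofReal_pow ENNReal.toReal_nonneg, ENNReal.ofReal_toReal hKt]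
  · calc _ = |n l - s * l| * |Real.log K.toReal| := by rw [← abs_mul]; congr 1; ring
      _ ≤ _ := by gcongr

lemma tendsto_div_of_abs_sub_le {u : ℕ → ℝ} {s C : ℝ} (h : ∀ᶠ l : ℕ in atTop, |u l - s * l| ≤ C) :
    Tendsto (fun l : ℕ => u l / l) atTop (𝓝 s) := by
  rw [tendsto_iff_norm_sub_tendsto_zero]
  refine squeeze_zero' (Eventually.of_forall fun _ => norm_nonneg _) (g := fun l : ℕ => C / l) ?_
    (tendsto_const_div_atTop_nhds_zero_nat C)
  filter_upwards [h, eventually_gt_atTop 0] with l hl hl0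
  have hl0' : (0 : ℝ) < l := by exact_mod_cast hl0
  have he : u l / l - s = (u l - s * l) / l := by field_simp
  rw [Real.norm_eq_abs, he, abs_div, abs_of_pos hl0']
  gcongr

lemma HasExpGrowth.liminf_log_div_log {S T : ℕ → ℝ≥0∞} {s t : ℝ} (hS : HasExpGrowth S s)
    (hT : HasExpGrowth T t) (ht : t ≠ 0) :
    liminf (fun l => ENNReal.log (S l) / ENNReal.log (T l)) atTop = ((s / t : ℝ) : EReal) := by
  obtain ⟨C, hC⟩ := hS
  obtain ⟨C', hC'⟩ := hT
  have hu : ∀ᶠ l : ℕ in atTop, |Real.log (S l).toReal - s * l| ≤ C := by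
    filter_upwards [hC] with l ⟨u, h1, h2⟩
    rwa [h1, ENNReal.toReal_ofReal (Real.exp_pos _).le, Real.log_exp]
  have hv : ∀ᶠ l : ℕ in atTop, |Real.log (T l).toReal - t * l| ≤ C' := by
    filter_upwards [hC'] with l ⟨u, h1, h2⟩
    rwa [h1, ENNReal.toReal_ofReal (Real.exp_pos _).le, Real.log_exp]
  have hlim := (tendsto_div_of_abs_sub_le hu).div (tendsto_div_of_abs_sub_le hv) ht
  refine Tendsto.liminf_eq (((continuous_coe_real_ereal.tendsto _).comp hlim).congr' ?_)
  filter_upwards [hC, hC', eventually_gt_atTop 0] with l ⟨u, h1, h2⟩ ⟨v, h3, h4⟩ hl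
  have hl' : (l : ℝ) ≠ 0 := by exact_mod_cast hl.ne'
  simp only [Function.comp_apply, Pi.div_apply]
  rw [h1, h3, ENNReal.log_ofReal_of_pos (Real.exp_pos _), ENNReal.log_ofReal_of_pos
    (Real.exp_pos _), ENNReal.toReal_ofReal (Real.exp_pos _).le,
    ENNReal.toReal_ofReal (Real.exp_pos _).le, Real.log_exp, Real.log_exp, ← EReal.coe_div,
    div_div_div_cancel_right₀ hl']

/-! ### Cells of a dyadic decomposition -/

instance isFiniteMeasure_surfaceMeasure (d : ℕ) : IsFiniteMeasure (surfaceMeasure d) := by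
  unfold surfaceMeasure; infer_instance

section
variable {d : ℕ}

/-- `C` is the constant of `exists_surface_cap_le`, and `v` a lower bound for the measure of `B`. -/
lemma isSpread_cond {B : Set (Sph d)} (hB : MeasurableSet B) {δ v C A : ℝ} (hδ : 0 < δ)
    (hC : ∀ (x : Sph d) (r : ℝ), 0 < r → (surfaceMeasure d).real (sphCap x r) ≤ C * r ^ d)
    (hv : 0 < v) (hvB : v ≤ (surfaceMeasure d).real B)
    (hBδ : ∀ x ∈ B, ∀ y ∈ B, angDist x y ≤ δ) (hA : C * δ ^ d ≤ A * v) :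
    IsSpread (ProbabilityTheory.cond (surfaceMeasure d) B) δ A := by
  have hmem := ae_cond_mem (μ := surfaceMeasure d) hB
  refine ⟨?_, Eventually.of_forall fun x t ht0 _ => ?_⟩
  · filter_upwards [hmem] with x hx
    filter_upwards [hmem] with y hy using hBδ x hx y hy
  · rw [cond_apply hB, ← ofReal_measureReal (measure_ne_top _ _),
      ← ENNReal.ofReal_inv_of_pos (hv.trans_le hvB)]
    have hsub : B ∩ {y | angDist x y ≤ t * δ} ⊆ sphCap x (t * δ) := by
      intro y hy
      change angDist y x ≤ t * δ
      rw [angDist_comm]; exact hy.2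
    calc ENNReal.ofReal ((surfaceMeasure d).real B)⁻¹ *
          surfaceMeasure d (B ∩ {y | angDist x y ≤ t * δ})
        ≤ ENNReal.ofReal v⁻¹ * ENNReal.ofReal (C * (t * δ) ^ d) := by
          gcongr
          refine (measure_mono hsub).trans ?_
          rw [← ofReal_measureReal (measure_ne_top _ _)]
          exact ENNReal.ofReal_le_ofReal (hC x _ (by positivity))
      _ = ENNReal.ofReal (v⁻¹ * (C * δ ^ d) * t ^ d) := by
          rw [← ENNReal.ofReal_mul (by positivity)]; congr 1; ring
      _ ≤ _ := by
          refine ENNReal.ofReal_le_ofReal ?_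
          gcongr
          rw [inv_mul_le_iff₀ hv]
          linarith

lemma mass_restrict_eq_mul {Ω S : Type*} [MeasurableSpace S] {L : ℕ → S → Ω → ℝ≥0∞}
    {σ : Measure S} [IsFiniteMeasure σ] {B : Set S} (hB : σ B ≠ 0) (s : Finset ℕ) (ω : Ω) :
    mass L (σ.restrict B) s ω = σ B * mass L (ProbabilityTheory.cond σ B) s ω := by
  rw [mass, mass, ProbabilityTheory.cond, lintegral_smul_measure, smul_eq_mul, ← mul_assoc,
    ENNReal.mul_inv_cancel hB (measure_ne_top _ _), one_mul]

/-- The surface measures and the diameters of the cells. -/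
lemma DyadicDecomposition.exists_cell_bounds (D : DyadicDecomposition d) :
    ∃ c C δ : ℝ, 0 < c ∧ 0 < C ∧ 0 < δ ∧ ∀ l m,
      c * ((1 / 2) ^ l) ^ d ≤ (surfaceMeasure d).real (D.cell l m) ∧
      (surfaceMeasure d).real (D.cell l m) ≤ C * ((1 / 2) ^ l) ^ d ∧
      ∀ x ∈ D.cell l m, ∀ y ∈ D.cell l m, angDist x y ≤ δ * (1 / 2) ^ l := by
  obtain ⟨c, C, hc, hC, h⟩ := D.caps
  obtain ⟨C', hC', hcap⟩ := exists_surface_cap_le d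
  obtain ⟨c', hc', hcap'⟩ := exists_le_surface_cap d
  refine ⟨c' * min c 1 ^ d, C' * C ^ d, 2 * C, by positivity, by positivity, by positivity,
    fun l m => ?_⟩
  obtain ⟨x, h1, h2⟩ := h l m
  have hp : (0 : ℝ) < (1 / 2) ^ l := by positivity
  refine ⟨?_, ?_, fun y hy z hz => ?_⟩
  · have hsub : sphCap x (min c 1 * (1 / 2) ^ l) ⊆ D.cell l m := by
      refine Set.Subset.trans (fun y hy => ?_) h1
      exact le_trans (show angDist y x ≤ _ from hy) (by gcongr; exact min_le_left _ _)
    refine le_trans ?_ (measureReal_mono hsub)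
    rw [mul_assoc, ← mul_pow]
    refine hcap' x _ (by positivity) ?_
    exact mul_le_one₀ (min_le_right _ _) hp.le (pow_le_one₀ (by norm_num) (by norm_num))
  · refine (measureReal_mono h2).trans ((hcap x _ (by positivity)).trans (le_of_eq ?_))
    rw [mul_pow, mul_assoc]
  · have hy' : angDist y x ≤ C * (1 / 2) ^ l := h2 hy
    have hz' : angDist z x ≤ C * (1 / 2) ^ l := h2 hz
    have := angDist_triangle y x z
    rw [angDist_comm x z] at this
    linarith

/-- The number `n l` of the fields that vary little on sets of diameter `δ * 2 ^ (-l)`, as is the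
case for the cells of level `l` of a decomposition. -/
lemma exists_scale {b δ : ℝ} (hb : 1 < b) (hδ : 0 < δ) : ∃ (n : ℕ → ℕ) (C : ℝ),
    ∀ᶠ l : ℕ in atTop, δ * (1 / 2) ^ l ≤ 1 ∧ b ^ n l * (δ * (1 / 2) ^ l) ≤ 1 ∧
      1 ≤ b ^ (n l + 1) * (δ * (1 / 2) ^ l) ∧ |n l - Real.log 2 / Real.log b * l| ≤ C := by
  have hb0 : 0 < b := by linarith
  have hlogb : 0 < Real.log b := Real.log_pos hb
  have hex : ∀ l : ℕ, ∃ n : ℕ, δ * (1 / 2) ^ l ≤ 1 →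
      b ^ n * (δ * (1 / 2) ^ l) ≤ 1 ∧ 1 ≤ b ^ (n + 1) * (δ * (1 / 2) ^ l) := by
    intro l
    have hp : 0 < δ * (1 / 2) ^ l := by positivity
    by_cases h : δ * (1 / 2) ^ l ≤ 1
    · obtain ⟨n, h1, h2⟩ := exists_nat_pow_near ((one_le_inv₀ hp).2 h) hb
      refine ⟨n, fun _ => ⟨?_, ?_⟩⟩
      · rwa [← le_inv_mul_iff₀' hp, mul_one] at *
      · rw [← inv_mul_le_iff₀' hp, mul_one]; exact h2.le
    · exact ⟨0, fun h' => absurd h' h⟩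
  choose n hn using hex
  refine ⟨n, (|Real.log δ| + Real.log b) / Real.log b, ?_⟩
  have hlim : Tendsto (fun l : ℕ => δ * (1 / 2) ^ l) atTop (𝓝 0) := by
    simpa using (tendsto_pow_atTop_nhds_zero_of_lt_one (r := (1 / 2 : ℝ)) (by norm_num)
      (by norm_num)).const_mul δ
  filter_upwards [hlim.eventually (ge_mem_nhds zero_lt_one)] with l hl
  obtain ⟨h1, h2⟩ := hn l hl
  refine ⟨hl, h1, h2, ?_⟩
  have hlog : Real.log (δ * (1 / 2) ^ l) = Real.log δ - l * Real.log 2 := by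
    rw [Real.log_mul hδ.ne' (by positivity), Real.log_pow, one_div, Real.log_inv]; ring
  have hp : 0 < δ * (1 / 2) ^ l := by positivity
  have h1' := Real.log_nonpos (by positivity) h1
  have h2' := Real.log_nonneg h2
  rw [Real.log_mul (by positivity) hp.ne', Real.log_pow, hlog] at h1' h2'
  push_cast at h2'
  rw [le_div_iff₀ hlogb, ← abs_of_pos hlogb, ← abs_mul, abs_of_pos hlogb]
  have he : (n l - Real.log 2 / Real.log b * l) * Real.log b =
      n l * Real.log b - l * Real.log 2 := by field_simp
  rw [he, abs_le]
  constructor <;> linarith [le_abs_self (Real.log δ), neg_abs_le (Real.log δ)]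

lemma hasExpGrowth_half_pow (d : ℕ) :
    HasExpGrowth (fun l => ENNReal.ofReal (((1 / 2) ^ l) ^ d)) (-(d * Real.log 2)) := by
  have h := hasExpGrowth_ofReal_exp (-(d * Real.log 2)) 0
  refine h.of_le one_ne_zero ENNReal.one_ne_top (Eventually.of_forall fun l => ?_)
  have he : Real.exp (-(d * Real.log 2) * l + 0) = ((1 / 2 : ℝ) ^ l) ^ d := by
    rw [← Real.exp_log (show (0 : ℝ) < ((1 / 2 : ℝ) ^ l) ^ d by positivity), Real.log_pow,
      Real.log_pow, one_div, Real.log_inv]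
    congr 1; ring
  rw [one_mul, he]
  exact ⟨le_rfl, le_rfl⟩

lemma DyadicDecomposition.surfaceMeasure_univ (D : DyadicDecomposition d) (l : ℕ) :
    surfaceMeasure d Set.univ = ∑ m, surfaceMeasure d (D.cell l m) := by
  rw [← D.iUnion_cell l, measure_iUnion (fun m m' h => D.disjoint_cell l m m' h)
    (D.measurableSet_cell l), tsum_fintype]

lemma surfaceMeasure_univ_ne_zero (d : ℕ) : surfaceMeasure d Set.univ ≠ 0 := by
  obtain ⟨c, hc, h⟩ := exists_le_surface_cap d
  intro h0
  have h1 := h (northPole d) 1 one_pos le_rfl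
  rw [measureReal_def, measure_mono_null (Set.subset_univ _) h0] at h1
  simp at h1
  linarith

lemma DyadicDecomposition.exists_surfaceMeasure_cell_bounds (D : DyadicDecomposition d) :
    ∃ c C : ℝ≥0∞, c ≠ 0 ∧ c ≠ ∞ ∧ C ≠ 0 ∧ C ≠ ∞ ∧ ∀ l m,
      c * ENNReal.ofReal (((1 / 2) ^ l) ^ d) ≤ surfaceMeasure d (D.cell l m) ∧
      surfaceMeasure d (D.cell l m) ≤ C * ENNReal.ofReal (((1 / 2) ^ l) ^ d) := by
  obtain ⟨c, C, δ, hc, hC, hδ, h⟩ := D.exists_cell_bounds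
  refine ⟨ENNReal.ofReal c, ENNReal.ofReal C, (ENNReal.ofReal_pos.2 hc).ne', ENNReal.ofReal_ne_top,
    (ENNReal.ofReal_pos.2 hC).ne', ENNReal.ofReal_ne_top, fun l m => ?_⟩
  rw [← ENNReal.ofReal_mul hc.le, ← ENNReal.ofReal_mul hC.le,
    ← ofReal_measureReal (measure_ne_top _ _)]
  exact ⟨ENNReal.ofReal_le_ofReal (h l m).1, ENNReal.ofReal_le_ofReal (h l m).2.1⟩

/-- If the cells have measure of order `2 ^ (-l d)`, there are `2 ^ (l d)` of them, up to a
factor. -/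
lemma DyadicDecomposition.hasExpGrowth_card (D : DyadicDecomposition d) :
    HasExpGrowth (fun l => ((D.last l + 1 : ℕ) : ℝ≥0∞)) (d * Real.log 2) := by
  obtain ⟨c, C, hc0, hct, hC0, hCt, h⟩ := D.exists_surfaceMeasure_cell_bounds
  have h0 := (hasExpGrowth_half_pow d).rpow (-1)
  rw [show -(d * Real.log 2) * -1 = d * Real.log 2 by ring] at h0
  refine h0.of_le (c := surfaceMeasure d Set.univ / C) (C := surfaceMeasure d Set.univ / c)
    (ENNReal.div_ne_zero.2 ⟨surfaceMeasure_univ_ne_zero d, hCt⟩)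
    (ENNReal.div_ne_top (measure_ne_top _ _) hc0) (Eventually.of_forall fun l => ?_)
  have hcell := h l
  have hR0 : ENNReal.ofReal (((1 / 2) ^ l) ^ d) ≠ 0 := (ENNReal.ofReal_pos.2 (by positivity)).ne'
  have hRt : ENNReal.ofReal (((1 / 2) ^ l) ^ d) ≠ ∞ := ENNReal.ofReal_ne_top
  set R := ENNReal.ofReal (((1 / 2) ^ l) ^ d)
  rw [ENNReal.rpow_neg_one, D.surfaceMeasure_univ l]
  have hcard : ∀ x : ℝ≥0∞, ∑ _m : Fin (D.last l + 1), x = ((D.last l + 1 : ℕ) : ℝ≥0∞) * x := by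
    intro x
    rw [Finset.sum_const, Finset.card_univ, Fintype.card_fin, nsmul_eq_mul]
  have hlow := Finset.sum_le_sum fun m (_ : m ∈ Finset.univ) => (hcell m).1
  have hupp := Finset.sum_le_sum fun m (_ : m ∈ Finset.univ) => (hcell m).2
  rw [hcard] at hlow hupp
  constructor
  · rw [div_eq_mul_inv, mul_assoc, ← ENNReal.mul_inv (Or.inl hC0) (Or.inl hCt),
      ← div_eq_mul_inv]
    exact ENNReal.div_le_of_le_mul hupp
  · rw [div_eq_mul_inv, mul_assoc, ← ENNReal.mul_inv (Or.inl hc0) (Or.inl hct),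
      ← div_eq_mul_inv]
    rwa [ENNReal.le_div_iff_mul_le (Or.inl (mul_ne_zero hc0 hR0))
      (Or.inl (ENNReal.mul_ne_top hct hRt))]

end

/-! ### Existence of the limit and the Rényi function -/

section
variable {Ω : Type*} [MeasurableSpace Ω] {P : Measure Ω} [IsProbabilityMeasure P] {d k : ℕ}
  {Λ : ℕ → Sph d → Ω → ℝ} {b p : ℝ} {a : Fin k → ℝ}

/-- The cumulative measures converge to a random measure. -/
lemma ConvergenceConditions.exists_isLimitingMeasure (hd : 1 ≤ d)
    (h : ConvergenceConditions P Λ b p a) {𝔅 : Set (Set (Sph d))} (h𝔅c : 𝔅.Countable)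
    (h𝔅m : ∀ B ∈ 𝔅, MeasurableSet B) :
    ∃ μ : Kernel Ω (Sph d), IsLimitingMeasure P Λ 𝔅 μ := by
  have hL := h.isCascade
  have hp := h.two_le
  obtain ⟨C', hC', hcap⟩ := exists_surface_cap_le d
  have hV0 := surfaceMeasure_univ_ne_zero d
  set V := surfaceMeasure d Set.univ with hV
  have hVt : V ≠ ∞ := measure_ne_top _ _
  have hVr : 0 < (surfaceMeasure d).real Set.univ := ENNReal.toReal_pos hV0 hVt
  have hspread := isSpread_cond (A := C' * Real.pi ^ d / (surfaceMeasure d).real Set.univ)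
    MeasurableSet.univ Real.pi_pos hcap hVr le_rfl
    (fun x _ y _ => angDist_le_pi x y) (by rw [div_mul_cancel₀ _ hVr.ne'])
  have hprob := cond_isProbabilityMeasure (μ := surfaceMeasure d) hV0
  obtain ⟨C, hCt, hC⟩ := h.exists_lintegral_mass_rpow_le hd
    (A := C' * Real.pi ^ d / (surfaceMeasure d).real Set.univ)
    (div_nonneg (mul_nonneg hC'.le (pow_nonneg Real.pi_pos.le _)) hVr.le)
  have hbound : ∀ N, ∫⁻ ω, mass (ennField Λ) (surfaceMeasure d) (Finset.range N) ω ^ p ∂P ≤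
      V ^ p * C := by
    intro N
    have h1 : 1 ≤ b ^ (0 + 1) * Real.pi := by
      rw [zero_add, pow_one]
      nlinarith [h.one_lt_scale, Real.pi_gt_three]
    have h2 := hC _ Real.pi hprob Real.pi_pos hspread 0 N h1
    rw [Nat.Ico_zero_eq_range] at h2
    calc _ = ∫⁻ ω, V ^ p * mass (ennField Λ)
            (ProbabilityTheory.cond (surfaceMeasure d) Set.univ) (Finset.range N) ω ^ p ∂P := by
          refine lintegral_congr fun ω => ?_
          rw [← ENNReal.mul_rpow_of_nonneg _ _ (by linarith), ← mass_restrict_eq_mul hV0,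
            Measure.restrict_univ]
      _ = V ^ p * ∫⁻ ω, mass (ennField Λ)
            (ProbabilityTheory.cond (surfaceMeasure d) Set.univ) (Finset.range N) ω ^ p ∂P :=
          lintegral_const_mul _ ((hL.measurable_mass _ _).pow_const _)
      _ ≤ _ := by gcongr
  obtain ⟨μ, hμ⟩ := hL.exists_limit_kernel (by linarith) (ENNReal.mul_ne_top
    (ENNReal.rpow_ne_top_of_nonneg (by linarith) hVt) hCt) hbound
  refine ⟨μ, (ae_ball_iff h𝔅c).2 fun B hB => ?_⟩
  filter_upwards [hμ B (h𝔅m B hB), hL.tendsto_limitMass (surfaceMeasure d) B,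
    h.cumMeasure_eq_mass] with ω h1 h2 h3
  rw [h1]
  exact (h2.comp (tendsto_add_atTop_nat 1)).congr fun n => (h3 n B (h𝔅m B hB)).symm

/-- The moments of the masses of the cells, at the scale `n l` of the fields that belongs to the
level `l`. -/
lemma exists_cell_moment_bounds (hd : 1 ≤ d) (h : ConvergenceConditions P Λ b p a)
    (hiso : IsotropyConditions P Λ p)
    (hsmall : ∀ q ∈ Set.Ioo (0 : ℝ) 1, SmallExponentCondition P Λ b q)
    (hlarge : ∀ q ∈ Set.Icc (1 : ℝ) p, LargeExponentCondition P Λ b k q)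
    {q : ℝ} (hq : q ∈ Set.Icc 0 p) (D : DyadicDecomposition d) {μ : Kernel Ω (Sph d)}
    (hμ : ∀ l m, ∀ᵐ ω ∂P, Tendsto (fun n => cumMeasure Λ n ω (D.cell l m)) atTop
      (𝓝 (μ ω (D.cell l m)))) :
    ∃ (c C : ℝ≥0∞) (n : ℕ → ℕ) (B : ℝ), c ≠ 0 ∧ C ≠ ∞ ∧ ∀ᶠ l : ℕ in atTop,
      |n l - Real.log 2 / Real.log b * l| ≤ B ∧ ∀ m,
      c * (surfaceMeasure d (D.cell l m) ^ q * powMoment P (Λ 0 (northPole d)) q ^ n l) ≤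
        ∫⁻ ω, μ ω (D.cell l m) ^ q ∂P ∧
      ∫⁻ ω, μ ω (D.cell l m) ^ q ∂P ≤
        C * (surfaceMeasure d (D.cell l m) ^ q * powMoment P (Λ 0 (northPole d)) q ^ n l) := by
  obtain ⟨c₁, C₁, δ, hc₁, _, hδ, hD⟩ := D.exists_cell_bounds
  obtain ⟨C', hC', hcap⟩ := exists_surface_cap_le d
  obtain ⟨n, B, hn⟩ := exists_scale h.one_lt_scale hδ
  -- all powers are `1` for `q = 0`
  rcases hq.1.eq_or_lt with rfl | hq0
  · refine ⟨1, 1, n, B, one_ne_zero, ENNReal.one_ne_top, ?_⟩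
    filter_upwards [hn] with l hl
    refine ⟨hl.2.2.2, fun m => ?_⟩
    simp [powMoment]
  obtain ⟨c, C, hc, hC, hb⟩ := exists_moment_bounds hd h hiso hsmall hlarge hq0 hq.2
    (A := C' * δ ^ d / c₁) (by positivity)
  refine ⟨c, C, n, B, hc, hC, ?_⟩
  filter_upwards [hn] with l ⟨h1, h2, h3, h4⟩
  refine ⟨h4, fun m => ?_⟩
  have hcell := D.measurableSet_cell l m
  obtain ⟨hD1, -, hD3⟩ := hD l m
  have hpos : 0 < c₁ * ((1 / 2 : ℝ) ^ l) ^ d := by positivity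
  have hσ0 : surfaceMeasure d (D.cell l m) ≠ 0 := by
    intro h0
    rw [measureReal_def, h0, ENNReal.toReal_zero] at hD1
    linarith
  have hσt : surfaceMeasure d (D.cell l m) ≠ ∞ := measure_ne_top _ _
  have hspread := isSpread_cond (A := C' * δ ^ d / c₁) hcell
    (show 0 < δ * (1 / 2) ^ l by positivity) hcap hpos hD1 hD3
    (le_of_eq (by rw [mul_pow]; field_simp))
  have hY : Measurable fun ω => (surfaceMeasure d (D.cell l m))⁻¹ * μ ω (D.cell l m) :=
    (Kernel.measurable_coe μ hcell).const_mul _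
  have hmain := hb _ _ (n l) (fun ω => (surfaceMeasure d (D.cell l m))⁻¹ * μ ω (D.cell l m))
    (cond_isProbabilityMeasure hσ0) hspread (by positivity) h1 h2 h3 hY.aemeasurable (by
      filter_upwards [h.tendsto_mass_of_tendsto hcell (hμ l m)] with ω hω
      refine (ENNReal.Tendsto.const_mul hω (Or.inr (ENNReal.inv_ne_top.2 hσ0))).congr fun N => ?_
      rw [mass_restrict_eq_mul hσ0, ← mul_assoc, ENNReal.inv_mul_cancel hσ0 hσt, one_mul])
  have he : ∫⁻ ω, μ ω (D.cell l m) ^ q ∂P = surfaceMeasure d (D.cell l m) ^ q *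
      ∫⁻ ω, ((surfaceMeasure d (D.cell l m))⁻¹ * μ ω (D.cell l m)) ^ q ∂P := by
    rw [← lintegral_const_mul _ (hY.pow_const q)]
    refine lintegral_congr fun ω => ?_
    rw [← ENNReal.mul_rpow_of_nonneg _ _ hq0.le, ← mul_assoc, ENNReal.mul_inv_cancel hσ0 hσt,
      one_mul]
  rw [he, mul_left_comm, mul_left_comm C]
  exact ⟨mul_le_mul_right hmain.1 _, mul_le_mul_right hmain.2 _⟩

/-- The partition sums of the Rényi function are of the exact order given by the number of cells,
their measure and the moments of the fields. -/
lemma hasExpGrowth_sum_moment (hd : 1 ≤ d) (h : ConvergenceConditions P Λ b p a)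
    (hiso : IsotropyConditions P Λ p)
    (hsmall : ∀ q ∈ Set.Ioo (0 : ℝ) 1, SmallExponentCondition P Λ b q)
    (hlarge : ∀ q ∈ Set.Icc (1 : ℝ) p, LargeExponentCondition P Λ b k q)
    {q : ℝ} (hq : q ∈ Set.Icc 0 p) (D : DyadicDecomposition d) {μ : Kernel Ω (Sph d)}
    (hμ : ∀ l m, ∀ᵐ ω ∂P, Tendsto (fun n => cumMeasure Λ n ω (D.cell l m)) atTop
      (𝓝 (μ ω (D.cell l m)))) :
    HasExpGrowth (fun l => ∑ m, ∫⁻ ω, μ ω (D.cell l m) ^ q ∂P)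
      (d * Real.log 2 + (-(d * Real.log 2) * q + Real.log 2 / Real.log b *
        Real.log (powMoment P (Λ 0 (northPole d)) q).toReal)) := by
  obtain ⟨c, C, n, B, hc, hC, hb⟩ := exists_cell_moment_bounds hd h hiso hsmall hlarge hq D hμ
  obtain ⟨c', C', hc0, hct, hC0, hCt, hD⟩ := D.exists_surfaceMeasure_cell_bounds
  have hK := hasExpGrowth_pow (h.powMoment_ne_zero q 0 (northPole d))
    (h.powMoment_ne_top hq 0 (northPole d)) (hb.mono fun l hl => hl.1)
  refine (D.hasExpGrowth_card.mul (((hasExpGrowth_half_pow d).rpow q).mul hK)).of_le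
    (c := c * c' ^ q) (C := C * C' ^ q)
    (mul_ne_zero hc (ENNReal.rpow_pos (pos_iff_ne_zero.2 hc0) hct).ne')
    (ENNReal.mul_ne_top hC (ENNReal.rpow_ne_top_of_nonneg hq.1 hCt)) ?_
  filter_upwards [hb] with l ⟨_, hl⟩
  set R := ENNReal.ofReal (((1 / 2) ^ l) ^ d)
  set K := powMoment P (Λ 0 (northPole d)) q ^ n l
  have hcard : ∀ x y : ℝ≥0∞, x * y ^ q * (((D.last l + 1 : ℕ) : ℝ≥0∞) * (R ^ q * K)) =
      ∑ _m : Fin (D.last l + 1), x * ((y * R) ^ q * K) := by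
    intro x y
    rw [Finset.sum_const, Finset.card_univ, Fintype.card_fin, nsmul_eq_mul,
      ENNReal.mul_rpow_of_nonneg _ _ hq.1]
    ring
  rw [hcard, hcard]
  refine ⟨Finset.sum_le_sum fun m _ => le_trans ?_ (hl m).1,
    Finset.sum_le_sum fun m _ => (hl m).2.trans ?_⟩
  · gcongr
    · exact hq.1
    · exact (hD l m).1
  · gcongr
    · exact hq.1
    · exact (hD l m).2

end

theorem theorem3 {Ω : Type*} [MeasurableSpace Ω] (P : Measure Ω) [IsProbabilityMeasure P]
    (d : ℕ) (hd : 1 ≤ d) (Λ : ℕ → Sph d → Ω → ℝ) (b p : ℝ) (k : ℕ) (a : Fin k → ℝ)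
    (hconv : ConvergenceConditions P Λ b p a)
    (hiso : IsotropyConditions P Λ p)
    (hsmall : ∀ q ∈ Set.Ioo (0 : ℝ) 1, SmallExponentCondition P Λ b q)
    (hlarge : ∀ q ∈ Set.Icc (1 : ℝ) p, LargeExponentCondition P Λ b k q)
    (𝔅 : Set (Set (Sph d))) (h𝔅c : 𝔅.Countable) (h𝔅m : ∀ B ∈ 𝔅, MeasurableSet B)
    (D : DyadicDecomposition d) (hD : ∀ l m, D.cell l m ∈ 𝔅) :
    (∃ μ : Kernel Ω (Sph d), IsLimitingMeasure P Λ 𝔅 μ) ∧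
    ∀ μ : Kernel Ω (Sph d), IsLimitingMeasure P Λ 𝔅 μ → ∀ q ∈ Set.Icc (0 : ℝ) p,
      renyi P D μ q =
        ((q - 1 - 1 / (d : ℝ) * Real.logb b (∫ ω, (Λ 0 (northPole d) ω) ^ q ∂P) : ℝ) : EReal) :=
  by
  refine ⟨hconv.exists_isLimitingMeasure hd h𝔅c h𝔅m, fun μ hμ q hq => ?_⟩
  have hS := hasExpGrowth_sum_moment hd hconv hiso hsmall hlarge hq D
    (fun l m => hμ.mono fun ω hω => hω _ (hD l m))
  obtain ⟨c, C, hc0, -, -, hCt, hcell⟩ := D.exists_surfaceMeasure_cell_bounds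
  have hT := (hasExpGrowth_half_pow d).of_le (T := fun l => surfaceMeasure d (D.cell l 0)) hc0 hCt
    (Eventually.of_forall fun l => hcell l 0)
  have hd0 : (d : ℝ) ≠ 0 := by exact_mod_cast (by omega : d ≠ 0)
  have hlog2 : Real.log 2 ≠ 0 := (Real.log_pos one_lt_two).ne'
  have hlogb : Real.log b ≠ 0 := (Real.log_pos hconv.one_lt_scale).ne'
  rw [renyi, hS.liminf_log_div_log hT (neg_ne_zero.2 (mul_ne_zero hd0 hlog2)),
    hconv.integral_rpow_eq hq.1, Real.logb]
  congr 1
  field_simp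
  ring
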